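/- Let $n\ge 1$, $j\ge 1$. Write $e_{kl}$ for the elementary $(2n+1)\times(2n+1)$ matrices, $e_1=(1,0,\dots,0)^t$, and let $\mathbb{R}^{n+1,n}$ be $\mathbb{R}^{2n+1}$ with the form $\langle X,Y\rangle=X^tC_nY$, $C_n=\sum_{i=1}^{2n+1}(-1)^{n+i-1}e_{i,2n+2-i}$. Let $O(n+1,n)$ be the group of all linear isomorphisms preserving this form and $o(n+1,n)=\{A\in sl(2n+1,\mathbb{R}) : A^tC_n+C_nA=0\}$. Put $$b=\sum_{i=1}^{2n}e_{i+1,i},\qquad \beta_i=e_{n+1-i,n+i}+e_{n+2-i,n+1+i},\qquad V_n=\bigoplus_{i=1}^n\mathbb{R}\beta_i .$$ *Curves.* $\mathcal{M}_{n+1,n}$ is the set of smooth $\gamma:\mathbb{R}\to\mathbb{R}^{n+1,n}$ such that, at every $x$, the vectors $\gamma,\gamma',\dots,\gamma^{(2n)}$ are linearly independent, $\gamma,\dots,\gamma^{(n-1)}$ span a maximal isotropic subspace, and $\langle\gamma^{(n)},\gamma^{(n)}\rangle=1$. The isotropic moving frame along $\gamma\in\mathcal{M}_{n+1,n}$ is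 the unique smooth $g:\mathbb{R}\to O(n+1,n)$ whose first $n+1$ columns are $\gamma,\gamma',\dots,\gamma^{(n)}$ and for which $u:=g^{-1}g_x-b$ takes values in $V_n$. The isotropic curvature map is $\Psi:\mathcal{M}_{n+1,n}\to C^\infty(\mathbb{R},V_n)$, $\Psi(\gamma)=u$. *B-type.* Let $J_B=b+\beta\lambda$ with $\beta=\frac12(e_{1,2n}+e_{2,2n+1})$. For $u\in C^\infty(\mathbb{R},V_n)$ let $P(u,\lambda)=\sum_{i\le m_0}P_{1,i}(u)\lambda^i$, with smooth coefficients in $o(n+1,n)$, be the unique formal series that satisfies $[\partial_x+J_B+u,P(u,\lambda)]=0$, is (at each $x$) conjugate to $J_B$ by an invertible matrix over the field $\mathbb{R}((\lambda^{-1}))$, and has $\beta$ as its coefficient of $\lambda^1$. Write $P(u,\lambda)^{2j-1}=\sum_iP_{2j-1,i}(u)\lambda^i$, and let $\eta_j(u)$ be the unique smooth map into the strictly upper triangular matrices of $o(n+1,n)$ with $[\partial_x+b+u,P_{2j-1,0}(u)-\eta_j(u)]\in V_n$. Set $Q^B_j(u)=P_{2j-1,0}(u)-\eta_j(u)$. *A-type.*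 Let $J=b+e_{1,2n+1}\lambda$, and for $u\in C^\infty(\mathbb{R},V_n)$ let $S(u,\lambda)=\sum_{i\le m_0}S_{1,i}(u)\lambda^i$, with smooth coefficients in $sl(2n+1,\mathbb{R})$, be the unique formal series with $C_nS(u,-\lambda)^tC_n+S(u,\lambda)=0$ and $[\partial_x+J+u,S(u,\lambda)]=0$ that is (at each $x$) conjugate to $J$ over $\mathbb{R}((\lambda^{-1}))$. Define $S_{2j-1,0}(u)$, $\tilde\eta_j(u)$ as above, with $S$ in place of $P$, and set $Q^A_j(u)=S_{2j-1,0}(u)-\tilde\eta_j(u)$. *Flows.* For $Q=Q^B_j$ (respectively $Q=Q^A_j$), a solution of the $(2j-1)$-th isotropic curve flow of B-type (respectively A-type) is a smooth $\gamma:\mathbb{R}^2\to\mathbb{R}^{n+1,n}$, $(x,t)\mapsto\gamma(x,t)$, with $\gamma(\cdot,t)\in\mathcal{M}_{n+1,n}$ for all $t$ and $$\gamma_t=g\,Q(u)\,e_1,$$ where $g(\cdot,t)$, $u(\cdot,t)$ are the isotropic moving frame and isotropic curvature of $\gamma(\cdot,t)$. A solution of the $(2j-1)$-th $\hat B_n^{(1)}$-KdV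 (respectively $\hat A_{2n}^{(2)}$-KdV) flow is a smooth $u:\mathbb{R}^2\to V_n$ with $$u_t=[\partial_x+b+u,\,Q(u)]=Q(u)_x+[b+u,Q(u)].$$ **Statement.** The space of solutions of the $(2j-1)$-th isotropic curve flow of B-type is invariant under $O(n+1,n)$, acting by $(c\cdot\gamma)(x,t)=c\,\gamma(x,t)$, and $\gamma\mapsto\big((x,t)\mapsto\Psi(\gamma(\cdot,t))(x)\big)$ induces a well-defined bijection from the space of these solutions modulo $O(n+1,n)$ onto the space of solutions of the $(2j-1)$-th $\hat B_n^{(1)}$-KdV flow. If moreover $2j-1\not\equiv0\pmod{2n+1}$, the same holds with A-type in place of B-type and the $\hat A_{2n}^{(2)}$-KdV flow in place of the $\hat B_n^{(1)}$-KdV flow. -/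

import Mathlib

open scoped ContDiff Matrix

noncomputable section

namespace IsotropicFlow

/-! ### Matrices of size `2n+1` and the form on `ℝ^{n+1,n}` -/

/-- Index type of the standard basis of `ℝ^{2n+1}`. -/
abbrev Idx (n : ℕ) := Fin (2 * n + 1)

/-- Vectors of `ℝ^{2n+1}`. -/
abbrev Vec (n : ℕ) := Idx n → ℝ

/-- Real `(2n+1) × (2n+1)` matrices. -/
abbrev Mat (n : ℕ) := Matrix (Idx n) (Idx n) ℝ

/-- The elementary matrix `e_{ab}`; here `a` and `b` are counted from `1` to `2n+1`. -/
def E (n a b : ℕ) : Mat n :=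
  Matrix.of fun i j => if (i : ℕ) + 1 = a ∧ (j : ℕ) + 1 = b then 1 else 0

/-- The first standard basis vector `e₁`. -/
def e₁ (n : ℕ) : Vec n := Pi.single 0 1

/-- `C_n = ∑_{i=1}^{2n+1} (-1)^{n+i-1} e_{i,2n+2-i}`. -/
def C (n : ℕ) : Mat n :=
  ∑ i ∈ Finset.Icc 1 (2 * n + 1), (-1 : ℝ) ^ (n + i - 1) • E n i (2 * n + 2 - i)

/-- The bilinear form `⟨X, Y⟩ = Xᵗ C_n Y`. -/
def form (n : ℕ) (X Y : Vec n) : ℝ := X ⬝ᵥ (C n *ᵥ Y)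

/-- The matrix `A` preserves the form. -/
def IsOrtho (n : ℕ) (A : Mat n) : Prop := Aᵀ * C n * A = C n

/-- The group `O(n+1,n)` of all linear isomorphisms that preserve the form. -/
def O (n : ℕ) : Subgroup (GL (Idx n) ℝ) where
  carrier := {c | IsOrtho n (c : Mat n)}
  one_mem' := by simp [IsOrtho]
  mul_mem' := by
    intro a b ha hb
    simp only [Set.mem_ofPred_eq, IsOrtho, Units.val_mul, Matrix.transpose_mul] at *
    calc (b : Mat n)ᵀ * (a : Mat n)ᵀ * C n * ((a : Mat n) * (b : Mat n))
        = (b : Mat n)ᵀ * ((a : Mat n)ᵀ * C n * (a : Mat n)) * (b : Mat n) := by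
          simp only [Matrix.mul_assoc]
      _ = C n := by rw [ha, hb]
  inv_mem' := by
    intro a ha
    simp only [Set.mem_ofPred_eq, IsOrtho] at *
    have h1 : (a : Mat n) * ((a⁻¹ : GL (Idx n) ℝ) : Mat n) = 1 := a.mul_inv
    have h2 : ((a⁻¹ : GL (Idx n) ℝ) : Mat n)ᵀ * (a : Mat n)ᵀ = 1 := by
      rw [← Matrix.transpose_mul, h1, Matrix.transpose_one]
    calc ((a⁻¹ : GL (Idx n) ℝ) : Mat n)ᵀ * C n * ((a⁻¹ : GL (Idx n) ℝ) : Mat n)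
        = ((a⁻¹ : GL (Idx n) ℝ) : Mat n)ᵀ * ((a : Mat n)ᵀ * C n * (a : Mat n)) *
            ((a⁻¹ : GL (Idx n) ℝ) : Mat n) := by rw [ha]
      _ = (((a⁻¹ : GL (Idx n) ℝ) : Mat n)ᵀ * (a : Mat n)ᵀ) * C n *
            ((a : Mat n) * ((a⁻¹ : GL (Idx n) ℝ) : Mat n)) := by
          simp only [Matrix.mul_assoc]
      _ = C n := by rw [h1, h2, one_mul, mul_one]

/-- The Lie algebra `o(n+1,n)`. -/
def so (n : ℕ) : Set (Mat n) := {A | A.trace = 0 ∧ Aᵀ * C n + C n * A = 0}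

/-- The subalgebra of strictly upper triangular matrices in `o(n+1,n)`. -/
def nilUpper (n : ℕ) : Set (Mat n) := {A | A ∈ so n ∧ ∀ i j, j ≤ i → A i j = 0}

/-- `b = ∑_{i=1}^{2n} e_{i+1,i}`. -/
def b (n : ℕ) : Mat n := ∑ i ∈ Finset.Icc 1 (2 * n), E n (i + 1) i

/-- `β_i = e_{n+1-i,n+i} + e_{n+2-i,n+1+i}` for `1 ≤ i ≤ n`. -/
def βmat (n i : ℕ) : Mat n := E n (n + 1 - i) (n + i) + E n (n + 2 - i) (n + 1 + i)

/-- `V_n`, the span of `β_1, …, β_n`. -/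
def V (n : ℕ) : Submodule ℝ (Mat n) := Submodule.span ℝ (βmat n '' Set.Icc 1 n)

/-! ### Isotropic curves, moving frames and curvature -/

/-- A subspace on which the form vanishes identically. -/
def IsIsotropic (n : ℕ) (W : Submodule ℝ (Vec n)) : Prop := ∀ X ∈ W, ∀ Y ∈ W, form n X Y = 0

/-- Isotropic curves: smooth, with `γ, γ', …, γ^{(2n)}` linearly independent and with
`γ, …, γ^{(n-1)}` spanning a maximal isotropic subspace, at every parameter. -/
def IsIsotropicCurve (n : ℕ) (γ : ℝ → Vec n) : Prop :=
  ContDiff ℝ ∞ γ ∧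
  (∀ x, LinearIndependent ℝ (fun k : Fin (2 * n + 1) => iteratedDeriv k γ x)) ∧
  ∀ x, Maximal (IsIsotropic n)
    (Submodule.span ℝ (Set.range fun k : Fin n => iteratedDeriv k γ x))

/-- The space `M_{n+1,n}` of isotropic curves in isotropic parameter. -/
def M (n : ℕ) : Set (ℝ → Vec n) :=
  {γ | IsIsotropicCurve n γ ∧ ∀ x, form n (iteratedDeriv n γ x) (iteratedDeriv n γ x) = 1}

/-- Smoothness of a matrix valued map, entry by entry. -/
def MatSmooth {F : Type*} [NormedAddCommGroup F] [NormedSpace ℝ F] (n : ℕ) (A : F → Mat n) :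
    Prop :=
  ∀ i j, ContDiff ℝ ∞ (fun x => A x i j)

/-- The derivative of a matrix valued function of a real variable, entry by entry. -/
def matDeriv {n : ℕ} (A : ℝ → Mat n) (x : ℝ) : Mat n :=
  Matrix.of fun i j => deriv (fun y => A y i j) x

/-- `g` is an isotropic moving frame along `γ`: smooth with values in `O(n+1,n)`, its first
`n+1` columns are `γ, γ', …, γ^{(n)}`, and `g⁻¹ g_x` takes values in `b + V_n`. -/
def IsMovingFrame (n : ℕ) (γ : ℝ → Vec n) (g : ℝ → Mat n) : Prop :=
  MatSmooth n g ∧ (∀ x, IsOrtho n (g x)) ∧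
  (∀ x, ∀ k : Idx n, (k : ℕ) ≤ n → (g x).col k = iteratedDeriv k γ x) ∧
  ∀ x, (g x)⁻¹ * matDeriv g x - b n ∈ V n

/-- The (unique) isotropic moving frame along a curve `γ` of `M_{n+1,n}`. -/
def movingFrame (n : ℕ) (γ : ℝ → Vec n) : ℝ → Mat n := Classical.epsilon (IsMovingFrame n γ)

/-- The isotropic curvature map `Ψ(γ) = g⁻¹ g_x - b`. -/
def Ψ (n : ℕ) (γ : ℝ → Vec n) (x : ℝ) : Mat n :=
  (movingFrame n γ x)⁻¹ * matDeriv (movingFrame n γ) x - b n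

/-! ### Formal loops `∑_{i ≤ m} ξ_i λ^i` -/

/-- Matrices over the field of formal series `∑_{i ≤ m} a_i λ^i` with real coefficients, which
is the field of Laurent series in the variable `λ⁻¹`. -/
abbrev LoopMat (n : ℕ) := Matrix (Idx n) (Idx n) (LaurentSeries ℝ)

/-- The loop parameter `λ`, the inverse of the variable of the Laurent series. -/
def lam : LaurentSeries ℝ := HahnSeries.single (-1 : ℤ) (1 : ℝ)

/-- A real matrix as a constant loop. -/
def constLoop {n : ℕ} (A : Mat n) : LoopMat n := A.map (HahnSeries.C : ℝ →+* LaurentSeries ℝ)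

/-- The coefficient of `λ^k`. -/
def loopCoeff {n : ℕ} (ξ : LoopMat n) (k : ℤ) : Mat n := ξ.map fun f => f.coeff (-k)

/-- Smooth maps from `ℝ` to formal loops: all coefficients are smooth, and the degrees in `λ`
are bounded above. -/
def IsSmoothLoop (n : ℕ) (P : ℝ → LoopMat n) : Prop :=
  (∀ k : ℤ, MatSmooth n fun x => loopCoeff (P x) k) ∧
  ∃ m : ℤ, ∀ x, ∀ k : ℤ, m < k → loopCoeff (P x) k = 0

/-- `[∂_x + J + u, P] = 0`, coefficient by coefficient in `λ`. -/
def CommutesWith (n : ℕ) (J : LoopMat n) (u : ℝ → Mat n) (P : ℝ → LoopMat n) : Prop :=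
  ∀ x, ∀ k : ℤ, matDeriv (fun y => loopCoeff (P y) k) x +
    loopCoeff ((J + constLoop (u x)) * P x - P x * (J + constLoop (u x))) k = 0

/-! ### The `B`-type resolvent -/

/-- The loop algebra `B̂_n^{(1)}`: all coefficients lie in `o(n+1,n)`. -/
def BLoop (n : ℕ) : Set (LoopMat n) := {ξ | ∀ k, loopCoeff ξ k ∈ so n}

/-- `β = (e_{1,2n} + e_{2,2n+1}) / 2`. -/
def βB (n : ℕ) : Mat n := (1 / 2 : ℝ) • (E n 1 (2 * n) + E n 2 (2 * n + 1))

/-- `J_B = b + β λ`. -/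
def JB (n : ℕ) : LoopMat n := constLoop (b n) + lam • constLoop (βB n)

/-- `P = P(u, λ)` commutes with `∂_x + J_B + u` and is conjugate to `J_B`. As `-J_B` is conjugate
to `J_B` too, these two conditions leave the sign of `P` open; it is fixed by the requirement
that `P` has the same coefficient of `λ` as `J_B`. -/
def IsP (n : ℕ) (u : ℝ → Mat n) (P : ℝ → LoopMat n) : Prop :=
  IsSmoothLoop n P ∧ (∀ x, P x ∈ BLoop n) ∧ CommutesWith n (JB n) u P ∧
  (∀ x, IsConj (JB n) (P x)) ∧ ∀ x, loopCoeff (P x) 1 = βB n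

/-- The (unique) solution `P(u, λ)`. -/
def P (n : ℕ) (u : ℝ → Mat n) : ℝ → LoopMat n := Classical.epsilon (IsP n u)

/-- `P_{m,i}(u)`, the coefficient of `λ^i` in `P(u, λ)^m`. -/
def Pcoeff (n m : ℕ) (i : ℤ) (u : ℝ → Mat n) (x : ℝ) : Mat n := loopCoeff (P n u x ^ m) i

/-! ### The `A`-type resolvent -/

/-- The loop algebra `Â_{2n}^{(2)}`: coefficients in `sl(2n+1,ℝ)`, with
`C_n ξ(-λ)ᵗ C_n + ξ(λ) = 0`. -/
def ALoop (n : ℕ) : Set (LoopMat n) :=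
  {ξ | ∀ k : ℤ, (loopCoeff ξ k).trace = 0 ∧
    (-1 : ℝ) ^ k • (C n * (loopCoeff ξ k)ᵀ * C n) + loopCoeff ξ k = 0}

/-- `J = b + e_{1,2n+1} λ`. -/
def JA (n : ℕ) : LoopMat n := constLoop (b n) + lam • constLoop (E n 1 (2 * n + 1))

/-- `S = S(u, λ)` takes values in `Â_{2n}^{(2)}`, commutes with `∂_x + J + u` and is conjugate
to `J`. -/
def IsS (n : ℕ) (u : ℝ → Mat n) (S : ℝ → LoopMat n) : Prop :=
  IsSmoothLoop n S ∧ (∀ x, S x ∈ ALoop n) ∧ CommutesWith n (JA n) u S ∧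
  ∀ x, IsConj (JA n) (S x)

/-- The (unique) solution `S(u, λ)`. -/
def S (n : ℕ) (u : ℝ → Mat n) : ℝ → LoopMat n := Classical.epsilon (IsS n u)

/-- `S_{m,i}(u)`, the coefficient of `λ^i` in `S(u, λ)^m`. -/
def Scoeff (n m : ℕ) (i : ℤ) (u : ℝ → Mat n) (x : ℝ) : Mat n := loopCoeff (S n u x ^ m) i

/-! ### The flows -/

/-- `[∂_x + b + u, A] = A_x + (b + u) A - A (b + u)`. -/
def brk (n : ℕ) (u A : ℝ → Mat n) (x : ℝ) : Mat n :=
  matDeriv A x + ((b n + u x) * A x - A x * (b n + u x))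

/-- `η` is smooth, strictly upper triangular in `o(n+1,n)`, and `[∂_x + b + u, A - η]` takes
values in `V_n`. -/
def IsCorrection (n : ℕ) (u A η : ℝ → Mat n) : Prop :=
  MatSmooth n η ∧ (∀ x, η x ∈ nilUpper n) ∧ ∀ x, brk n u (fun y => A y - η y) x ∈ V n

/-- The (unique) correction term of `A = P_{2j-1,0}(u)` (where it is called `η_j(u)`) or of
`A = S_{2j-1,0}(u)` (where it is called `η̃_j(u)`). -/
def correction (n : ℕ) (u A : ℝ → Mat n) : ℝ → Mat n := Classical.epsilon (IsCorrection n u A)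

/-- `P_{2j-1,0}(u) - η_j(u)`. -/
def QB (n j : ℕ) (u : ℝ → Mat n) (x : ℝ) : Mat n :=
  Pcoeff n (2 * j - 1) 0 u x - correction n u (Pcoeff n (2 * j - 1) 0 u) x

/-- `S_{2j-1,0}(u) - η̃_j(u)`. -/
def QA (n j : ℕ) (u : ℝ → Mat n) (x : ℝ) : Mat n :=
  Scoeff n (2 * j - 1) 0 u x - correction n u (Scoeff n (2 * j - 1) 0 u) x

/-- Smooth solutions `γ(x,t)` on `ℝ²` of the isotropic curve flow `γ_t = g Q(u) e₁`, where
`g(·,t)` and `u(·,t)` are the isotropic moving frame and the isotropic curvature along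
`γ(·,t) ∈ M_{n+1,n}`. -/
def CurveFlow (n : ℕ) (Q : (ℝ → Mat n) → ℝ → Mat n) : Set (ℝ × ℝ → Vec n) :=
  {γ | ContDiff ℝ ∞ γ ∧ (∀ t, (fun x => γ (x, t)) ∈ M n) ∧
    ∀ x t, deriv (fun s => γ (x, s)) t =
      (movingFrame n (fun y => γ (y, t)) x * Q (Ψ n fun y => γ (y, t)) x) *ᵥ e₁ n}

/-- Smooth solutions `u(x,t) ∈ V_n` on `ℝ²` of the flow `u_t = [∂_x + b + u, Q(u)]`. -/
def KdVFlow (n : ℕ) (Q : (ℝ → Mat n) → ℝ → Mat n) : Set (ℝ × ℝ → Mat n) :=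
  {u | MatSmooth n u ∧ (∀ p, u p ∈ V n) ∧
    ∀ x t, matDeriv (fun s => u (x, s)) t =
      brk n (fun y => u (y, t)) (Q fun y => u (y, t)) x}

/-- Two maps of a set `X` are equivalent when an element of `O(n+1,n)` carries one to the
other. -/
def orbitSetoid (n : ℕ) (X : Set (ℝ × ℝ → Vec n)) : Setoid X where
  r γ δ := ∃ c ∈ O n, ∀ p, δ.1 p = (c : Mat n) *ᵥ γ.1 p
  iseqv :=
    { refl := fun γ => ⟨1, (O n).one_mem, fun p => by simp⟩
      symm := by
        rintro γ δ ⟨c, hc, h⟩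
        refine ⟨c⁻¹, (O n).inv_mem hc, fun p => ?_⟩
        have h1 : ((c⁻¹ : GL (Idx n) ℝ) : Mat n) * (c : Mat n) = 1 := c.inv_mul
        rw [h p, Matrix.mulVec_mulVec, h1, Matrix.one_mulVec]
      trans := by
        rintro γ δ ε ⟨c, hc, h⟩ ⟨d, hd, k⟩
        refine ⟨d * c, (O n).mul_mem hd hc, fun p => ?_⟩
        rw [k p, h p, Matrix.mulVec_mulVec, Units.val_mul] }

/-- The set `X` modulo `O(n+1,n)`. -/
abbrev ModO (n : ℕ) (X : Set (ℝ × ℝ → Vec n)) := Quotient (orbitSetoid n X)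

/-- The class modulo `O(n+1,n)` of an element of `X`. -/
def cls {n : ℕ} {X : Set (ℝ × ℝ → Vec n)} (γ : X) : ModO n X := Quotient.mk (orbitSetoid n X) γ

/-- The set `X` is carried into itself by `O(n+1,n)`. -/
def OInvariant (n : ℕ) (X : Set (ℝ × ℝ → Vec n)) : Prop :=
  ∀ c ∈ O n, ∀ γ ∈ X, (fun p => (c : Mat n) *ᵥ γ p) ∈ X

end IsotropicFlow

end

open IsotropicFlow

/-! A curve in `M n` and its moving frame carry the same information, and for the frame the curve
flow becomes a zero curvature equation. Functions of (x,t) are treated as elements of one ring `Sm`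
with two commuting derivations. Frames, resolvents and corrections are matrices over it, so smooth
dependence on t is built in.

Let g be a frame, gᵀCg = C and g_x = g(b+u), and put A = g⁻¹g_t. Since the derivations commute, u_t
= [∂_x+b+u, A], and this lies in V_n because u does. A matrix of o(n+1,n) whose bracket with ∂_x+b+u
lies in V_n is determined by its first column (`eq_zero_of_brkM`): each column of the bracket
determines the next column of the matrix, and skewness fixes the free V_n coefficient. Q(u) has the
same two properties, and γ_t = gQe₁ says exactly that A and Q have the same first column. So A = Q,
and u solves the KdV flow (`IsFrame.evolution`). Conversely, the KdV flow is the flatness of the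
connection g_x = g(b+u), g_t = gQ. Integrating it gives a frame (`exists_isFrame_of_flat`) whose
first column solves the curve flow. Two solutions with the same u have frames solving the same
linear system, so these differ by a constant left factor in O(n+1,n). This is `correspondence`,
valid for every Q with `IsFlowOp`.

What remains is that the objects named by a choice exist and are unique. Frames (`exists_frame`,
`frame_unique`) and corrections (`exists_correction`, `IsCorrection.eq`) are built column by column:
the derivative of a column gives the next one, orthogonality or skewness propagates by the equation
itself, and the single remaining defect is removed by the V_n coefficient.

For the resolvents, λ gets degree M and e_{ij} degree i-j, with M = 2n in type B and M = 2n+1 in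
type A. Then J has degree 1 and J^{M+1} = λJ. Dressing conjugates ∂_x+J+u to ∂_x+J+H with H
commuting with J, and S = TJT⁻¹ is a resolvent. Conversely, a loop conjugate to J satisfies X^{M+1}
= λX. Together with the differential equation this bounds the degree by 1, makes the leading term a
multiple aJ, and, once a = 1, determines X by linearization at J. Uniqueness also yields the
symmetry of the resolvent, as X(λ) ↦ -C X(±λ)ᵗ C maps solutions to solutions. -/

noncomputable section

namespace IsotropicFlow

/-! ### The differential ring of smooth functions on the plane -/

/-- The algebra of smooth real functions on the plane. -/
def smoothAlg : Subalgebra ℝ (ℝ × ℝ → ℝ) where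
  carrier := {f | ContDiff ℝ ∞ f}
  mul_mem' := by
    intro a b ha hb
    simp only [Set.mem_ofPred_eq] at *
    exact ha.mul hb
  add_mem' := by
    intro a b ha hb
    simp only [Set.mem_ofPred_eq] at *
    exact ha.add hb
  algebraMap_mem' := by
    intro r
    simp only [Set.mem_ofPred_eq]
    exact contDiff_const

/-- The ring of smooth real functions on the plane. -/
abbrev Sm : Type := smoothAlg

theorem Sm.contDiff (f : Sm) : ContDiff ℝ ∞ (f : ℝ × ℝ → ℝ) := f.2

theorem Sm.differentiableAt (f : Sm) (p : ℝ × ℝ) : DifferentiableAt ℝ (f : ℝ × ℝ → ℝ) p :=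
  f.contDiff.contDiffAt.differentiableAt (by simp)

/-- The derivative in the direction `v`, as a linear map of the ring of smooth functions. -/
def dirDerivLin (v : ℝ × ℝ) : Sm →ₗ[ℝ] Sm where
  toFun f := ⟨fun p => fderiv ℝ (f : ℝ × ℝ → ℝ) p v,
    (f.contDiff.fderiv_right (m := ∞) (by simp)).clm_apply contDiff_const⟩
  map_add' f g := by
    ext p
    have : ((f + g : Sm) : ℝ × ℝ → ℝ) = fun p => f.1 p + g.1 p := rfl
    simp only [this]
    rw [fderiv_fun_add (f.differentiableAt p) (g.differentiableAt p)]
    rfl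
  map_smul' c f := by
    ext p
    have : ((c • f : Sm) : ℝ × ℝ → ℝ) = fun p => c • f.1 p := rfl
    simp only [this]
    rw [fderiv_fun_const_smul (f.differentiableAt p)]
    rfl

theorem dirDerivLin_apply (v : ℝ × ℝ) (f : Sm) (p : ℝ × ℝ) :
    (dirDerivLin v f : ℝ × ℝ → ℝ) p = fderiv ℝ (f : ℝ × ℝ → ℝ) p v := rfl

/-- The derivative in the direction `v`, as a derivation of the ring of smooth functions. -/
def dirDeriv (v : ℝ × ℝ) : Derivation ℝ Sm Sm :=
  Derivation.mk' (dirDerivLin v) fun f g => by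
    apply Subtype.ext
    funext p
    have h1 : ((f • dirDerivLin v g + g • dirDerivLin v f : Sm) : ℝ × ℝ → ℝ) p =
      f.1 p * fderiv ℝ g.1 p v + g.1 p * fderiv ℝ f.1 p v := rfl
    have h2 : ((f * g : Sm) : ℝ × ℝ → ℝ) = fun p => f.1 p * g.1 p := rfl
    rw [h1, dirDerivLin_apply, h2, fderiv_fun_mul (f.differentiableAt p) (g.differentiableAt p)]
    simp

/-- Symmetry of the second derivative. It is the source of the zero curvature equation for frames.
-/
theorem dirDeriv_comm (v w : ℝ × ℝ) (f : Sm) :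
    dirDeriv v (dirDeriv w f) = dirDeriv w (dirDeriv v f) := by
  have key : ∀ (v w : ℝ × ℝ) (p : ℝ × ℝ),
      (dirDeriv v (dirDeriv w f) : ℝ × ℝ → ℝ) p = fderiv ℝ (fderiv ℝ f.1) p v w := by
    intro v w p
    have h : DifferentiableAt ℝ (fderiv ℝ f.1) p :=
      (f.contDiff.fderiv_right (m := ∞) (by simp)).contDiffAt.differentiableAt (by simp)
    change fderiv ℝ (fun q => fderiv ℝ f.1 q w) p v = _
    rw [fderiv_clm_apply h (differentiableAt_const w)]
    simp
  ext p
  rw [key, key]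
  refine (f.contDiff.contDiffAt.isSymmSndFDerivAt ?_) v w
  rw [minSmoothness_of_isRCLikeNormedField]
  exact WithTop.coe_le_coe.2 (le_top : (2 : ℕ∞) ≤ ⊤)

/-- The derivative in `x`. -/
def dX : Derivation ℝ Sm Sm := dirDeriv (1, 0)

/-- The derivative in `t`. -/
def dT : Derivation ℝ Sm Sm := dirDeriv (0, 1)

theorem dX_dT (f : Sm) : dX (dT f) = dT (dX f) := dirDeriv_comm _ _ f

theorem Sm.hasDerivAt_x (f : Sm) (x t : ℝ) :
    HasDerivAt (fun y => (f : ℝ × ℝ → ℝ) (y, t)) ((dX f : ℝ × ℝ → ℝ) (x, t)) x := by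
  have h := (f.differentiableAt (x, t)).hasFDerivAt
  have h2 : HasDerivAt (fun y : ℝ => (y, t)) ((1 : ℝ), (0 : ℝ)) x :=
    (hasDerivAt_id x).prodMk (hasDerivAt_const x t)
  exact h.comp_hasDerivAt x h2

theorem Sm.hasDerivAt_t (f : Sm) (x t : ℝ) :
    HasDerivAt (fun s => (f : ℝ × ℝ → ℝ) (x, s)) ((dT f : ℝ × ℝ → ℝ) (x, t)) t := by
  have h := (f.differentiableAt (x, t)).hasFDerivAt
  have h2 : HasDerivAt (fun y : ℝ => (x, y)) ((0 : ℝ), (1 : ℝ)) t :=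
    (hasDerivAt_const t x).prodMk (hasDerivAt_id t)
  exact h.comp_hasDerivAt t h2

/-- Evaluation of smooth functions at a point. -/
def ev (p : ℝ × ℝ) : Sm →+* ℝ := (Pi.evalRingHom (fun _ : ℝ × ℝ => ℝ) p).comp smoothAlg.val.toRingHom

@[simp] theorem ev_algebraMap (p : ℝ × ℝ) (c : ℝ) : ev p (algebraMap ℝ Sm c) = c := rfl

theorem Sm.ext_ev {f g : Sm} (h : ∀ p, ev p f = ev p g) : f = g := Subtype.ext (funext h)

theorem ev_dX (f : Sm) (x t : ℝ) : ev (x, t) (dX f) = deriv (fun y => ev (y, t) f) x :=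
  (f.hasDerivAt_x x t).deriv.symm

theorem ev_dT (f : Sm) (x t : ℝ) : ev (x, t) (dT f) = deriv (fun s => ev (x, s) f) t :=
  (f.hasDerivAt_t x t).deriv.symm

/-- Matrices over the ring of smooth functions. -/
abbrev SMat (n : ℕ) := Matrix (Idx n) (Idx n) Sm

/-- Evaluation of a matrix of smooth functions at a point. -/
def evM {n : ℕ} (p : ℝ × ℝ) : SMat n →+* Mat n := (ev p).mapMatrix

theorem evM_apply {n : ℕ} (p : ℝ × ℝ) (X : SMat n) (i j : Idx n) :
    evM p X i j = ev p (X i j) := rfl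

theorem SMat.ext_ev {n : ℕ} {X Y : SMat n} (h : ∀ p, evM p X = evM p Y) : X = Y := by
  ext1 i j
  exact Sm.ext_ev fun p => congrFun (congrFun (h p) i) j

/-- The matrix of smooth functions of a smooth matrix valued map. -/
def toSMat {n : ℕ} (A : ℝ × ℝ → Mat n) (hA : MatSmooth n A) : SMat n :=
  Matrix.of fun i j => ⟨fun p => A p i j, hA i j⟩

@[simp] theorem evM_toSMat {n : ℕ} (A : ℝ × ℝ → Mat n) (hA : MatSmooth n A) (p : ℝ × ℝ) :
    evM p (toSMat A hA) = A p := rfl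

theorem matSmooth_evM {n : ℕ} (X : SMat n) : MatSmooth n fun p => evM p X :=
  fun i j => (X i j).contDiff

theorem MatSmooth.comp {n : ℕ} {F G : Type*} [NormedAddCommGroup F] [NormedSpace ℝ F]
    [NormedAddCommGroup G] [NormedSpace ℝ G] {A : F → Mat n} (hA : MatSmooth n A) {f : G → F}
    (hf : ContDiff ℝ ∞ f) : MatSmooth n fun x => A (f x) :=
  fun i j => (hA i j).comp hf

theorem MatSmooth.slice {n : ℕ} {A : ℝ × ℝ → Mat n} (hA : MatSmooth n A) (t : ℝ) :
    MatSmooth n fun x => A (x, t) :=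
  hA.comp (contDiff_id.prodMk contDiff_const)

theorem MatSmooth.lift {n : ℕ} {A : ℝ → Mat n} (hA : MatSmooth n A) :
    MatSmooth n fun p : ℝ × ℝ => A p.1 :=
  hA.comp contDiff_fst

/-- Entrywise application of a derivation to a matrix. -/
def matD {R : Type*} [CommRing R] [Algebra ℝ R] (D : Derivation ℝ R R) {ι : Type*}
    (X : Matrix ι ι R) : Matrix ι ι R := X.map D

section matD
variable {R : Type*} [CommRing R] [Algebra ℝ R] (D : Derivation ℝ R R) {ι : Type*}

theorem matD_apply (X : Matrix ι ι R) (i j : ι) : matD D X i j = D (X i j) := rfl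

theorem matD_add (X Y : Matrix ι ι R) : matD D (X + Y) = matD D X + matD D Y := by
  ext; simp [matD_apply]

theorem matD_sub (X Y : Matrix ι ι R) : matD D (X - Y) = matD D X - matD D Y := by
  ext; simp [matD_apply]

theorem matD_zero : matD D (0 : Matrix ι ι R) = 0 := by
  ext; simp [matD_apply]

theorem matD_transpose (X : Matrix ι ι R) : matD D Xᵀ = (matD D X)ᵀ := rfl

theorem matD_mul [Fintype ι] (X Y : Matrix ι ι R) :
    matD D (X * Y) = matD D X * Y + X * matD D Y := by
  ext i j
  simp only [matD_apply, Matrix.mul_apply, Matrix.add_apply, map_sum, Derivation.leibniz,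
    smul_eq_mul, Finset.sum_add_distrib]
  rw [add_comm]
  congr 1
  exact Finset.sum_congr rfl fun k _ => mul_comm _ _

theorem matD_map_algebraMap (X : Matrix ι ι ℝ) : matD D (X.map (algebraMap ℝ R)) = 0 := by
  ext; simp [matD_apply]

end matD

theorem evM_matD_dX {n : ℕ} (X : SMat n) (x t : ℝ) :
    evM (x, t) (matD dX X) = matDeriv (fun y => evM (y, t) X) x := by
  ext i j
  exact ev_dX _ x t

theorem evM_matD_dT {n : ℕ} (X : SMat n) (x t : ℝ) :
    evM (x, t) (matD dT X) = matDeriv (fun s => evM (x, s) X) t := by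
  ext i j
  exact ev_dT _ x t

theorem matD_dX_dT {n : ℕ} (X : SMat n) : matD dX (matD dT X) = matD dT (matD dX X) := by
  ext1 i j
  exact dX_dT _

/-! ### Matrices over a differential ring -/

/-- The matrix of the form, over any ring. -/
def formM (R : Type*) [CommRing R] (n : ℕ) : Matrix (Idx n) (Idx n) R :=
  Matrix.of fun i j => if (i : ℕ) + j = 2 * n then (-1) ^ (n + (i : ℕ)) else 0

/-- The shift matrix `b`, over any ring. -/
def shiftM (R : Type*) [CommRing R] (n : ℕ) : Matrix (Idx n) (Idx n) R :=
  Matrix.of fun i j => if (i : ℕ) = j + 1 then 1 else 0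

theorem neg_one_pow_congr {R : Type*} [CommRing R] {a b : ℕ} (h : a % 2 = b % 2) :
    (-1 : R) ^ a = (-1) ^ b := by
  rw [neg_one_pow_eq_pow_mod_two, h, ← neg_one_pow_eq_pow_mod_two]

theorem neg_one_pow_congr_neg {R : Type*} [CommRing R] {a b : ℕ} (h : (a + 1) % 2 = b % 2) :
    (-1 : R) ^ a = -(-1) ^ b := by
  rw [← neg_one_pow_congr h, pow_succ]
  ring

section
variable {R : Type*} [CommRing R] {n : ℕ}

theorem rev_val (i : Idx n) : (i.rev : ℕ) = 2 * n - i := by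
  rw [Fin.val_rev]
  omega

theorem formM_apply (i j : Idx n) :
    formM R n i j = if j = i.rev then (-1) ^ (n + (i : ℕ)) else 0 := by
  have : ((i : ℕ) + j = 2 * n) ↔ j = i.rev := by
    rw [Fin.ext_iff, rev_val]
    omega
  simp [formM, this]

theorem formM_mul_apply (X : Matrix (Idx n) (Idx n) R) (i j : Idx n) :
    (formM R n * X) i j = (-1) ^ (n + (i : ℕ)) * X i.rev j := by
  simp [Matrix.mul_apply, formM_apply]

theorem formM_transpose : (formM R n)ᵀ = formM R n := by
  ext i j
  simp only [Matrix.transpose_apply, formM, Matrix.of_apply]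
  by_cases h : (i : ℕ) + j = 2 * n
  · rw [if_pos h, if_pos (by omega)]
    exact neg_one_pow_congr (by omega)
  · rw [if_neg h, if_neg (by omega)]

theorem mul_formM_apply (X : Matrix (Idx n) (Idx n) R) (i j : Idx n) :
    (X * formM R n) i j = (-1) ^ (n + (j : ℕ)) * X i j.rev := by
  have : X * formM R n = (formM R n * Xᵀ)ᵀ := by
    rw [Matrix.transpose_mul, formM_transpose, Matrix.transpose_transpose]
  rw [this, Matrix.transpose_apply, formM_mul_apply, Matrix.transpose_apply]

theorem formM_mul_self : formM R n * formM R n = 1 := by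
  ext i j
  have : n + (i.rev : ℕ) = n + (2 * n - i) := by rw [rev_val]
  rw [formM_mul_apply, formM_apply, Fin.rev_rev, Matrix.one_apply]
  by_cases h : j = i
  · rw [if_pos h, if_pos h.symm, this, ← pow_add]
    rw [neg_one_pow_congr (b := 0) (by omega), pow_zero]
  · rw [if_neg h, if_neg (Ne.symm h), mul_zero]

theorem mul_shiftM_apply (X : Matrix (Idx n) (Idx n) R) (i j q : Idx n) (hq : (q : ℕ) = j + 1) :
    (X * shiftM R n) i j = X i q := by
  rw [Matrix.mul_apply, Finset.sum_eq_single q]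
  · simp [shiftM, hq]
  · intro l _ hl
    have : (l : ℕ) ≠ j + 1 := fun h => hl (Fin.ext (by omega))
    simp [shiftM, this]
  · simp

/-- The matrices of `o(n+1,n)`, over any ring. -/
def IsSkew (X : Matrix (Idx n) (Idx n) R) : Prop := Xᵀ * formM R n + formM R n * X = 0

theorem formM_mul_transpose (X : Matrix (Idx n) (Idx n) R) :
    (formM R n * X)ᵀ = Xᵀ * formM R n := by
  rw [Matrix.transpose_mul, formM_transpose]

theorem isSkew_iff {X : Matrix (Idx n) (Idx n) R} :
    IsSkew X ↔ ∀ i j, (formM R n * X) j i + (formM R n * X) i j = 0 := by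
  rw [IsSkew, ← formM_mul_transpose, ← Matrix.ext_iff]
  rfl

theorem IsSkew.add {X Y : Matrix (Idx n) (Idx n) R} (hX : IsSkew X) (hY : IsSkew Y) :
    IsSkew (X + Y) := by
  unfold IsSkew at *
  rw [Matrix.transpose_add, add_mul, mul_add, add_add_add_comm, hX, hY, add_zero]

theorem IsSkew.neg {X : Matrix (Idx n) (Idx n) R} (hX : IsSkew X) : IsSkew (-X) := by
  unfold IsSkew at *
  rw [Matrix.transpose_neg, neg_mul, mul_neg, ← neg_add, hX, neg_zero]

theorem IsSkew.sub {X Y : Matrix (Idx n) (Idx n) R} (hX : IsSkew X) (hY : IsSkew Y) :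
    IsSkew (X - Y) := sub_eq_add_neg X Y ▸ hX.add hY.neg

theorem isSkew_zero : IsSkew (0 : Matrix (Idx n) (Idx n) R) := by simp [IsSkew]

theorem IsSkew.smul {X : Matrix (Idx n) (Idx n) R} (a : R) (hX : IsSkew X) : IsSkew (a • X) := by
  unfold IsSkew at *
  rw [Matrix.transpose_smul, smul_mul_assoc, mul_smul_comm, ← smul_add, hX, smul_zero]

theorem IsSkew.transpose_mul_formM {X : Matrix (Idx n) (Idx n) R} (hX : IsSkew X) :
    Xᵀ * formM R n = -(formM R n * X) := eq_neg_of_add_eq_zero_left hX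

theorem IsSkew.apply_rev {X : Matrix (Idx n) (Idx n) R} (hX : IsSkew X) (i j : Idx n) :
    X i j = -(-1) ^ ((i : ℕ) + j) * X j.rev i.rev := by
  have h := isSkew_iff.1 hX i.rev j
  rw [formM_mul_apply, formM_mul_apply, Fin.rev_rev] at h
  have hi : (i.rev : ℕ) = 2 * n - i := rev_val i
  have h1 : (-1 : R) ^ (n + (i.rev : ℕ)) * (-1) ^ (n + (i.rev : ℕ)) = 1 := by
    rw [← pow_add, neg_one_pow_congr (b := 0) (by omega), pow_zero]
  have h2 : (-1 : R) ^ (n + (i.rev : ℕ)) * (-1) ^ (n + (j : ℕ)) = (-1) ^ ((i : ℕ) + j) := by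
    rw [← pow_add]
    exact neg_one_pow_congr (by omega)
  calc X i j = (-1 : R) ^ (n + (i.rev : ℕ)) * (-1) ^ (n + (i.rev : ℕ)) * X i j := by rw [h1, one_mul]
    _ = -((-1 : R) ^ (n + (i.rev : ℕ)) * (-1) ^ (n + (j : ℕ))) * X j.rev i.rev := by
      linear_combination (-1 : R) ^ (n + (i.rev : ℕ)) * h
    _ = _ := by rw [h2]

theorem isSkew_shiftM : IsSkew (shiftM R n) := by
  rw [isSkew_iff]
  intro i j
  rw [formM_mul_apply, formM_mul_apply]
  have hi := rev_val i
  have hj := rev_val j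
  simp only [shiftM, Matrix.of_apply]
  by_cases h : (i.rev : ℕ) = j + 1
  · rw [if_pos h, if_pos (by omega), mul_one, mul_one,
      neg_one_pow_congr_neg (a := n + (j : ℕ)) (b := n + (i : ℕ)) (by omega)]
    ring
  · rw [if_neg h, if_neg (by omega)]
    ring

/-! ### The space V_n over a ring -/

/-- Matrices with entries in the span `V_n`, over any ring. -/
def IsV (v : Matrix (Idx n) (Idx n) R) : Prop :=
  IsSkew v ∧ ∀ i j : Idx n, v i j ≠ 0 →
    (i : ℕ) < j ∧ ((i : ℕ) + j + 1 = 2 * n ∨ (i : ℕ) + j = 2 * n + 1)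

theorem isV_zero : IsV (0 : Matrix (Idx n) (Idx n) R) := ⟨isSkew_zero, by simp⟩

theorem IsV.add {v w : Matrix (Idx n) (Idx n) R} (hv : IsV v) (hw : IsV w) : IsV (v + w) := by
  refine ⟨hv.1.add hw.1, fun i j h => ?_⟩
  by_cases h1 : v i j = 0
  · by_cases h2 : w i j = 0
    · simp [h1, h2] at h
    · exact hw.2 i j h2
  · exact hv.2 i j h1

theorem IsV.smul {v : Matrix (Idx n) (Idx n) R} (a : R) (hv : IsV v) : IsV (a • v) :=
  ⟨hv.1.smul a, fun i j h => hv.2 i j fun h0 => h (by simp [h0])⟩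

theorem IsV.eq_zero_of_le {v : Matrix (Idx n) (Idx n) R} (hv : IsV v) {i j : Idx n}
    (h : j ≤ i) : v i j = 0 := by
  by_contra h0
  have := (hv.2 i j h0).1
  exact absurd h (not_le.2 this)

theorem IsV.eq_zero_of_lt {v : Matrix (Idx n) (Idx n) R} (hv : IsV v) {i j : Idx n}
    (h : (j : ℕ) < n) : v i j = 0 := by
  by_contra h0
  have := hv.2 i j h0
  omega

theorem IsV.mul_col_zero {v : Matrix (Idx n) (Idx n) R} (hv : IsV v) {j : Idx n}
    (h : (j : ℕ) < n) (X : Matrix (Idx n) (Idx n) R) (i : Idx n) : (X * v) i j = 0 := by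
  rw [Matrix.mul_apply]
  exact Finset.sum_eq_zero fun l _ => by rw [hv.eq_zero_of_lt h, mul_zero]

/-- The generator of `V_n` with entries in the columns `m` and `q = m + 1`. -/
def betaM (R : Type*) [CommRing R] {n : ℕ} (m q : Idx n) : Matrix (Idx n) (Idx n) R :=
  Matrix.of fun i j => if (i = q.rev ∧ j = m) ∨ (i = m.rev ∧ j = q) then 1 else 0

theorem isV_betaM {m q : Idx n} (hq : (q : ℕ) = m + 1) (hm : n ≤ m) :
    IsV (betaM R m q) := by
  have hq' := rev_val q
  have hm' := rev_val m
  constructor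
  · rw [isSkew_iff]
    intro i j
    rw [formM_mul_apply, formM_mul_apply]
    simp only [betaM, Matrix.of_apply, Fin.rev_inj]
    by_cases h : (i = q ∧ j = m) ∨ (i = m ∧ j = q)
    · rw [if_pos h, if_pos (by tauto), mul_one, mul_one,
        neg_one_pow_congr_neg (a := n + (j : ℕ)) (b := n + (i : ℕ))
          (by rcases h with ⟨rfl, rfl⟩ | ⟨rfl, rfl⟩ <;> omega)]
      ring
    · rw [if_neg h, if_neg (by tauto)]
      ring
  · intro i j h
    simp only [betaM, Matrix.of_apply, ne_eq, ite_eq_right_iff, Classical.not_imp] at h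
    rcases h.1 with ⟨rfl, rfl⟩ | ⟨rfl, rfl⟩ <;> omega

theorem betaM_col_of_lt {m q : Idx n} (hq : (q : ℕ) = m + 1) {j : Idx n} (hj : j < m)
    (i : Idx n) : betaM R m q i j = 0 := by
  have h1 : j ≠ m := hj.ne
  have h2 : j ≠ q := fun h => by
    have := Fin.lt_def.1 hj
    rw [h] at this
    omega
  simp [betaM, h1, h2]

theorem betaM_col_self {m q : Idx n} (hq : (q : ℕ) = m + 1) (i : Idx n) :
    betaM R m q i m = if i = q.rev then 1 else 0 := by
  have h2 : m ≠ q := fun h => by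
    rw [h] at hq
    omega
  simp [betaM, h2]

theorem mul_betaM_self {m q : Idx n} (hq : (q : ℕ) = m + 1)
    (X : Matrix (Idx n) (Idx n) R) (i : Idx n) : (X * betaM R m q) i m = X i q.rev := by
  rw [Matrix.mul_apply, Finset.sum_eq_single q.rev]
  · rw [betaM_col_self hq, if_pos rfl, mul_one]
  · intro l _ hl
    rw [betaM_col_self hq, if_neg hl, mul_zero]
  · simp

theorem updateCol_mul_apply (X v : Matrix (Idx n) (Idx n) R) (q : Idx n) (c : Idx n → R)
    (i j : Idx n) (h : v q j = 0) : (X.updateCol q c * v) i j = (X * v) i j := by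
  rw [Matrix.mul_apply, Matrix.mul_apply]
  refine Finset.sum_congr rfl fun l _ => ?_
  by_cases hl : l = q
  · rw [hl, h, mul_zero, mul_zero]
  · rw [Matrix.updateCol_ne hl]

/-- Column m of an element of V_n has at most two possible entries. One of them is, up to sign, the
mirror image of an entry in column m - 1, so after the earlier columns vanish only row `q.rev` is
left. This is the one free coefficient in each step of the column inductions. -/
theorem IsV.val_eq_of_col {v : Matrix (Idx n) (Idx n) R} (hv : IsV v) {m q : Idx n}
    (hq : (q : ℕ) = m + 1) (hprev : ∀ i j : Idx n, j < m → v i j = 0) (i : Idx n)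
    (hi : i ≠ q.rev) : v i m = 0 := by
  by_contra h0
  obtain ⟨h1, h2 | h2⟩ := hv.2 i m h0
  · exact hi (Fin.ext (by rw [rev_val]; omega))
  · apply h0
    rw [hv.1.apply_rev, hprev, mul_zero]
    rw [Fin.lt_def, rev_val]
    omega

theorem shiftM_add_one {v : Matrix (Idx n) (Idx n) R} (hv : IsV v) (i j : Idx n)
    (h : (i : ℕ) = j + 1) : (shiftM R n + v) i j = 1 := by
  rw [Matrix.add_apply, hv.eq_zero_of_le (Fin.le_def.2 (by omega))]
  simp [shiftM, h]

theorem shiftM_add_zero {v : Matrix (Idx n) (Idx n) R} (hv : IsV v) (i j : Idx n)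
    (h : (j : ℕ) + 1 < i) : (shiftM R n + v) i j = 0 := by
  rw [Matrix.add_apply, hv.eq_zero_of_le (Fin.le_def.2 (by omega))]
  have : (i : ℕ) ≠ j + 1 := by omega
  simp [shiftM, this]

theorem mul_shiftM_add_apply (g v : Matrix (Idx n) (Idx n) R) (i j q : Idx n)
    (hq : (q : ℕ) = j + 1) : (g * (shiftM R n + v)) i j = g i q + (g * v) i j := by
  rw [mul_add, Matrix.add_apply, mul_shiftM_apply g i j q hq]

/-- A skew matrix all of whose columns but the last vanish is zero. -/
theorem eq_zero_of_skew_of_last {Z : Matrix (Idx n) (Idx n) R} [Algebra ℝ R]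
    (hZ : ∀ i j, Z j i + Z i j = 0) (h : ∀ i j : Idx n, (j : ℕ) < 2 * n → Z i j = 0) : Z = 0 := by
  ext i j
  by_cases hj : (j : ℕ) < 2 * n
  · exact h i j hj
  · by_cases hi : (i : ℕ) < 2 * n
    · simpa [h j i hi] using hZ i j
    · have : i = j := Fin.ext (by omega)
      subst this
      have h2 : (2 : ℝ) • Z i i = 0 := by rw [two_smul]; exact hZ i i
      have h3 := congrArg ((2 : ℝ)⁻¹ • ·) h2
      simpa [smul_smul] using h3

theorem eq_zero_of_add_self [Algebra ℝ R] {x : R} (h : x + x = 0) : x = 0 := by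
  have h2 : (2 : ℝ) • x = 0 := by rw [two_smul]; exact h
  have h3 := congrArg ((2 : ℝ)⁻¹ • ·) h2
  simpa [smul_smul] using h3

end

section
variable {R : Type*} [CommRing R] [Algebra ℝ R] (D : Derivation ℝ R R) {n : ℕ}

theorem matD_formM : matD D (formM R n) = 0 := by
  ext i j
  simp only [matD_apply, formM, Matrix.of_apply, Matrix.zero_apply]
  split_ifs
  · rw [Derivation.leibniz_pow]
    simp
  · simp

/-- If a symmetric matrix satisfies `X' = Bᵀ X + X B` in its leading block and vanishes there, then
it vanishes in the row below that block. -/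
theorem extend_row {X B : Matrix (Idx n) (Idx n) R} (hsym : Xᵀ = X)
    (hB1 : ∀ i j : Idx n, (i : ℕ) = j + 1 → B i j = 1)
    (hB0 : ∀ i j : Idx n, (j : ℕ) + 1 < i → B i j = 0) {m q : Idx n} (hq : (q : ℕ) = m + 1)
    (hX : ∀ i j, i ≤ m → j ≤ m → X i j = 0)
    (hE : ∀ i j, i ≤ m → j ≤ m → (matD D X - Bᵀ * X - X * B) i j = 0) (j : Idx n) (hj : j ≤ m) :
    X q j = 0 := by
  have hs : ∀ i j, X i j = X j i := fun i j => congrFun (congrFun hsym j) i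
  have h := hE m j le_rfl hj
  have h1 : (Bᵀ * X) m j = X q j := by
    rw [Matrix.mul_apply, Finset.sum_eq_single q]
    · rw [Matrix.transpose_apply, hB1 q m hq, one_mul]
    · intro l _ hl
      by_cases hlm : l ≤ m
      · rw [hX l j hlm hj, mul_zero]
      · rw [Matrix.transpose_apply, hB0 l m, zero_mul]
        have : (l : ℕ) ≠ q := fun h => hl (Fin.ext h)
        have := Fin.lt_def.1 (not_le.1 hlm)
        omega
    · simp
  rw [Matrix.sub_apply, Matrix.sub_apply, matD_apply, hX m j le_rfl hj, map_zero, h1] at h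
  -- For j < m the term X B sees only the leading block, where X vanishes. For j = m, symmetry makes
  -- both terms equal to X q m, and 2 is invertible.
  rcases hj.lt_or_eq with hj | rfl
  · have h2 : (X * B) m j = 0 := by
      rw [Matrix.mul_apply]
      refine Finset.sum_eq_zero fun l _ => ?_
      by_cases hlm : l ≤ m
      · rw [hX m l le_rfl hlm, zero_mul]
      · rw [hB0 l j, mul_zero]
        have := Fin.lt_def.1 (not_le.1 hlm)
        have := Fin.lt_def.1 hj
        omega
    rw [h2] at h
    linear_combination -h
  · have h2 : (X * B) j j = X q j := by
      rw [← h1]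
      simp only [Matrix.mul_apply, Matrix.transpose_apply]
      exact Finset.sum_congr rfl fun l _ => by rw [hs j l, mul_comm]
    rw [h2] at h
    exact eq_zero_of_add_self (by linear_combination -h)

end

/-! ### Moving frames, column by column -/

section
variable {R : Type*} [CommRing R] [Algebra ℝ R] (D : Derivation ℝ R R) {n : ℕ}

/-- The form on columns, over any ring. -/
def bil (R : Type*) [CommRing R] (n : ℕ) (x y : Idx n → R) : R := x ⬝ᵥ (formM R n *ᵥ y)

omit [Algebra ℝ R] in
theorem gram_apply (g h : Matrix (Idx n) (Idx n) R) (i j : Idx n) :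
    (gᵀ * formM R n * h) i j = bil R n (fun k => g k i) (fun k => h k j) := by
  rw [Matrix.mul_assoc, Matrix.mul_apply]
  simp [bil, dotProduct, Matrix.mulVec, Matrix.mul_apply]

omit [Algebra ℝ R] in
theorem bil_comm (x y : Idx n → R) : bil R n x y = bil R n y x := by
  unfold bil
  rw [Matrix.dotProduct_mulVec, ← Matrix.mulVec_transpose, formM_transpose, dotProduct_comm]

omit [Algebra ℝ R] in
theorem bil_sub_smul_self (x y : Idx n → R) (a : R) :
    bil R n (x - a • y) (x - a • y)
      = bil R n x x - 2 * a * bil R n x y + a ^ 2 * bil R n y y := by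
  have h := bil_comm x y
  unfold bil at *
  simp only [Matrix.mulVec_sub, Matrix.mulVec_smul, dotProduct_sub, sub_dotProduct,
    dotProduct_smul, smul_dotProduct, smul_eq_mul]
  linear_combination a * h

/-- `gᵀ C g - C` evolves linearly up to the defect of the frame equation. -/
theorem matD_gram (g B : Matrix (Idx n) (Idx n) R) (hB : IsSkew B) :
    matD D (gᵀ * formM R n * g - formM R n) - Bᵀ * (gᵀ * formM R n * g - formM R n)
        - (gᵀ * formM R n * g - formM R n) * B
      = (matD D g - g * B)ᵀ * formM R n * g + gᵀ * formM R n * (matD D g - g * B) := by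
  have h : Bᵀ * formM R n = -(formM R n * B) := hB.transpose_mul_formM
  rw [matD_sub, matD_mul, matD_mul, matD_formM, matD_transpose]
  simp only [Matrix.transpose_sub, Matrix.transpose_mul, mul_sub, sub_mul, mul_zero, add_zero,
    sub_zero]
  simp only [Matrix.mul_assoc] at h ⊢
  rw [h]
  abel

/-- The frame equation `g' = g (b + v)` in the columns below `m`, and `gᵀ C g = C` in the leading
block up to `m`. -/
structure IsFrameUpTo (m : Idx n) (g v : Matrix (Idx n) (Idx n) R) : Prop where
  isV : IsV v
  gram : ∀ i j, i ≤ m → j ≤ m → (gᵀ * formM R n * g) i j = formM R n i j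
  der : ∀ i j : Idx n, j < m → (matD D g - g * (shiftM R n + v)) i j = 0

variable {D}

/-- The products of a new column with the earlier ones are forced. By `matD_gram` the defect gᵀCg -
C obeys a homogeneous linear equation wherever the frame equation holds, and the ones on the
subdiagonal of b push its vanishing from the leading block to the next row. -/
theorem gram_row {m q : Idx n} (hq : (q : ℕ) = m + 1) {g v : Matrix (Idx n) (Idx n) R} (hv : IsV v)
    (gram : ∀ i j, i ≤ m → j ≤ m → (gᵀ * formM R n * g) i j = formM R n i j)
    (der : ∀ i j : Idx n, j ≤ m → (matD D g - g * (shiftM R n + v)) i j = 0) (j : Idx n)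
    (hj : j ≤ m) : (gᵀ * formM R n * g) q j = formM R n q j := by
  rw [← sub_eq_zero, ← Matrix.sub_apply]
  refine extend_row D (B := shiftM R n + v) ?_ (shiftM_add_one hv) (shiftM_add_zero hv) hq ?_ ?_
    j hj
  · simp only [Matrix.transpose_sub, Matrix.transpose_mul, formM_transpose,
      Matrix.transpose_transpose, Matrix.mul_assoc]
  · intro i j hi hj
    rw [Matrix.sub_apply, gram i j hi hj, sub_self]
  · intro i j hi hj
    rw [matD_gram D g _ (isSkew_shiftM.add hv.1), Matrix.add_apply]
    have h1 : ((matD D g - g * (shiftM R n + v))ᵀ * formM R n * g) i j = 0 := by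
      rw [Matrix.mul_assoc, Matrix.mul_apply]
      exact Finset.sum_eq_zero fun l _ => by rw [Matrix.transpose_apply, der l i hi, zero_mul]
    have h2 : (gᵀ * formM R n * (matD D g - g * (shiftM R n + v))) i j = 0 := by
      rw [Matrix.mul_apply]
      exact Finset.sum_eq_zero fun l _ => by rw [der l j hj, mul_zero]
    rw [h1, h2, add_zero]

theorem IsFrameUpTo.step {m q : Idx n} (hq : (q : ℕ) = m + 1) (hm : n ≤ m)
    {g v : Matrix (Idx n) (Idx n) R} (h : IsFrameUpTo D m g v) :
    ∃ g' v', IsFrameUpTo D q g' v' ∧ ∀ i j : Idx n, j ≤ m → g' i j = g i j := by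
  have hp : (q.rev : ℕ) = 2 * n - q := rev_val q
  have hql := q.isLt
  have hmq : m < q := Fin.lt_def.2 (by omega)
  have hpm : q.rev < m := Fin.lt_def.2 (by omega)
  -- The frame equation in column m defines column q. This is stated for every potential w that
  -- agrees with v before column m, because it is used for v itself and then for the corrected
  -- potential.
  have key : ∀ (c : Idx n → R) (w : Matrix (Idx n) (Idx n) R), IsV w →
      (∀ i j, j < m → w i j = v i j) →
      (∀ i, c i = D (g i m) - (g * w) i m) →
      (∀ i j : Idx n, j ≤ m →
        (matD D (g.updateCol q c) - g.updateCol q c * (shiftM R n + w)) i j = 0) ∧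
      (∀ i j, i ≤ m → j ≤ m →
        ((g.updateCol q c)ᵀ * formM R n * g.updateCol q c) i j = formM R n i j) ∧
      ∀ j ≤ m, ((g.updateCol q c)ᵀ * formM R n * g.updateCol q c) q j = formM R n q j := by
    intro c w hw hwv hc
    have hcol : ∀ i j, j ≤ m → g.updateCol q c i j = g i j := fun i j hj =>
      Matrix.updateCol_ne (hj.trans_lt hmq).ne
    have hder : ∀ i j : Idx n, j ≤ m →
        (matD D (g.updateCol q c) - g.updateCol q c * (shiftM R n + w)) i j = 0 := by
      intro i j hj
      have hw0 : w q j = 0 := hw.eq_zero_of_le (hj.trans hmq.le)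
      have hjq : (j : ℕ) ≤ m := hj
      rw [Matrix.sub_apply, mul_shiftM_add_apply _ _ i j ⟨j + 1, by omega⟩ rfl, matD_apply,
        hcol i j hj, updateCol_mul_apply _ _ _ _ _ _ hw0]
      rcases hj.lt_or_eq with hj' | rfl
      · have h1 := h.der i j hj'
        rw [Matrix.sub_apply, mul_shiftM_add_apply _ _ i j ⟨j + 1, by omega⟩ rfl, matD_apply] at h1
        have h2 : (g * w) i j = (g * v) i j := by
          simp only [Matrix.mul_apply]
          exact Finset.sum_congr rfl fun l _ => by rw [hwv l j hj']
        rw [hcol i _ (Fin.le_def.2 (Nat.succ_le_of_lt hj')), h2, h1]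
      · have : (⟨j + 1, by omega⟩ : Idx n) = q := Fin.ext hq.symm
        rw [this, Matrix.updateCol_self, hc]
        ring
    have hgram : ∀ i j, i ≤ m → j ≤ m →
        ((g.updateCol q c)ᵀ * formM R n * g.updateCol q c) i j = formM R n i j := by
      intro i j hi hj
      rw [← h.gram i j hi hj, gram_apply, gram_apply]
      congr 1 <;> funext k <;> exact hcol _ _ (by assumption)
    exact ⟨hder, hgram, gram_row hq hw hgram hder⟩
  set c : Idx n → R := fun i => D (g i m) - (g * v) i m with hc
  obtain ⟨-, -, hrow⟩ := key c v h.isV (fun _ _ _ => rfl) fun i => rfl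
  have hcp : bil R n c (fun k => g k q.rev) = formM R n q q.rev := by
    rw [← hrow q.rev hpm.le, gram_apply]
    simp only [Matrix.updateCol_self, Matrix.updateCol_ne (hpm.trans hmq).ne]
  have hpp : bil R n (fun k => g k q.rev) (fun k => g k q.rev) = 0 := by
    rw [← gram_apply, h.gram _ _ hpm.le hpm.le]
    rw [formM, Matrix.of_apply, if_neg (by omega)]
  -- Only ⟨c,c⟩ can be wrong. Column `q.rev` is isotropic and pairs with c to (-1)^(n+q), so
  -- subtracting a times it makes the new column isotropic. The generator `betaM R m q` has its
  -- entry of column m in row `q.rev`, so adding a times it to v performs this subtraction.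
  set a : R := (2⁻¹ : ℝ) • ((-1) ^ (n + (q : ℕ)) * bil R n c c) with ha
  have ha2 : 2 * a * formM R n q q.rev = bil R n c c := by
    rw [formM_apply, if_pos rfl, ha, two_mul, ← two_smul ℝ, smul_smul]
    rw [mul_inv_cancel₀ two_ne_zero, one_smul, mul_right_comm, ← pow_add,
      neg_one_pow_congr (b := 0) (by omega), pow_zero, one_mul]
  have hw : IsV (v + a • betaM R m q) := h.isV.add ((isV_betaM hq hm).smul a)
  obtain ⟨k1, k2, k3⟩ := key (c - a • fun k => g k q.rev) (v + a • betaM R m q) hw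
    (fun i j hj => by simp [betaM_col_of_lt hq hj])
    (fun i => by
      rw [mul_add, Matrix.add_apply, mul_smul_comm, Matrix.smul_apply, mul_betaM_self hq]
      simp only [hc, Pi.sub_apply, Pi.smul_apply, smul_eq_mul]
      ring)
  refine ⟨_, _, ⟨hw, ?_, fun i j hj => k1 i j ?_⟩, fun i j hj => Matrix.updateCol_ne
    (hj.trans_lt hmq).ne⟩
  · have hs : ∀ X : Matrix (Idx n) (Idx n) R, ∀ i j,
        (Xᵀ * formM R n * X) i j = (Xᵀ * formM R n * X) j i := by
      intro X i j
      rw [gram_apply, gram_apply, bil_comm]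
    have hle : ∀ i : Idx n, i ≤ q → i ≤ m ∨ i = q := by
      intro i hi
      rcases hi.lt_or_eq with h1 | h1
      · left
        have := Fin.lt_def.1 h1
        exact Fin.le_def.2 (by omega)
      · exact Or.inr h1
    intro i j hi hj
    rcases hle i hi with hi' | hi' <;> rcases hle j hj with hj' | hj'
    · exact k2 i j hi' hj'
    · rw [hj', hs, k3 i hi']
      exact congrFun (congrFun formM_transpose i) q
    · rw [hi']
      exact k3 j hj'
    · rw [hi', hj', gram_apply]
      simp only [Matrix.updateCol_self]
      change bil R n (c - a • fun k => g k q.rev) (c - a • fun k => g k q.rev) = _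
      rw [bil_sub_smul_self, hpp, hcp, ha2, formM, Matrix.of_apply, if_neg (by omega)]
      ring
  · have := Fin.lt_def.1 hj
    exact Fin.le_def.2 (by omega)

theorem IsFrameUpTo.exists_top {m : Idx n} (hm : n ≤ m) {g v : Matrix (Idx n) (Idx n) R}
    (h : IsFrameUpTo D m g v) :
    ∃ g' v', IsFrameUpTo D (Fin.last (2 * n)) g' v' ∧ ∀ i j : Idx n, j ≤ m → g' i j = g i j := by
  obtain ⟨k, hk⟩ : ∃ k, (m : ℕ) + k = 2 * n := ⟨2 * n - m, by omega⟩
  induction k generalizing m g v with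
  | zero =>
    have : m = Fin.last (2 * n) := Fin.ext hk
    subst this
    exact ⟨g, v, h, fun _ _ _ => rfl⟩
  | succ k ih =>
    obtain ⟨g1, v1, h1, h2⟩ := h.step (q := ⟨m + 1, by omega⟩) rfl hm
    obtain ⟨g2, v2, h3, h4⟩ := ih (m := ⟨m + 1, by omega⟩) (by simp; omega) h1 (by simp; omega)
    refine ⟨g2, v2, h3, fun i j hj => ?_⟩
    rw [h4 i j (Fin.le_def.2 (by have := Fin.le_def.1 hj; simp; omega)), h2 i j hj]

omit [Algebra ℝ R] in
theorem left_inv_of_gram {g : Matrix (Idx n) (Idx n) R} (h : gᵀ * formM R n * g = formM R n) :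
    formM R n * gᵀ * formM R n * g = 1 := by
  rw [Matrix.mul_assoc, Matrix.mul_assoc, ← Matrix.mul_assoc gᵀ, h, formM_mul_self]

/-- A full frame solves the frame equation also in the last column. -/
theorem IsFrameUpTo.top {g v : Matrix (Idx n) (Idx n) R}
    (h : IsFrameUpTo D (Fin.last (2 * n)) g v) :
    gᵀ * formM R n * g = formM R n ∧ matD D g = g * (shiftM R n + v) := by
  have hg : gᵀ * formM R n * g = formM R n := by
    ext i j
    exact h.gram i j (Fin.le_last _) (Fin.le_last _)
  refine ⟨hg, ?_⟩
  have h1 := matD_gram D g _ (isSkew_shiftM.add h.isV.1)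
  rw [hg, sub_self, matD_zero, mul_zero, zero_mul, sub_self, sub_self] at h1
  -- The last column has no successor to absorb an error. Since gᵀCg = C holds throughout, `h1` says
  -- that this matrix is antisymmetric, and it vanishes outside its last column.
  have h2 : gᵀ * formM R n * (matD D g - g * (shiftM R n + v)) = 0 := by
    refine eq_zero_of_skew_of_last (fun i j => ?_) fun i j hj => ?_
    · have h3 : (gᵀ * formM R n * (matD D g - g * (shiftM R n + v)))ᵀ
          = (matD D g - g * (shiftM R n + v))ᵀ * formM R n * g := by
        simp only [Matrix.transpose_mul, formM_transpose, Matrix.transpose_transpose,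
          Matrix.mul_assoc]
      rw [← h3] at h1
      exact (congrFun (congrFun h1 i) j).symm
    · rw [Matrix.mul_apply]
      exact Finset.sum_eq_zero fun l _ => by rw [h.der l j (Fin.lt_def.2 hj), mul_zero]
  have h3 : g * (formM R n * gᵀ * formM R n) = 1 :=
    mul_eq_one_comm.1 (left_inv_of_gram hg)
  rw [← sub_eq_zero]
  calc matD D g - g * (shiftM R n + v)
      = g * (formM R n * gᵀ * formM R n) * (matD D g - g * (shiftM R n + v)) := by
        rw [h3, one_mul]
    _ = g * formM R n * (gᵀ * formM R n * (matD D g - g * (shiftM R n + v))) := by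
        simp only [Matrix.mul_assoc]
    _ = 0 := by rw [h2, mul_zero]

/-- The gram relations of an isotropic curve in isotropic parameter give a moving frame. -/
theorem exists_frame (γ : ℕ → Idx n → R) (hγ : ∀ k i, D (γ k i) = γ (k + 1) i)
    (hgram : ∀ i j, i ≤ n → j ≤ n → bil R n (γ i) (γ j) = if i = n ∧ j = n then 1 else 0) :
    ∃ g v : Matrix (Idx n) (Idx n) R, IsV v ∧ gᵀ * formM R n * g = formM R n ∧
      matD D g = g * (shiftM R n + v) ∧ ∀ i k : Idx n, (k : ℕ) ≤ n → g i k = γ k i := by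
  -- The potential may start at zero, since elements of V_n have no entries in the first n columns.
  -- The columns of γ beyond n are placeholders, overwritten later.
  have h0 : IsFrameUpTo D (⟨n, by omega⟩ : Idx n) (Matrix.of fun i k : Idx n => γ k i) 0 := by
    refine ⟨isV_zero, fun i j hi hj => ?_, fun i j hj => ?_⟩
    · rw [gram_apply]
      simp only [Matrix.of_apply]
      rw [hgram i j hi hj, formM, Matrix.of_apply]
      have hi : (i : ℕ) ≤ n := hi
      have hj : (j : ℕ) ≤ n := hj
      by_cases h : (i : ℕ) = n ∧ (j : ℕ) = n
      · rw [if_pos h, if_pos (by omega), neg_one_pow_congr (b := 0) (by omega), pow_zero]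
      · rw [if_neg h, if_neg (by omega)]
    · have hj : (j : ℕ) < n := hj
      rw [Matrix.sub_apply, mul_shiftM_add_apply _ _ i j ⟨j + 1, by omega⟩ rfl, matD_apply]
      simp [hγ]
  obtain ⟨g, v, h1, h2⟩ := h0.exists_top (by simp)
  exact ⟨g, v, h1.isV, h1.top.1, h1.top.2, fun i k hk => h2 i k hk⟩

/-- Frames are determined by their first `n + 1` columns. -/
theorem frame_unique {g g' v v' : Matrix (Idx n) (Idx n) R} (hv : IsV v) (hv' : IsV v')
    (hg : gᵀ * formM R n * g = formM R n) (hg' : g'ᵀ * formM R n * g' = formM R n)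
    (hD : matD D g = g * (shiftM R n + v)) (hD' : matD D g' = g' * (shiftM R n + v'))
    (h : ∀ i k : Idx n, (k : ℕ) ≤ n → g' i k = g i k) : g' = g := by
  suffices H : ∀ m : ℕ, ∀ hm : n ≤ m, ∀ hm' : m ≤ 2 * n,
      (∀ i j : Idx n, (j : ℕ) ≤ m → g' i j = g i j) ∧ ∀ i j : Idx n, (j : ℕ) < m → v' i j = v i j by
    ext i j
    exact (H (2 * n) (by omega) le_rfl).1 i j (by omega)
  intro m hm
  induction m, hm using Nat.le_induction with
  | base =>
    exact fun _ => ⟨h, fun i j hj => by rw [hv.eq_zero_of_lt hj, hv'.eq_zero_of_lt hj]⟩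
  | succ m hm ih =>
    intro hm'
    obtain ⟨ih1, ih2⟩ := ih (by omega)
    set q : Idx n := ⟨m + 1, by omega⟩ with hqd
    set l : Idx n := ⟨m, by omega⟩ with hld
    have hq : (q : ℕ) = l + 1 := rfl
    have hqm : (q : ℕ) = m + 1 := rfl
    have hp : (q.rev : ℕ) = 2 * n - q := rev_val q
    have hdiff : ∀ i, i ≠ q.rev → (v - v') i l = 0 := by
      have hvv : IsV (v - v') := by
        have := hv.add (hv'.smul (-1))
        rwa [neg_one_smul, ← sub_eq_add_neg] at this
      intro i hi
      exact hvv.val_eq_of_col hq (fun i j hj => by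
        rw [Matrix.sub_apply, ih2 i j hj, sub_self]) i hi
    set a := (v - v') q.rev l with ha
    have hcol : ∀ i, g' i q = g i q + a * g i q.rev := by
      intro i
      have e1 : matD D g' i l = matD D g i l := by
        rw [matD_apply, matD_apply, ih1 i l le_rfl]
      rw [hD, hD', mul_shiftM_add_apply _ _ i l q hq, mul_shiftM_add_apply _ _ i l q hq] at e1
      have e2 : (g' * v') i l = (g * v') i l := by
        rw [Matrix.mul_apply, Matrix.mul_apply]
        refine Finset.sum_congr rfl fun k _ => ?_
        by_cases hk : k ≤ l
        · rw [ih1 i k hk]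
        · rw [hv'.eq_zero_of_le (not_le.1 hk).le, mul_zero, mul_zero]
      have e3 : (g * (v - v')) i l = g i q.rev * a := by
        rw [Matrix.mul_apply, Finset.sum_eq_single q.rev]
        · intro k _ hk
          rw [hdiff k hk, mul_zero]
        · simp
      rw [mul_sub, Matrix.sub_apply] at e3
      linear_combination e1 - e2 + e3
    -- Both candidates for column q are isotropic. They differ by a times column `q.rev`, which is
    -- isotropic and pairs with column q to a sign, so 2a = 0.
    have h1 : bil R n (fun k => g' k q) (fun k => g' k q) = 0 := by
      rw [← gram_apply, hg', formM, Matrix.of_apply, if_neg (by omega)]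
    have h2 : bil R n (fun k => g k q) (fun k => g k q) = 0 := by
      rw [← gram_apply, hg, formM, Matrix.of_apply, if_neg (by omega)]
    have h3 : bil R n (fun k => g k q.rev) (fun k => g k q.rev) = 0 := by
      rw [← gram_apply, hg, formM, Matrix.of_apply, if_neg (by omega)]
    have h4 : bil R n (fun k => g k q) (fun k => g k q.rev) = (-1) ^ (n + (q : ℕ)) := by
      rw [← gram_apply, hg, formM_apply, if_pos rfl]
    have h5 : (fun k => g' k q) = (fun k => g k q) - (-a) • fun k => g k q.rev := by
      funext k
      simp only [Pi.sub_apply, Pi.smul_apply, smul_eq_mul]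
      rw [hcol k]
      ring
    rw [h5, bil_sub_smul_self, h2, h3, h4] at h1
    have h6 : a = 0 := by
      apply eq_zero_of_add_self
      have h7 : ((-1 : R) ^ (n + (q : ℕ))) * (-1) ^ (n + (q : ℕ)) = 1 := by
        rw [← pow_add, neg_one_pow_congr (b := 0) (by omega), pow_zero]
      linear_combination (-1 : R) ^ (n + (q : ℕ)) * h1 - 2 * a * h7
    constructor
    · intro i j hj
      rcases Nat.lt_or_ge j (m + 1) with hj' | hj'
      · exact ih1 i j (by omega)
      · have : j = q := Fin.ext (le_antisymm hj hj')
        rw [this, hcol, h6, zero_mul, add_zero]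
    · intro i j hj
      rcases Nat.lt_or_ge j m with hj' | hj'
      · exact ih2 i j hj'
      · have : j = l := Fin.ext (le_antisymm (by simpa [hld] using Nat.le_of_lt_succ hj) hj')
        rw [this]
        by_cases hi : i = q.rev
        · rw [hi]
          exact (sub_eq_zero.1 h6).symm
        · exact (sub_eq_zero.1 (hdiff i hi)).symm

end

/-! ### Correction terms, column by column -/

section
variable {R : Type*} [CommRing R] [Algebra ℝ R] (D : Derivation ℝ R R) {n : ℕ}

/-- `[∂ + b + u, Q]`, over any differential ring. -/
def brkM (u Q : Matrix (Idx n) (Idx n) R) : Matrix (Idx n) (Idx n) R :=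
  matD D Q + ((shiftM R n + u) * Q - Q * (shiftM R n + u))

theorem brkM_sub (u Q Q' : Matrix (Idx n) (Idx n) R) :
    brkM D u (Q - Q') = brkM D u Q - brkM D u Q' := by
  simp only [brkM, matD_sub, mul_sub, sub_mul]
  abel

/-- `Qᵀ C + C Q` evolves linearly up to the skewness defect of `[∂ + b + u, Q] - v`. -/
theorem matD_skew (u Q v : Matrix (Idx n) (Idx n) R) (hu : IsSkew u) (hv : IsSkew v) :
    matD D (Qᵀ * formM R n + formM R n * Q)
        - (shiftM R n + u)ᵀ * (Qᵀ * formM R n + formM R n * Q)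
        - (Qᵀ * formM R n + formM R n * Q) * (shiftM R n + u)
      = (brkM D u Q - v)ᵀ * formM R n + formM R n * (brkM D u Q - v) := by
  have h : (shiftM R n + u)ᵀ * formM R n = -(formM R n * (shiftM R n + u)) :=
    (isSkew_shiftM.add hu).transpose_mul_formM
  have hv' : vᵀ * formM R n = -(formM R n * v) := hv.transpose_mul_formM
  rw [brkM]
  generalize shiftM R n + u = B at *
  rw [matD_add, matD_mul, matD_mul, matD_formM, matD_transpose]
  simp only [Matrix.transpose_sub, Matrix.transpose_add, Matrix.transpose_mul, mul_sub, sub_mul,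
    mul_add, add_mul, mul_zero, zero_mul, add_zero, zero_add, hv']
  have h1 : Bᵀ * (formM R n * Q) = -(formM R n * (B * Q)) := by
    rw [← Matrix.mul_assoc, h, neg_mul, Matrix.mul_assoc]
  have h2 : Qᵀ * Bᵀ * formM R n = -(Qᵀ * formM R n * B) := by
    rw [Matrix.mul_assoc, h, mul_neg, Matrix.mul_assoc]
  rw [h1, h2]
  simp only [Matrix.mul_assoc]
  abel

variable {D}

/-- A matrix of `o(n+1,n)` with vanishing first column is zero as soon as its bracket with
`∂ + b + u` lies in `V_n`. -/
theorem eq_zero_of_brkM {u N : Matrix (Idx n) (Idx n) R} (hu : IsV u) (hN : IsSkew N)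
    (h0 : ∀ i, N i 0 = 0) (hV : IsV (brkM D u N)) : N = 0 := by
  set v := brkM D u N with hvd
  suffices H : ∀ m : ℕ, ∀ hm' : m ≤ 2 * n,
      (∀ i j : Idx n, (j : ℕ) ≤ m → N i j = 0) ∧ ∀ i j : Idx n, (j : ℕ) < m → v i j = 0 by
    ext i j
    exact (H (2 * n) le_rfl).1 i j (by omega)
  intro m
  induction m with
  | zero =>
    refine fun _ => ⟨fun i j hj => ?_, fun i j hj => absurd hj (Nat.not_lt_zero _)⟩
    have : j = 0 := Fin.ext (by simpa using hj)
    rw [this, h0]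
  | succ m ih =>
    intro hm'
    obtain ⟨ih1, ih2⟩ := ih (by omega)
    set q : Idx n := ⟨m + 1, by omega⟩ with hqd
    set l : Idx n := ⟨m, by omega⟩ with hld
    have hq : (q : ℕ) = l + 1 := rfl
    have hqm : (q : ℕ) = m + 1 := rfl
    have hp : (q.rev : ℕ) = 2 * n - q := rev_val q
    -- Column l of N is zero, so there the bracket reduces to -N b, that is, to minus the next
    -- column of N.
    have hcol : ∀ i, N i q = -v i l := by
      intro i
      have e1 : v i l = (matD D N + ((shiftM R n + u) * N - N * (shiftM R n + u))) i l := rfl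
      have e2 : ((shiftM R n + u) * N) i l = 0 := by
        rw [Matrix.mul_apply]
        exact Finset.sum_eq_zero fun k _ => by rw [ih1 k l le_rfl, mul_zero]
      have e3 : (N * u) i l = 0 := by
        rw [Matrix.mul_apply]
        refine Finset.sum_eq_zero fun k _ => ?_
        by_cases hk : k ≤ l
        · rw [ih1 i k hk, zero_mul]
        · rw [hu.eq_zero_of_le (not_le.1 hk).le, mul_zero]
      rw [Matrix.add_apply, Matrix.sub_apply, e2, mul_shiftM_add_apply _ _ i l q hq, e3,
        matD_apply, ih1 i l le_rfl, map_zero] at e1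
      linear_combination e1
    have hv0 : ∀ i, v i l = 0 := by
      intro i
      -- Row `q.rev` holds the only coefficient that V_n leaves free. There the entry of N lies on
      -- the antidiagonal, where skewness makes it zero.
      by_cases hi : i = q.rev
      · have h1 := isSkew_iff.1 hN q q
        rw [formM_mul_apply, hcol, ← hi] at h1
        have h2 := eq_zero_of_add_self h1
        have h7 : ((-1 : R) ^ (n + (q : ℕ))) * (-1) ^ (n + (q : ℕ)) = 1 := by
          rw [← pow_add, neg_one_pow_congr (b := 0) (by omega), pow_zero]
        linear_combination -(-1 : R) ^ (n + (q : ℕ)) * h2 - v i l * h7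
      · exact hV.val_eq_of_col hq ih2 i hi
    constructor
    · intro i j hj
      rcases Nat.lt_or_ge j (m + 1) with hj' | hj'
      · exact ih1 i j (by omega)
      · have : j = q := Fin.ext (le_antisymm hj hj')
        rw [this, hcol, hv0, neg_zero]
    · intro i j hj
      rcases Nat.lt_or_ge j m with hj' | hj'
      · exact ih2 i j hj'
      · have : j = l := Fin.ext (le_antisymm (by simpa [hld] using Nat.le_of_lt_succ hj) hj')
        rw [this, hv0]

omit [Algebra ℝ R] in
theorem skew_symm (Q : Matrix (Idx n) (Idx n) R) :
    (Qᵀ * formM R n + formM R n * Q)ᵀ = Qᵀ * formM R n + formM R n * Q := by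
  simp only [Matrix.transpose_add, Matrix.transpose_mul, formM_transpose,
    Matrix.transpose_transpose]
  abel

omit [Algebra ℝ R] in
theorem skew_apply (Q : Matrix (Idx n) (Idx n) R) (i j : Idx n) :
    (Qᵀ * formM R n + formM R n * Q) i j
      = (-1) ^ (n + (j : ℕ)) * Q j.rev i + (-1) ^ (n + (i : ℕ)) * Q i.rev j := by
  rw [Matrix.add_apply, mul_formM_apply, formM_mul_apply, Matrix.transpose_apply]

variable (D)

/-- `[∂ + b + u, Q] = v` in the columns below `m`, and skewness in the leading block up to `m`. -/
structure IsCorrUpTo (u : Matrix (Idx n) (Idx n) R) (m : Idx n) (Q v : Matrix (Idx n) (Idx n) R) :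
    Prop where
  isV : IsV v
  skew : ∀ i j, i ≤ m → j ≤ m → (Qᵀ * formM R n + formM R n * Q) i j = 0
  der : ∀ i j : Idx n, j < m → (brkM D u Q - v) i j = 0

variable {D}

/-- The infinitesimal version of `gram_row`: the skewness defect of Q also obeys a homogeneous
linear equation. -/
theorem skew_row {u : Matrix (Idx n) (Idx n) R} (hu : IsV u) {m q : Idx n} (hq : (q : ℕ) = m + 1)
    {Q v : Matrix (Idx n) (Idx n) R} (hv : IsV v)
    (skew : ∀ i j, i ≤ m → j ≤ m → (Qᵀ * formM R n + formM R n * Q) i j = 0)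
    (der : ∀ i j : Idx n, j ≤ m → (brkM D u Q - v) i j = 0) (j : Idx n)
    (hj : j ≤ m) : (Qᵀ * formM R n + formM R n * Q) q j = 0 := by
  refine extend_row D (B := shiftM R n + u) (skew_symm Q) (shiftM_add_one hu) (shiftM_add_zero hu)
    hq skew ?_ j hj
  intro i j hi hj
  rw [matD_skew D u Q v hu.1 hv.1, Matrix.add_apply]
  have h1 : ((brkM D u Q - v)ᵀ * formM R n) i j = 0 := by
    rw [Matrix.mul_apply]
    exact Finset.sum_eq_zero fun l _ => by rw [Matrix.transpose_apply, der l i hi, zero_mul]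
  have h2 : (formM R n * (brkM D u Q - v)) i j = 0 := by
    rw [Matrix.mul_apply]
    exact Finset.sum_eq_zero fun l _ => by rw [der l j hj, mul_zero]
  rw [h1, h2, add_zero]

/-- The column that `[∂ + b + u, Q] = v` prescribes after the column `m`. -/
def nextCol (D : Derivation ℝ R R) (u Q v : Matrix (Idx n) (Idx n) R) (m : Idx n) : Idx n → R :=
  fun i => D (Q i m) + ((shiftM R n + u) * Q) i m - (Q * u) i m - v i m

/-- Up to column m, the bracket involves column q of Q only in column m, and there only through -Q
b. Hence column m of the bracket can be prescribed by choosing column q of Q. -/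
theorem brkM_updateCol {u : Matrix (Idx n) (Idx n) R} (hu : IsV u) {m q : Idx n}
    (hq : (q : ℕ) = m + 1) {Q v w : Matrix (Idx n) (Idx n) R}
    (der : ∀ i j : Idx n, j < m → (brkM D u Q - v) i j = 0)
    (hwv : ∀ i j, j < m → w i j = v i j) (i j : Idx n) (hj : j ≤ m) :
    (brkM D u (Q.updateCol q (nextCol D u Q w m)) - w) i j = 0 := by
  have hql := q.isLt
  have hmq : m < q := Fin.lt_def.2 (by omega)
  have hcol : ∀ c, ∀ i j, j ≤ m → Q.updateCol q c i j = Q i j := fun c i j hj =>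
    Matrix.updateCol_ne (hj.trans_lt hmq).ne
  have hu0 : u q j = 0 := hu.eq_zero_of_le (hj.trans hmq.le)
  have hjq : (j : ℕ) ≤ m := hj
  have hleft : ∀ c, ((shiftM R n + u) * Q.updateCol q c) i j = ((shiftM R n + u) * Q) i j := by
    intro c
    rw [Matrix.mul_apply, Matrix.mul_apply]
    exact Finset.sum_congr rfl fun l _ => by rw [hcol c l j hj]
  rw [Matrix.sub_apply, brkM, Matrix.add_apply, Matrix.sub_apply, hleft,
    mul_shiftM_add_apply _ _ i j ⟨j + 1, by omega⟩ rfl, matD_apply, hcol _ i j hj,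
    updateCol_mul_apply _ _ _ _ _ _ hu0]
  rcases hj.lt_or_eq with hj' | rfl
  · have h1 := der i j hj'
    rw [Matrix.sub_apply, brkM, Matrix.add_apply, Matrix.sub_apply,
      mul_shiftM_add_apply _ _ i j ⟨j + 1, by omega⟩ rfl, matD_apply] at h1
    rw [hcol _ i _ (Fin.le_def.2 (Nat.succ_le_of_lt hj')), hwv i j hj', h1]
  · have : (⟨j + 1, by omega⟩ : Idx n) = q := Fin.ext hq.symm
    rw [this, Matrix.updateCol_self, nextCol]
    ring

theorem IsCorrUpTo.step {u : Matrix (Idx n) (Idx n) R} (hu : IsV u) {m q : Idx n}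
    (hq : (q : ℕ) = m + 1) (hm : n ≤ m) {Q v : Matrix (Idx n) (Idx n) R}
    (h : IsCorrUpTo D u m Q v) :
    ∃ Q' v', IsCorrUpTo D u q Q' v' ∧ ∀ i j : Idx n, j ≤ m → Q' i j = Q i j := by
  have hp : (q.rev : ℕ) = 2 * n - q := rev_val q
  have hql := q.isLt
  have hmq : m < q := Fin.lt_def.2 (by omega)
  -- Skewness at position (q,q) asks that the entry (`q.rev`, q) vanish. This is its value for the
  -- potential v; increasing v by a times the generator lowers it to zero.
  set a : R := nextCol D u Q v m q.rev with ha
  set w := v + a • betaM R m q with hwd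
  have hw : IsV w := h.isV.add ((isV_betaM hq hm).smul a)
  have hcol : ∀ c, ∀ i j, j ≤ m → Q.updateCol q c i j = Q i j := fun c i j hj =>
    Matrix.updateCol_ne (hj.trans_lt hmq).ne
  have hder := brkM_updateCol hu hq (w := w) h.der fun i j hj => by
    simp [hwd, betaM_col_of_lt hq hj]
  set Q' := Q.updateCol q (nextCol D u Q w m) with hQ'
  have hskew : ∀ i j, i ≤ m → j ≤ m → (Q'ᵀ * formM R n + formM R n * Q') i j = 0 := by
    intro i j hi hj
    rw [← h.skew i j hi hj, skew_apply, skew_apply, hQ', hcol _ _ _ hi, hcol _ _ _ hj]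
  have hrow := skew_row hu hq hw hskew hder
  refine ⟨Q', w, ⟨hw, ?_, fun i j hj => hder i j ?_⟩, hcol _⟩
  · have hs : ∀ i j, (Q'ᵀ * formM R n + formM R n * Q') i j
        = (Q'ᵀ * formM R n + formM R n * Q') j i := fun i j =>
      congrFun (congrFun (skew_symm Q') j) i
    have hle : ∀ i : Idx n, i ≤ q → i ≤ m ∨ i = q := by
      intro i hi
      rcases hi.lt_or_eq with h1 | h1
      · left
        have := Fin.lt_def.1 h1
        exact Fin.le_def.2 (by omega)
      · exact Or.inr h1
    intro i j hi hj
    rcases hle i hi with hi' | hi' <;> rcases hle j hj with hj' | hj'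
    · exact hskew i j hi' hj'
    · rw [hj', hs, hrow i hi']
    · rw [hi', hrow j hj']
    · have h8 : nextCol D u Q w m q.rev = 0 := by
        have : nextCol D u Q w m q.rev = nextCol D u Q v m q.rev - a := by
          simp only [nextCol, hwd, Matrix.add_apply, Matrix.smul_apply, betaM_col_self hq,
            if_true, smul_eq_mul, mul_one]
          ring
        rw [this, ha, sub_self]
      rw [hi', hj', skew_apply, hQ', Matrix.updateCol_self, h8]
      ring
  · have := Fin.lt_def.1 hj
    exact Fin.le_def.2 (by omega)

theorem IsCorrUpTo.exists_top {u : Matrix (Idx n) (Idx n) R} (hu : IsV u) {m : Idx n} (hm : n ≤ m)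
    {Q v : Matrix (Idx n) (Idx n) R} (h : IsCorrUpTo D u m Q v) :
    ∃ Q' v', IsCorrUpTo D u (Fin.last (2 * n)) Q' v' ∧
      ∀ i j : Idx n, j ≤ m → Q' i j = Q i j := by
  obtain ⟨k, hk⟩ : ∃ k, (m : ℕ) + k = 2 * n := ⟨2 * n - m, by omega⟩
  induction k generalizing m Q v with
  | zero =>
    have : m = Fin.last (2 * n) := Fin.ext hk
    subst this
    exact ⟨Q, v, h, fun _ _ _ => rfl⟩
  | succ k ih =>
    obtain ⟨Q1, v1, h1, h2⟩ := h.step hu (q := ⟨m + 1, by omega⟩) rfl hm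
    obtain ⟨Q2, v2, h3, h4⟩ := ih (m := ⟨m + 1, by omega⟩) (by simp; omega) h1 (by simp; omega)
    refine ⟨Q2, v2, h3, fun i j hj => ?_⟩
    rw [h4 i j (Fin.le_def.2 (by have := Fin.le_def.1 hj; simp; omega)), h2 i j hj]

/-- As for frames, the last column follows from antisymmetry: the skewness defect of Q vanishes, so
C times the remaining error is antisymmetric and supported in that column. -/
theorem IsCorrUpTo.top {u Q v : Matrix (Idx n) (Idx n) R} (hu : IsV u)
    (h : IsCorrUpTo D u (Fin.last (2 * n)) Q v) : IsSkew Q ∧ brkM D u Q = v := by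
  have hQ : IsSkew Q := by
    ext i j
    exact h.skew i j (Fin.le_last _) (Fin.le_last _)
  refine ⟨hQ, ?_⟩
  have h1 := matD_skew D u Q v hu.1 h.isV.1
  rw [IsSkew] at hQ
  rw [hQ, matD_zero, mul_zero, zero_mul, sub_self, sub_self] at h1
  have h2 : formM R n * (brkM D u Q - v) = 0 := by
    refine eq_zero_of_skew_of_last (isSkew_iff.1 h1.symm) fun i j hj => ?_
    rw [Matrix.mul_apply]
    exact Finset.sum_eq_zero fun l _ => by rw [h.der l j (Fin.lt_def.2 hj), mul_zero]
  rw [← sub_eq_zero, ← one_mul (brkM D u Q - v), ← formM_mul_self, Matrix.mul_assoc, h2, mul_zero]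

/-- A matrix of `o(n+1,n)` whose bracket with `∂ + b + u` is upper triangular can be corrected by a
strictly upper triangular one so that the bracket lies in `V_n`. -/
theorem exists_correction {u A : Matrix (Idx n) (Idx n) R} (hu : IsV u) (hA : IsSkew A)
    (hbrk : ∀ i j, j < i → brkM D u A i j = 0) :
    ∃ Q, IsSkew Q ∧ IsV (brkM D u Q) ∧ ∀ i j, j ≤ i → Q i j = A i j := by
  -- V_n has no entries in the columns before n, so the bracket must vanish there, which fixes the
  -- next columns. Entries on or below the diagonal stay those of A: their recursion involves only
  -- such entries, and by `hbrk` those of A satisfy it too.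
  have phase1 : ∀ m : ℕ, ∀ hm : m ≤ n, ∃ Q : Matrix (Idx n) (Idx n) R,
      (∀ i j, j ≤ i → Q i j = A i j) ∧ ∀ i j : Idx n, (j : ℕ) < m → brkM D u Q i j = 0 := by
    intro m
    induction m with
    | zero => exact fun _ => ⟨A, fun _ _ _ => rfl, fun i j hj => absurd hj (Nat.not_lt_zero _)⟩
    | succ m ih =>
      intro hm
      obtain ⟨Q, h1, h2⟩ := ih (by omega)
      set l : Idx n := ⟨m, by omega⟩ with hl
      set q : Idx n := ⟨m + 1, by omega⟩ with hqd
      have hq : (q : ℕ) = l + 1 := rfl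
      have hder := brkM_updateCol (D := D) hu hq (Q := Q) (v := 0) (w := 0)
        (fun i j hj => by rw [sub_zero]; exact h2 i j hj) fun i j hj => rfl
      refine ⟨Q.updateCol q (nextCol D u Q 0 l), fun i j hij => ?_, fun i j hj => ?_⟩
      · by_cases hj : j = q
        · have hi : l < i := lt_of_lt_of_le (Fin.lt_def.2 (by omega)) (hj ▸ hij)
          have h3 := hbrk i l hi
          have hlm : (l : ℕ) < n := by simp only [hl]; omega
          rw [brkM, Matrix.add_apply, Matrix.sub_apply, mul_shiftM_add_apply _ _ i l q hq,
            hu.mul_col_zero hlm, matD_apply] at h3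
          rw [hj, Matrix.updateCol_self, nextCol, hu.mul_col_zero hlm, h1 i l hi.le,
            Matrix.zero_apply]
          have h4 : ((shiftM R n + u) * Q) i l = ((shiftM R n + u) * A) i l := by
            rw [Matrix.mul_apply, Matrix.mul_apply]
            refine Finset.sum_congr rfl fun k _ => ?_
            by_cases hk : l ≤ k
            · rw [h1 k l hk]
            · rw [shiftM_add_zero hu, zero_mul, zero_mul]
              have := Fin.lt_def.1 (not_le.1 hk)
              have := Fin.lt_def.1 hi
              omega
          rw [h4]
          linear_combination h3
        · rw [Matrix.updateCol_ne hj, h1 i j hij]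
      · have := hder i j (Fin.le_def.2 (by simp only [hl]; omega))
        rwa [sub_zero] at this
  obtain ⟨Q, h1, h2⟩ := phase1 n le_rfl
  -- The skewness of the leading block involves only entries on or below the diagonal, so it is
  -- inherited from A.
  have hrev : ∀ i j : Idx n, (i : ℕ) ≤ n → (j : ℕ) ≤ n → Q i.rev j = A i.rev j := fun i j hi hj =>
    h1 _ _ (Fin.le_def.2 (by rw [rev_val]; omega))
  have h3 : IsCorrUpTo D u (⟨n, by omega⟩ : Idx n) Q 0 := by
    refine ⟨isV_zero, fun i j hi hj => ?_, fun i j hj => ?_⟩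
    · have hi : (i : ℕ) ≤ n := hi
      have hj : (j : ℕ) ≤ n := hj
      rw [skew_apply, hrev i j hi hj, hrev j i hj hi, ← skew_apply]
      exact congrFun (congrFun hA i) j
    · rw [sub_zero]
      exact h2 i j hj
  obtain ⟨Q', v, h4, h5⟩ := h3.exists_top hu (by simp)
  obtain ⟨h6, h7⟩ := h4.top hu
  refine ⟨Q', h6, h7 ▸ h4.isV, fun i j hij => ?_⟩
  have low : ∀ i j : Idx n, (j : ℕ) ≤ n → j ≤ i → Q' i j = A i j := fun i j hj hij => by
    rw [h5 i j hj, h1 i j hij]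
  -- Reflection in the antidiagonal preserves the lower triangle and takes the columns beyond n to
  -- columns before n.
  by_cases hj : (j : ℕ) ≤ n
  · exact low i j hj hij
  · rw [h6.apply_rev, hA.apply_rev, low j.rev i.rev]
    · have := Fin.le_def.1 hij
      rw [rev_val]
      omega
    · exact Fin.rev_le_rev.2 hij

end

/-! ### Dressing in complete filtered rings -/

section
variable {A : Type*} [Ring A]

/-- `J` satisfies `J^{M+1} = λ J` with `λ` a central unit of inverse `μ`, and `K` is its inverse on
its image. -/
structure IsCyc (M : ℕ) (J K lam mu : A) : Prop where
  two_le : 2 ≤ M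
  lam_comm : ∀ X, Commute lam X
  mu_comm : ∀ X, Commute mu X
  lam_mu : lam * mu = 1
  pow : J ^ (M + 1) = lam * J
  K_eq : K = mu * J ^ (M - 1)

namespace IsCyc
variable {M : ℕ} {J K lam mu : A}

theorem mu_lam (h : IsCyc M J K lam mu) : mu * lam = 1 := (h.mu_comm lam).eq.trans h.lam_mu

theorem comm (h : IsCyc M J K lam mu) : Commute J K := by
  rw [h.K_eq]
  exact (h.mu_comm J).symm.mul_right ((Commute.refl J).pow_right _)

/-- The element e = JK is idempotent with eJ = Je = J. It is 1 in type A. In type B, where J is not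
invertible, it has corank one, and this is why K is only an inverse on the image of J. -/
theorem JK (h : IsCyc M J K lam mu) : J * K = mu * J ^ M := by
  have := h.two_le
  rw [h.comm.eq, h.K_eq, mul_assoc, ← pow_succ, Nat.sub_add_cancel (by omega)]

theorem lam_JK (h : IsCyc M J K lam mu) : J ^ M = lam * (J * K) := by
  rw [h.JK, ← mul_assoc, h.lam_mu, one_mul]

theorem JKJ (h : IsCyc M J K lam mu) : J * K * J = J := by
  rw [h.JK, mul_assoc, ← pow_succ, h.pow, ← mul_assoc, h.mu_lam, one_mul]

theorem KJK (h : IsCyc M J K lam mu) : K * (J * K) = K := by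
  have h2 := h.two_le
  rw [h.JK, h.K_eq, mul_assoc, ← mul_assoc _ mu, ← (h.mu_comm _).eq, mul_assoc, ← pow_add]
  have : M - 1 + M = M + 1 + (M - 2) := by omega
  rw [this, pow_add, h.pow, mul_assoc lam, ← pow_succ', ← mul_assoc mu lam, h.mu_lam, one_mul]
  congr 2
  omega

theorem J_mul_one_sub (h : IsCyc M J K lam mu) : J * (1 - J * K) = 0 := by
  rw [mul_sub, mul_one, h.comm.eq, ← mul_assoc, h.JKJ, sub_self]

theorem one_sub_mul_J (h : IsCyc M J K lam mu) : (1 - J * K) * J = 0 := by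
  rw [sub_mul, one_mul, h.JKJ, sub_self]

theorem K_pow (h : IsCyc M J K lam mu) : K ^ M = mu * (J * K) := by
  have h2 := h.two_le
  have hid : (J * K) * (J * K) = J * K := by rw [mul_assoc, h.KJK]
  have h3 : ∀ k, (J * K) ^ (k + 1) = J * K := by
    intro k
    induction k with
    | zero => simp
    | succ k ih => rw [pow_succ, ih, hid]
  have h4 : J ^ M * K ^ M = J * K := by
    rw [← h.comm.mul_pow]
    obtain ⟨k, rfl⟩ : ∃ k, M = k + 1 := ⟨M - 1, by omega⟩
    exact h3 k
  have h5 : J * K * K ^ M = K ^ M := by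
    obtain ⟨k, rfl⟩ : ∃ k, M = k + 1 := ⟨M - 1, by omega⟩
    rw [pow_succ', ← mul_assoc, mul_assoc J K K, ← mul_assoc, h.comm.eq, mul_assoc K J K, h.KJK]
  rw [h.lam_JK, mul_assoc, h5] at h4
  rw [← h4, ← mul_assoc, h.mu_lam, one_mul]

theorem idem (h : IsCyc M J K lam mu) : J * K * (J * K) = J * K := by rw [mul_assoc, h.KJK]

theorem K_pow_mul (h : IsCyc M J K lam mu) (a : ℕ) : K ^ (a + 1) * (J * K) = K ^ (a + 1) := by
  rw [pow_succ, mul_assoc, h.KJK]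

variable [Algebra ℝ A]

/-- The projection onto the centralizer of `J`. -/
def proj (M : ℕ) (J K X : A) : A :=
  (1 - J * K) * X * (1 - J * K)
    + (M : ℝ)⁻¹ • ∑ a ∈ Finset.range M, J ^ (a + 1) * X * K ^ (a + 1)

/-- A partial inverse of the commutator with `J`. -/
def invAd (M : ℕ) (J K X : A) : A :=
  K * X * (1 - J * K) - (1 - J * K) * X * K
    - (M : ℝ)⁻¹ • ∑ a ∈ Finset.range M, ∑ b ∈ Finset.range (a + 1), J ^ b * (J * K) * X * K ^ (b + 1)

/-- The block cut out by 1 - e is killed by J on both sides. The rest is an average over conjugation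
by J, whose commutator with J telescopes; the two ends agree because J^{M+1} = λJ and K^M = μe. -/
theorem proj_comm (h : IsCyc M J K lam mu) (X : A) : J * proj M J K X = proj M J K X * J := by
  unfold proj
  have h1 : J * ((1 - J * K) * X * (1 - J * K)) = 0 := by
    rw [mul_assoc, ← mul_assoc, h.J_mul_one_sub, zero_mul]
  have h2 : (1 - J * K) * X * (1 - J * K) * J = 0 := by
    rw [mul_assoc, h.one_sub_mul_J, mul_zero]
  rw [mul_add, add_mul, h1, h2, zero_add, zero_add, mul_smul_comm, smul_mul_assoc]
  congr 1
  rw [Finset.mul_sum, Finset.sum_mul]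
  have e1 : ∀ a, J * (J ^ (a + 1) * X * K ^ (a + 1)) = J ^ (a + 1 + 1) * X * (K ^ (a + 1) * (J * K)) := by
    intro a
    rw [h.K_pow_mul, pow_succ' J (a + 1)]
    simp only [mul_assoc]
  have e2 : ∀ a, J ^ (a + 1) * X * K ^ (a + 1) * J = J ^ (a + 1) * X * (K ^ a * (J * K)) := by
    intro a
    rw [h.comm.eq, pow_succ K]
    simp only [mul_assoc]
  simp only [e1, e2]
  rw [← sub_eq_zero, ← Finset.sum_sub_distrib,
    Finset.sum_range_sub (fun a => J ^ (a + 1) * X * (K ^ a * (J * K))), h.pow, h.K_pow]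
  rw [mul_assoc mu, h.idem, zero_add, pow_one, pow_zero, one_mul, mul_assoc lam J X,
    ← mul_assoc _ mu, (h.lam_comm _).eq, mul_assoc _ lam mu, h.lam_mu, mul_one, sub_self]

/-- In the blocks eX(1-e) and (1-e)Xe, multiplication of [J,X] by K recovers X up to sign. In the
block eXe, each difference eXe - J^a X K^a is up to sign a telescoping sum of conjugates of [J,X],
and these are averaged over a. -/
theorem sub_proj (h : IsCyc M J K lam mu) (X : A) :
    X - proj M J K X = invAd M J K (J * X - X * J) := by
  have hM : (M : ℝ) ≠ 0 := by
    have := h.two_le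
    positivity
  set Cm := J * X - X * J with hC
  have hJX : J * X = Cm + X * J := by rw [hC]; abel
  have e1 : K * Cm * (1 - J * K) = J * K * X * (1 - J * K) := by
    calc K * Cm * (1 - J * K) = K * J * X * (1 - J * K) - K * X * (J * (1 - J * K)) := by
          rw [hC]
          noncomm_ring
      _ = _ := by rw [h.J_mul_one_sub, mul_zero, sub_zero, h.comm.eq]
  have e2 : (1 - J * K) * Cm * K = -((1 - J * K) * X * (J * K)) := by
    rw [hC, mul_sub, ← mul_assoc, h.one_sub_mul_J, zero_mul, zero_sub, neg_mul]
    simp only [mul_assoc]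
  have hJe : ∀ b, J ^ (b + 1) * (J * K) = J ^ (b + 1) := by
    intro b
    have : J * (J * K) = J := by rw [h.comm.eq, ← mul_assoc, h.JKJ]
    rw [pow_succ, mul_assoc, this]
  have e3 : ∀ b, J ^ b * (J * K) * Cm * K ^ (b + 1)
      = J ^ (b + 1) * (J * K) * X * (J * K * K ^ (b + 1)) - J ^ b * (J * K) * X * (J * K * K ^ b) := by
    intro b
    have h1 : J * K * K ^ (b + 1) = K ^ (b + 1) := by
      rw [pow_succ', ← mul_assoc, h.comm.eq, mul_assoc K J K, h.KJK]
    have h2 : J ^ (b + 1) * (J * K) = J ^ b * (J * K) * J := by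
      rw [mul_assoc (J ^ b), h.JKJ, hJe, pow_succ]
    rw [h1, h2, hC, mul_sub, sub_mul]
    congr 1
    · simp only [mul_assoc]
    · rw [pow_succ']
      simp only [mul_assoc]
  have e4 : ∀ a, ∑ b ∈ Finset.range (a + 1), J ^ b * (J * K) * Cm * K ^ (b + 1)
      = J ^ (a + 1) * X * K ^ (a + 1) - J * K * X * (J * K) := by
    intro a
    simp only [e3]
    rw [Finset.sum_range_sub (fun b => J ^ b * (J * K) * X * (J * K * K ^ b)), hJe, pow_zero,
      pow_zero, one_mul, mul_one]
    congr 2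
    rw [pow_succ', ← mul_assoc, h.comm.eq, mul_assoc K J K, h.KJK]
  unfold invAd proj
  simp only [e4]
  rw [e1, e2, Finset.sum_sub_distrib, smul_sub, Finset.sum_const, Finset.card_range,
    ← Nat.cast_smul_eq_nsmul ℝ, smul_smul, inv_mul_cancel₀ hM, one_smul]
  noncomm_ring

/-- All multipliers in `invAd` commute with J, so `invAd` commutes with ad J. With `sub_proj` this
gives X = proj X + [J, invAd X]. -/
theorem invAd_comm (h : IsCyc M J K lam mu) (X : A) :
    invAd M J K (J * X - X * J) = J * invAd M J K X - invAd M J K X * J := by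
  have hJe : Commute J (1 - J * K) :=
    (Commute.one_right J).sub_right ((Commute.refl J).mul_right h.comm)
  have key : ∀ P Q : A, Commute J P → Commute J Q →
      P * (J * X - X * J) * Q = J * (P * X * Q) - P * X * Q * J := by
    intro P Q hP hQ
    rw [mul_sub, sub_mul, ← mul_assoc, ← hP.eq]
    simp only [mul_assoc]
    rw [hQ.eq]
  unfold invAd
  have k1 := key K (1 - J * K) h.comm hJe
  have k2 := key (1 - J * K) K hJe h.comm
  have k3 : ∀ b, _ := fun b => key (J ^ b * (J * K)) (K ^ (b + 1))
    (((Commute.refl J).pow_right b).mul_right ((Commute.refl J).mul_right h.comm))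
    (h.comm.pow_right (b + 1))
  rw [k1, k2]
  simp only [k3, Finset.sum_sub_distrib, ← Finset.mul_sum, ← Finset.sum_mul, smul_sub]
  rw [← mul_smul_comm, ← smul_mul_assoc]
  noncomm_ring

end IsCyc

/-! ### Complete filtrations, dressing and resolvents -/

variable [Algebra ℝ A]

/-- A complete separated filtration of a ring, in which `J` has degree `1` and `λ` degree `M`. -/
structure IsFiltr (M : ℕ) (J lam mu : A) (F : ℤ → AddSubgroup A) : Prop where
  mono : ∀ {a b : ℤ}, a ≤ b → F a ≤ F b
  one : (1 : A) ∈ F 0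
  smul : ∀ (c : ℝ) {a : ℤ} {X : A}, X ∈ F a → c • X ∈ F a
  mul : ∀ {a b : ℤ} {X Y : A}, X ∈ F a → Y ∈ F b → X * Y ∈ F (a + b)
  J : J ∈ F 1
  lam : lam ∈ F M
  mu : mu ∈ F (-M)
  sep : ∀ X, (∀ k : ℕ, X ∈ F (-k)) → X = 0
  complete : ∀ X : ℕ → A, (∀ k : ℕ, X (k + 1) - X k ∈ F (-(k + 1))) →
    ∃ Y, ∀ k : ℕ, Y - X k ∈ F (-(k + 1))

namespace IsFiltr
variable {M : ℕ} {J K lam mu : A} {F : ℤ → AddSubgroup A}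

theorem mul' (hF : IsFiltr M J lam mu F) {a b c : ℤ} {X Y : A} (hX : X ∈ F a) (hY : Y ∈ F b)
    (h : a + b ≤ c) : X * Y ∈ F c := hF.mono h (hF.mul hX hY)

theorem pow (hF : IsFiltr M J lam mu F) {a : ℤ} {X : A} (hX : X ∈ F a) (k : ℕ) :
    X ^ k ∈ F (k * a) := by
  induction k with
  | zero => simpa using hF.one
  | succ k ih =>
    rw [pow_succ]
    exact hF.mul' ih hX (by push_cast; linarith)

theorem J_pow (hF : IsFiltr M J lam mu F) (k : ℕ) : J ^ k ∈ F k := by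
  simpa using hF.pow hF.J k

theorem K_mem (hF : IsFiltr M J lam mu F) (h : IsCyc M J K lam mu) : K ∈ F (-1) := by
  have := h.two_le
  rw [h.K_eq]
  exact hF.mul' hF.mu (hF.J_pow (M - 1)) (by omega)

theorem e_mem (hF : IsFiltr M J lam mu F) (h : IsCyc M J K lam mu) : J * K ∈ F 0 :=
  hF.mul' hF.J (hF.K_mem h) (by omega)

theorem one_sub_e_mem (hF : IsFiltr M J lam mu F) (h : IsCyc M J K lam mu) : 1 - J * K ∈ F 0 :=
  sub_mem hF.one (hF.e_mem h)

theorem K_pow (hF : IsFiltr M J lam mu F) (h : IsCyc M J K lam mu) (k : ℕ) : K ^ k ∈ F (-k) := by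
  simpa using hF.pow (hF.K_mem h) k

theorem proj_mem (hF : IsFiltr M J lam mu F) (h : IsCyc M J K lam mu) {m : ℤ} {X : A}
    (hX : X ∈ F m) : IsCyc.proj M J K X ∈ F m := by
  refine add_mem ?_ (hF.smul _ (sum_mem fun a _ => ?_))
  · exact hF.mul' (hF.mul' (hF.one_sub_e_mem h) hX le_rfl) (hF.one_sub_e_mem h) (by omega)
  · exact hF.mul' (hF.mul' (hF.J_pow (a + 1)) hX le_rfl) (hF.K_pow h (a + 1)) (by omega)

theorem invAd_mem (hF : IsFiltr M J lam mu F) (h : IsCyc M J K lam mu) {m : ℤ} {X : A}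
    (hX : X ∈ F m) : IsCyc.invAd M J K X ∈ F (m - 1) := by
  refine sub_mem (sub_mem ?_ ?_) (hF.smul _ (sum_mem fun a _ => sum_mem fun b _ => ?_))
  · exact hF.mul' (hF.mul' (hF.K_mem h) hX le_rfl) (hF.one_sub_e_mem h) (by omega)
  · exact hF.mul' (hF.mul' (hF.one_sub_e_mem h) hX le_rfl) (hF.K_mem h) (by omega)
  · exact hF.mul' (hF.mul' (hF.mul' (hF.J_pow b) (hF.e_mem h) le_rfl) hX le_rfl)
      (hF.K_pow h (b + 1)) (by push_cast; omega)

theorem decomp (hF : IsFiltr M J lam mu F) (h : IsCyc M J K lam mu) {m : ℤ} {X : A}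
    (hX : X ∈ F m) : ∃ Z ∈ F m, ∃ Y ∈ F (m - 1), Commute J Z ∧ X = Z + (J * Y - Y * J) := by
  refine ⟨_, hF.proj_mem h hX, _, hF.invAd_mem h hX, h.proj_comm X, ?_⟩
  rw [← h.invAd_comm, ← h.sub_proj]
  abel

/-- A commutator with J normally raises the degree by one. If it does not, `invAd`, which lowers the
degree by one, shows that the top part of X commutes with J. -/
theorem leading (hF : IsFiltr M J lam mu F) (h : IsCyc M J K lam mu) {m : ℤ} {X : A}
    (hX : X ∈ F m) (hJ : J * X - X * J ∈ F m) : ∃ Z ∈ F m, Commute J Z ∧ X - Z ∈ F (m - 1) :=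
  ⟨_, hF.proj_mem h hX, h.proj_comm X, h.sub_proj X ▸ hF.invAd_mem h hJ⟩

/-- The geometric series in 1 - T converges by completeness. -/
theorem exists_inverse (hF : IsFiltr M J lam mu F) {T : A} (hT : T - 1 ∈ F (-1)) :
    ∃ Y ∈ F 0, T * Y = 1 ∧ Y * T = 1 := by
  set N := 1 - T with hN
  have hNm : N ∈ F (-1) := by
    have := neg_mem hT
    rwa [neg_sub] at this
  have hNk : ∀ k : ℕ, N ^ k ∈ F (-k) := fun k => by simpa using hF.pow hNm k
  obtain ⟨Y, hY⟩ := hF.complete (fun k => ∑ i ∈ Finset.range (k + 1), N ^ i) fun k => by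
    rw [Finset.sum_range_succ _ (k + 1), add_sub_cancel_left]
    exact_mod_cast hNk (k + 1)
  have hTN : T = 1 - N := by rw [hN]; abel
  have hT0 : T ∈ F 0 := by
    rw [hTN]
    exact sub_mem hF.one (hF.mono (by omega) hNm)
  have hY0 : Y ∈ F 0 := by
    have h1 := hF.mono (show -((0 : ℕ) + 1 : ℤ) ≤ 0 by simp) (hY 0)
    have h2 : Y = Y - ∑ i ∈ Finset.range (0 + 1), N ^ i + 1 := by simp
    rw [h2]
    exact add_mem h1 hF.one
  refine ⟨Y, hY0, ?_, ?_⟩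
  · rw [← sub_eq_zero]
    refine hF.sep _ fun k => ?_
    have h1 : T * ∑ i ∈ Finset.range (k + 1), N ^ i = 1 - N ^ (k + 1) := by
      rw [hTN, mul_neg_geom_sum]
    have h2 : T * Y - 1 = T * (Y - ∑ i ∈ Finset.range (k + 1), N ^ i) - N ^ (k + 1) := by
      rw [mul_sub, h1]
      abel
    rw [h2]
    exact sub_mem (hF.mul' hT0 (hY k) (by omega)) (hF.mono (by push_cast; omega) (hNk (k + 1)))
  · rw [← sub_eq_zero]
    refine hF.sep _ fun k => ?_
    have h1 : (∑ i ∈ Finset.range (k + 1), N ^ i) * T = 1 - N ^ (k + 1) := by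
      rw [hTN, geom_sum_mul_neg]
    have h2 : Y * T - 1 = (Y - ∑ i ∈ Finset.range (k + 1), N ^ i) * T - N ^ (k + 1) := by
      rw [sub_mul, h1]
      abel
    rw [h2]
    exact sub_mem (hF.mul' (hY k) hT0 (by omega)) (hF.mono (by push_cast; omega) (hNk (k + 1)))

/-- A derivation of a filtered ring which kills `J`. -/
structure IsDer (F : ℤ → AddSubgroup A) (D : A →+ A) (J : A) : Prop where
  leib : ∀ X Y, D (X * Y) = D X * Y + X * D Y
  mem : ∀ {a : ℤ} {X : A}, X ∈ F a → D X ∈ F a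
  J : D J = 0

/-- Every `∂ + J + u` with `u` of degree zero is conjugate to some `∂ + J + H` with `H` commuting
with `J`. -/
theorem exists_dressing (hF : IsFiltr M J lam mu F) (h : IsCyc M J K lam mu) {D : A →+ A}
    (hD : IsDer F D J) {u : A} (hu : u ∈ F 0) :
    ∃ T H, T - 1 ∈ F (-1) ∧ Commute J H ∧ D T + (J + u) * T - T * (J + H) = 0 := by
  have hD1 : D 1 = 0 := by
    have := hD.leib 1 1
    simpa using this
  let E : A × A → A := fun p => D p.1 + (J + u) * p.1 - p.1 * (J + p.2)
  -- One step of the iteration: an error of degree -k splits as Z + [J,Y] with Z commuting with J.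
  -- Replacing T by T - Y and H by H + Z cancels it and leaves an error one degree lower.
  have step : ∀ (k : ℕ) (p : A × A), p.1 - 1 ∈ F (-1) → p.2 ∈ F 0 → Commute J p.2 →
      E p ∈ F (-k) → ∃ q : A × A, q.1 - 1 ∈ F (-1) ∧ q.2 ∈ F 0 ∧ Commute J q.2 ∧
        E q ∈ F (-(k + 1)) ∧ q.1 - p.1 ∈ F (-(k + 1)) ∧ q.2 - p.2 ∈ F (-k) := by
    rintro k ⟨T, H⟩ hT hH hc hE
    obtain ⟨Z, hZ, Y, hY, hJZ, hX⟩ := hF.decomp h hE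
    simp only at hT hH hc hX
    have hY1 : Y ∈ F (-(k + 1)) := hF.mono (by omega) hY
    have hZ0 : Z ∈ F 0 := hF.mono (by omega) hZ
    refine ⟨(T - Y, H + Z), ?_, add_mem hH hZ0, hc.add_right hJZ, ?_, ?_, ?_⟩
    · have : T - Y - 1 = T - 1 - Y := by abel
      simp only [this]
      exact sub_mem hT (hF.mono (by omega) hY1)
    · have h1 : E (T - Y, H + Z)
          = -(D Y) - u * Y + Y * (H + Z) - (T - 1) * Z := by
        have h2 : E (T - Y, H + Z) = E (T, H) - D Y - (J + u) * Y + Y * (J + (H + Z)) - T * Z := by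
          simp only [E, map_sub]
          noncomm_ring
        rw [h2, hX]
        noncomm_ring
      rw [h1]
      refine sub_mem (add_mem (sub_mem (neg_mem (hD.mem hY1)) ?_) ?_) ?_
      · exact hF.mul' hu hY1 (by omega)
      · exact hF.mul' hY1 (add_mem hH hZ0) (by omega)
      · exact hF.mul' hT hZ (by omega)
    · have : (T - Y) - T = -Y := by abel
      simp only [this]
      exact neg_mem hY1
    · simpa using hZ
  choose! f hf1 hf2 hf3 hf4 hf5 hf6 using step
  let p : ℕ → A × A := fun k => Nat.rec (1, 0) (fun k q => f k q) k
  have hp : ∀ k, (p k).1 - 1 ∈ F (-1) ∧ (p k).2 ∈ F 0 ∧ Commute J (p k).2 ∧ E (p k) ∈ F (-k) := by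
    intro k
    induction k with
    | zero =>
      refine ⟨by simp [p], by simp [p], by simp [p], ?_⟩
      have : E (p 0) = u := by simp [E, p, hD1]
      rw [this]
      simpa using hu
    | succ k ih =>
      obtain ⟨i1, i2, i3, i4⟩ := ih
      refine ⟨hf1 k _ i1 i2 i3 i4, hf2 k _ i1 i2 i3 i4, hf3 k _ i1 i2 i3 i4, ?_⟩
      exact_mod_cast hf4 k _ i1 i2 i3 i4
  obtain ⟨T, hT⟩ := hF.complete (fun k => (p k).1) fun k =>
    hf5 k _ (hp k).1 (hp k).2.1 (hp k).2.2.1 (hp k).2.2.2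
  obtain ⟨H, hH⟩ := hF.complete (fun k => (p (k + 1)).2) fun k => by
    have := hf6 (k + 1) _ (hp (k + 1)).1 (hp (k + 1)).2.1 (hp (k + 1)).2.2.1 (hp (k + 1)).2.2.2
    exact_mod_cast this
  have hT1 : T - 1 ∈ F (-1) := by
    have := add_mem (hT 0) (hp 0).1
    simpa [p] using this
  have hT0 : T ∈ F 0 := by
    have := add_mem (hF.mono (by omega) hT1 : _ ∈ F 0) hF.one
    simpa using this
  refine ⟨T, H, hT1, ?_, ?_⟩
  · change J * H = H * J
    rw [← sub_eq_zero]
    refine hF.sep _ fun k => ?_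
    have h1 := hH k
    have h2 : J * H - H * J = J * (H - (p (k + 1)).2) - (H - (p (k + 1)).2) * J := by
      rw [mul_sub, sub_mul, (hp (k + 1)).2.2.1.eq]
      abel
    rw [h2]
    exact sub_mem (hF.mul' hF.J h1 (by omega)) (hF.mul' h1 hF.J (by omega))
  · refine hF.sep _ fun k => ?_
    -- The approximation of T is taken at stage k + 1, since multiplying T - T' by J costs one
    -- degree.
    have h1 := hT (k + 1)
    have h2 := hH k
    have h3 := (hp (k + 1)).2.2.2
    set T' := (p (k + 1)).1
    set H' := (p (k + 1)).2
    have hH'0 : H' ∈ F 0 := (hp (k + 1)).2.1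
    have h4 : D T + (J + u) * T - T * (J + H)
        = E (p (k + 1)) + D (T - T') + J * (T - T') + u * (T - T') - (T - T') * J
          - (T - T') * H' - T * (H - H') := by
      have : E (p (k + 1)) = D T' + (J + u) * T' - T' * (J + H') := rfl
      rw [this, map_sub]
      noncomm_ring
    rw [h4]
    refine sub_mem (sub_mem (sub_mem (add_mem (add_mem (add_mem ?_ ?_) ?_) ?_) ?_) ?_) ?_
    · exact hF.mono (by push_cast; omega) h3
    · exact hF.mono (by push_cast; omega) (hD.mem h1)
    · exact hF.mul' hF.J h1 (by push_cast; omega)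
    · exact hF.mul' hu h1 (by push_cast; omega)
    · exact hF.mul' h1 hF.J (by push_cast; omega)
    · exact hF.mul' h1 hH'0 (by push_cast; omega)
    · exact hF.mul' hT0 h2 (by omega)

/-- Existence of a solution of `[∂ + J + u, S] = 0` conjugate to `J`. -/
theorem exists_resolvent (hF : IsFiltr M J lam mu F) (h : IsCyc M J K lam mu) {D : A →+ A}
    (hD : IsDer F D J) {u : A} (hu : u ∈ F 0) :
    ∃ T Y, T * Y = 1 ∧ Y * T = 1 ∧ T * J * Y - J ∈ F 0 ∧ (T * J * Y) ^ (M + 1) = lam * (T * J * Y) ∧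
      D (T * J * Y) + ((J + u) * (T * J * Y) - T * J * Y * (J + u)) = 0 := by
  obtain ⟨T, H, hT, hJH, hE⟩ := hF.exists_dressing h hD hu
  obtain ⟨Y, hY, hTY, hYT⟩ := hF.exists_inverse hT
  have hD1 : D 1 = 0 := by
    have := hD.leib 1 1
    simpa using this
  refine ⟨T, Y, hTY, hYT, ?_, ?_, ?_⟩
  · have h1 : T * J * Y - J = ((T - 1) * J - J * (T - 1)) * Y := by
      have : J * (T * Y) = J := by rw [hTY, mul_one]
      calc T * J * Y - J = T * J * Y - J * (T * Y) := by rw [this]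
        _ = _ := by noncomm_ring
    rw [h1]
    exact hF.mul' (sub_mem (hF.mul' hT hF.J le_rfl) (hF.mul' hF.J hT (by omega))) hY (by omega)
  · have h1 : ∀ k, (T * J * Y) ^ (k + 1) = T * J ^ (k + 1) * Y := by
      intro k
      induction k with
      | zero => simp
      | succ k ih =>
        rw [pow_succ, ih, pow_succ J (k + 1)]
        calc T * J ^ (k + 1) * Y * (T * J * Y) = T * J ^ (k + 1) * (Y * T) * J * Y := by
              simp only [mul_assoc]
          _ = _ := by rw [hYT, mul_one]; simp only [mul_assoc]
    rw [h1, h.pow, ← mul_assoc T lam, ← (h.lam_comm T).eq]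
    simp only [mul_assoc]
  · have hDT : D T = T * (J + H) - (J + u) * T := by
      rw [← sub_eq_zero, ← hE]
      abel
    have hDY : D Y = Y * (J + u) - (J + H) * Y := by
      have h1 := hD.leib Y T
      rw [hYT, hD1, hDT] at h1
      have h2 : (D Y * T + Y * (T * (J + H) - (J + u) * T)) * Y = 0 := by rw [← h1, zero_mul]
      have h3 : D Y = (D Y * T + Y * (T * (J + H) - (J + u) * T)) * Y
          + (Y * (J + u) - (J + H) * Y) := by
        have h4 : (D Y * T + Y * (T * (J + H) - (J + u) * T)) * Y
            = D Y * (T * Y) + (Y * T) * (J + H) * Y - Y * (J + u) * (T * Y) := by noncomm_ring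
        rw [h4, hTY, hYT]
        noncomm_ring
      rw [h3, h2, zero_add]
    have hc : H * J = J * H := hJH.eq.symm
    rw [hD.leib, hD.leib, hD.J, hDT, hDY]
    have h5 : (T * (J + H) - (J + u) * T) * J + T * 0 = T * (J * J + H * J) - (J + u) * T * J := by
      noncomm_ring
    rw [h5, hc]
    noncomm_ring

/-- Solutions of `[∂ + J + u, S] = 0` and `S^{M+1} = λ S` with leading term `J` are unique. -/
theorem resolvent_unique (hF : IsFiltr M J lam mu F) (h : IsCyc M J K lam mu) {D : A →+ A}
    (hD : IsDer F D J) {u : A} (hu : u ∈ F 0) {S S' : A} (hS : S - J ∈ F 0) (hS' : S' - J ∈ F 0)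
    (hpow : S ^ (M + 1) = lam * S) (hpow' : S' ^ (M + 1) = lam * S')
    (hE : D S + ((J + u) * S - S * (J + u)) = 0) (hE' : D S' + ((J + u) * S' - S' * (J + u)) = 0) :
    S = S' := by
  have hM : (M : ℝ) ≠ 0 := by
    have := h.two_le
    positivity
  rw [← sub_eq_zero]
  set X := S - S' with hX
  have hSJ : S ∈ F 1 := by
    have := add_mem (hF.mono (by omega) hS : _ ∈ F 1) hF.J
    simpa using this
  have hSJ' : S' ∈ F 1 := by
    have := add_mem (hF.mono (by omega) hS' : _ ∈ F 1) hF.J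
    simpa using this
  refine hF.sep _ fun k => ?_
  induction k with
  | zero =>
    have := sub_mem hS hS'
    simpa using this
  | succ k ih =>
    -- The difference X also solves the linear equation, so [J,X] = -DX - [u,X] has no higher degree
    -- than X, and the top part Z of X commutes with J.
    have hJX : J * X - X * J ∈ F (-k) := by
      have h1 : J * X - X * J = -(D X) - u * X + X * u := by
        have h2 : D X + ((J + u) * X - X * (J + u)) = 0 := by
          rw [hX, map_sub]
          calc _ = (D S + ((J + u) * S - S * (J + u))) - (D S' + ((J + u) * S' - S' * (J + u))) := by
                noncomm_ring
            _ = 0 := by rw [hE, hE', sub_zero]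
        calc J * X - X * J = (D X + ((J + u) * X - X * (J + u))) - D X - u * X + X * u := by
              noncomm_ring
          _ = _ := by rw [h2, zero_sub]
      rw [h1]
      exact add_mem (sub_mem (neg_mem (hD.mem ih)) (hF.mul' hu ih (by omega)))
        (hF.mul' ih hu (by omega))
    obtain ⟨Z, hZ, hJZ, hXZ⟩ := hF.leading h ih hJX
    -- Linearization of the r-th power at J. For r = M + 1, the relation S^{M+1} = λS yields Z =
    -- (M+1) e Z up to lower degree. Multiplying by e gives M e Z = 0, hence Z = 0, both up to lower
    -- degree.
    have hpowdiff : ∀ r : ℕ, S ^ r - S' ^ r - (r : ℝ) • (J ^ (r - 1) * Z) ∈ F (r - 1 - k - 1) := by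
      intro r
      induction r with
      | zero => simp
      | succ r ihr =>
        have h1 : S ^ (r + 1) - S' ^ (r + 1) - ((r + 1 : ℕ) : ℝ) • (J ^ (r + 1 - 1) * Z)
            = (S ^ r - S' ^ r - (r : ℝ) • (J ^ (r - 1) * Z)) * S
              + (r : ℝ) • (J ^ (r - 1) * Z) * (S - J) + (S' ^ r - J ^ r) * X + J ^ r * (X - Z) := by
          have h2 : (r : ℝ) • (J ^ (r - 1) * Z) * J = (r : ℝ) • (J ^ r * Z) := by
            rcases Nat.eq_zero_or_pos r with rfl | hr
            · simp
            · rw [smul_mul_assoc, mul_assoc, ← hJZ.eq, ← mul_assoc, ← pow_succ,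
                Nat.sub_add_cancel hr]
          rw [mul_sub _ S J, h2, pow_succ S, pow_succ S', hX, Nat.add_sub_cancel]
          push_cast
          rw [add_smul, one_smul]
          noncomm_ring
        have hSr : ∀ r : ℕ, S' ^ r - J ^ r ∈ F (r - 1) := by
          intro r
          induction r with
          | zero => simp
          | succ r ihr =>
            have : S' ^ (r + 1) - J ^ (r + 1) = (S' ^ r - J ^ r) * S' + J ^ r * (S' - J) := by
              rw [pow_succ, pow_succ]
              noncomm_ring
            rw [this]
            exact add_mem (hF.mul' ihr hSJ' (by push_cast; omega))
              (hF.mul' (hF.J_pow r) hS' (by push_cast; omega))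
        rw [h1]
        refine add_mem (add_mem (add_mem ?_ ?_) ?_) ?_
        · exact hF.mul' ihr hSJ (by push_cast; omega)
        · rcases Nat.eq_zero_or_pos r with rfl | hr
          · simp
          · refine hF.mul' (hF.smul _ (hF.mul' (hF.J_pow (r - 1)) hZ le_rfl)) hS ?_
            push_cast
            omega
        · exact hF.mul' (hSr r) ih (by push_cast; omega)
        · exact hF.mul' (hF.J_pow r) hXZ (by push_cast; omega)
    have h1 := hpowdiff (M + 1)
    rw [hpow, hpow', Nat.add_sub_cancel, ← mul_sub, ← hX, h.lam_JK] at h1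
    have h2 : lam * (Z - ((M + 1 : ℕ) : ℝ) • (J * K * Z)) ∈ F (M - k - 1) := by
      have h3 : lam * (Z - ((M + 1 : ℕ) : ℝ) • (J * K * Z))
          = (lam * X - ((M + 1 : ℕ) : ℝ) • (lam * (J * K) * Z)) - lam * (X - Z) := by
        rw [mul_sub lam Z, mul_smul_comm, mul_sub lam X Z, ← mul_assoc lam]
        abel
      rw [h3]
      exact sub_mem (hF.mono (by push_cast; omega) h1) (hF.mul' hF.lam hXZ (by omega))
    have h3 : Z - ((M + 1 : ℕ) : ℝ) • (J * K * Z) ∈ F (-k - 1) := by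
      have h4 := hF.mul' hF.mu h2 (show -(M : ℤ) + (M - k - 1) ≤ -k - 1 by omega)
      rwa [← mul_assoc, h.mu_lam, one_mul] at h4
    have hid : (J * K) * (J * K) = J * K := by rw [mul_assoc, h.KJK]
    have h4 : J * K * Z ∈ F (-k - 1) := by
      have h5 := hF.smul (-(M : ℝ)⁻¹) (hF.mul' (hF.e_mem h) h3 (zero_add _).le)
      have h6 : (-(M : ℝ)⁻¹) • (J * K * (Z - ((M + 1 : ℕ) : ℝ) • (J * K * Z))) = J * K * Z := by
        rw [mul_sub, mul_smul_comm, ← mul_assoc, hid]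
        push_cast
        rw [add_smul, one_smul, smul_sub, smul_add, smul_smul]
        rw [neg_mul, inv_mul_cancel₀ hM]
        module
      rwa [h6] at h5
    have h5 : Z ∈ F (-k - 1) := by
      have := add_mem h3 (hF.smul ((M + 1 : ℕ) : ℝ) h4)
      rwa [sub_add_cancel] at this
    have h6 := add_mem hXZ h5
    rw [sub_add_cancel] at h6
    exact hF.mono (by push_cast; omega) h6

end IsFiltr

end

/-! ### The principal filtration on loops -/

section
variable {R : Type*} [CommRing R] [Algebra ℝ R] {n : ℕ}

/-- The coefficientwise algebra structure of Laurent series. -/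
instance laurentAlgebra : Algebra ℝ (LaurentSeries R) := HahnSeries.instAlgebra

/-- Matrices over the Laurent series in `λ⁻¹` with coefficients in `R`. -/
abbrev LMat (R : Type*) [CommRing R] (n : ℕ) := Matrix (Idx n) (Idx n) (LaurentSeries R)

/-- The loops of principal degree at most `m`, where `λ^k e_{ij}` has degree `M k + i - j`. -/
def filt (R : Type*) [CommRing R] (n M : ℕ) (m : ℤ) : AddSubgroup (LMat R n) where
  -- The series are in λ⁻¹: the coefficient at k belongs to λ^{-k} and has degree -M k + i - j.
  carrier := {X | ∀ i j : Idx n, ∀ k : ℤ, (M : ℤ) * k < (i : ℤ) - j - m → (X i j).coeff k = 0}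
  zero_mem' := by simp
  add_mem' := by
    intro X Y hX hY
    simp only [Set.mem_ofPred_eq] at *
    intro i j k h
    rw [Matrix.add_apply, HahnSeries.coeff_add, hX i j k h, hY i j k h, add_zero]
  neg_mem' := by
    intro X hX
    simp only [Set.mem_ofPred_eq] at *
    intro i j k h
    rw [Matrix.neg_apply, HahnSeries.coeff_neg, hX i j k h, neg_zero]

omit [Algebra ℝ R] in
theorem mem_filt {M : ℕ} {m : ℤ} {X : LMat R n} : X ∈ filt R n M m ↔
    ∀ i j : Idx n, ∀ k : ℤ, (M : ℤ) * k < (i : ℤ) - j - m → (X i j).coeff k = 0 := Iff.rfl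

/-- The loop parameter `λ`. -/
def lamL (R : Type*) [CommRing R] : LaurentSeries R := HahnSeries.single (-1 : ℤ) (1 : R)

/-- The inverse of the loop parameter. -/
def muL (R : Type*) [CommRing R] : LaurentSeries R := HahnSeries.single (1 : ℤ) (1 : R)

/-- A scalar series as a loop. -/
def scL (n : ℕ) (f : LaurentSeries R) : LMat R n := f • (1 : LMat R n)

omit [Algebra ℝ R] in
theorem lamL_mul_muL : lamL R * muL R = 1 := by
  rw [lamL, muL, HahnSeries.single_mul_single]
  simp

omit [Algebra ℝ R] in
theorem scL_mul (f : LaurentSeries R) (X : LMat R n) : scL n f * X = f • X := by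
  rw [scL, smul_mul_assoc, one_mul]

omit [Algebra ℝ R] in
theorem scL_commute (f : LaurentSeries R) (X : LMat R n) : Commute (scL n f) X := by
  rw [Commute, SemiconjBy, scL_mul, scL, mul_smul_comm, mul_one]

theorem real_smul_eq (c : ℝ) (X : LMat R n) :
    c • X = scL n (HahnSeries.single 0 (algebraMap ℝ R c)) * X := by
  rw [scL_mul, ← algebraMap_smul (LaurentSeries R) c X]
  congr 1

omit [Algebra ℝ R] in
theorem filt_scalar {M : ℕ} (a : ℤ) (r : R) :
    scL n (HahnSeries.single a r) ∈ filt R n M (-(M * a)) := by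
  rw [mem_filt]
  intro i j k h
  rw [scL, Matrix.smul_apply, Matrix.one_apply]
  split_ifs with hij
  · rw [hij, sub_self, zero_sub, neg_neg] at h
    rw [smul_eq_mul, mul_one]
    refine HahnSeries.coeff_single_of_ne ?_
    rintro rfl
    exact lt_irrefl _ h
  · simp

omit [Algebra ℝ R] in
theorem filt_mono {M : ℕ} {a b : ℤ} (h : a ≤ b) : filt R n M a ≤ filt R n M b :=
  fun _ hX i j k hk => hX i j k (by linarith)

omit [Algebra ℝ R] in
theorem filt_mul {M : ℕ} {a b : ℤ} {X Y : LMat R n} (hX : X ∈ filt R n M a)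
    (hY : Y ∈ filt R n M b) : X * Y ∈ filt R n M (a + b) := by
  rw [mem_filt] at *
  intro i j k hk
  rw [Matrix.mul_apply, HahnSeries.coeff_sum]
  refine Finset.sum_eq_zero fun l _ => ?_
  rw [HahnSeries.coeff_mul]
  refine Finset.sum_eq_zero fun p hp => ?_
  rw [Finset.mem_antidiagonal] at hp
  by_cases h : (M : ℤ) * p.1 < (i : ℤ) - l - a
  · rw [hX i l _ h, zero_mul]
  · rw [hY l j, mul_zero]
    have := hp.2.2
    rw [← this, mul_add] at hk
    linarith

omit [Algebra ℝ R] in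
theorem filt_sep {M : ℕ} (X : LMat R n) (h : ∀ k : ℕ, X ∈ filt R n M (-k)) : X = 0 := by
  ext i j p
  rw [Matrix.zero_apply, HahnSeries.coeff_zero]
  refine h ((M : ℤ) * p + j - i + 1).toNat i j p ?_
  have := Int.self_le_toNat ((M : ℤ) * p + j - i + 1)
  linarith

omit [Algebra ℝ R] in
theorem coeff_bdd (f : LaurentSeries R) : ∃ N : ℤ, ∀ k < N, f.coeff k = 0 :=
  ⟨f.order, fun _ h => HahnSeries.coeff_eq_zero_of_lt_order h⟩

omit [Algebra ℝ R] in
theorem filt_complete {M : ℕ} (hM : 1 ≤ M) (X : ℕ → LMat R n)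
    (h : ∀ k : ℕ, X (k + 1) - X k ∈ filt R n M (-(k + 1))) :
    ∃ Y, ∀ k : ℕ, Y - X k ∈ filt R n M (-(k + 1)) := by
  have hle : ∀ k l : ℕ, k ≤ l → X l - X k ∈ filt R n M (-(k + 1)) := by
    intro k l hkl
    induction l, hkl using Nat.le_induction with
    | base => simp
    | succ l hl ih =>
      rw [← sub_add_sub_cancel _ (X l)]
      exact add_mem (filt_mono (by omega) (h l)) ih
  -- From stage K i j p on, the coefficient at p of the entry (i,j) no longer changes, so the limit
  -- reads it there. For very negative p this stage is 0, whence the support of the limit is bounded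
  -- below.
  let K : Idx n → Idx n → ℤ → ℕ := fun i j p => ((M : ℤ) * p + j - i).toNat
  have hK : ∀ i j p, (M : ℤ) * p + j - i ≤ K i j p := fun i j p => Int.self_le_toNat _
  have hbdd : ∀ i j : Idx n, BddBelow (Function.support fun p => (X (K i j p) i j).coeff p) := by
    intro i j
    obtain ⟨N, hN⟩ := coeff_bdd (X 0 i j)
    refine ⟨min N (-(2 * n)), fun p hp => ?_⟩
    by_contra hlt
    rw [not_le, lt_min_iff] at hlt
    apply hp
    have h0 : K i j p = 0 := by
      have hi := i.isLt
      have hj := j.isLt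
      refine Int.toNat_eq_zero.2 ?_
      have hMp : (M : ℤ) * p ≤ 1 * p := mul_le_mul_of_nonpos_right (by exact_mod_cast hM) (by omega)
      omega
    change (X (K i j p) i j).coeff p = 0
    rw [h0, hN p hlt.1]
  refine ⟨Matrix.of fun i j => HahnSeries.ofSuppBddBelow _ (hbdd i j), fun k i j p hp => ?_⟩
  rw [Matrix.sub_apply, Matrix.of_apply, HahnSeries.coeff_sub, HahnSeries.coeff_ofSuppBddBelow]
  have h1 : K i j p ≤ k := by
    refine Int.toNat_le.2 ?_
    linarith
  have h2 := hle _ _ h1 i j p (by have := hK i j p; linarith)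
  rw [Matrix.sub_apply, HahnSeries.coeff_sub] at h2
  linear_combination -h2

theorem isFiltr {M : ℕ} (hM : 1 ≤ M) {J : LMat R n} (hJ : J ∈ filt R n M 1) :
    IsFiltr M J (scL n (lamL R)) (scL n (muL R)) (filt R n M) where
  mono := filt_mono
  one := by
    have := filt_scalar (n := n) (M := M) 0 (1 : R)
    simpa [scL] using this
  smul c a X hX := by
    rw [real_smul_eq]
    refine filt_mono ?_ (filt_mul (filt_scalar 0 _) hX)
    simp
  mul := filt_mul
  J := hJ
  lam := by simpa [lamL] using filt_scalar (n := n) (M := M) (-1) (1 : R)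
  mu := by simpa [muL] using filt_scalar (n := n) (M := M) 1 (1 : R)
  sep := filt_sep
  complete := filt_complete hM

omit [Algebra ℝ R] in
theorem isCyc {M : ℕ} (hM : 2 ≤ M) {J : LMat R n} (hJ : J ^ (M + 1) = lamL R • J) :
    IsCyc M J (scL n (muL R) * J ^ (M - 1)) (scL n (lamL R)) (scL n (muL R)) where
  two_le := hM
  lam_comm X := scL_commute _ X
  mu_comm X := scL_commute _ X
  lam_mu := by rw [scL_mul, scL, smul_smul, lamL_mul_muL, one_smul]
  pow := by rw [hJ, scL_mul]
  K_eq := rfl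

/-! ### Derivations of loops -/

/-- A derivation applied to all coefficients of a series. -/
def derL (D : Derivation ℝ R R) : LaurentSeries R →+ LaurentSeries R where
  toFun f := f.map D
  map_zero' := by ext; simp
  map_add' f g := by ext; simp

@[simp] theorem coeff_derL (D : Derivation ℝ R R) (f : LaurentSeries R) (k : ℤ) :
    (derL D f).coeff k = D (f.coeff k) := rfl

theorem derL_mul (D : Derivation ℝ R R) (f g : LaurentSeries R) :
    derL D (f * g) = derL D f * g + f * derL D g := by
  ext k
  have key : ∀ f : LaurentSeries R, (derL D f).support ⊆ f.support := by
    intro f k hk hk'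
    apply hk
    change D (f.coeff k) = 0
    rw [hk', map_zero]
  rw [HahnSeries.coeff_add, coeff_derL, HahnSeries.coeff_mul,
    HahnSeries.coeff_mul_left' f.isPWO_support (key f), HahnSeries.coeff_mul_right' g.isPWO_support (key g),
    map_sum, ← Finset.sum_add_distrib]
  refine Finset.sum_congr rfl fun p _ => ?_
  rw [D.leibniz, coeff_derL, coeff_derL, smul_eq_mul, smul_eq_mul]
  ring

/-- A derivation applied to all coefficients of a loop. -/
def derM (n : ℕ) (D : Derivation ℝ R R) : LMat R n →+ LMat R n where
  toFun X := X.map (derL D)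
  map_zero' := by ext; simp
  map_add' X Y := by ext; simp

theorem derM_apply (D : Derivation ℝ R R) (X : LMat R n) (i j : Idx n) :
    derM n D X i j = derL D (X i j) := rfl

theorem derM_mul (D : Derivation ℝ R R) (X Y : LMat R n) :
    derM n D (X * Y) = derM n D X * Y + X * derM n D Y := by
  ext1 i j
  simp only [derM_apply, Matrix.mul_apply, Matrix.add_apply, map_sum, derL_mul,
    Finset.sum_add_distrib]

theorem derM_mem (D : Derivation ℝ R R) {M : ℕ} {a : ℤ} {X : LMat R n} (hX : X ∈ filt R n M a) :
    derM n D X ∈ filt R n M a := fun i j k hk => by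
  rw [derM_apply, coeff_derL, hX i j k hk, map_zero]

theorem isDer (D : Derivation ℝ R R) {M : ℕ} {J : LMat R n} (hJ : derM n D J = 0) :
    IsFiltr.IsDer (filt R n M) (derM n D) J where
  leib := derM_mul D
  mem := derM_mem D
  J := hJ

/-! ### Constant loops -/

/-- A matrix over `R` as a constant loop. -/
def cstM (X : Matrix (Idx n) (Idx n) R) : LMat R n := X.map HahnSeries.C

omit [Algebra ℝ R] in
theorem cstM_apply (X : Matrix (Idx n) (Idx n) R) (i j : Idx n) :
    cstM X i j = HahnSeries.C (X i j) := rfl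

omit [Algebra ℝ R] in
theorem cstM_mem {M : ℕ} {m : ℤ} {X : Matrix (Idx n) (Idx n) R}
    (h : ∀ i j : Idx n, m < (i : ℤ) - j → X i j = 0) : cstM X ∈ filt R n M m := by
  intro i j k hk
  rw [cstM_apply, HahnSeries.C_apply]
  by_cases hk0 : k = 0
  · subst hk0
    rw [HahnSeries.coeff_single_same]
    exact h i j (by linarith)
  · exact HahnSeries.coeff_single_of_ne hk0

/-- `J = b + β λ` for a constant real matrix `β`. -/
def loopJ (R : Type*) [CommRing R] [Algebra ℝ R] {n : ℕ} (β : Mat n) : LMat R n :=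
  cstM (shiftM R n) + lamL R • cstM (β.map (algebraMap ℝ R))

theorem loopJ_mem {M : ℕ} {β : Mat n} (h : ∀ i j : Idx n, 1 < (i : ℤ) - j + M → β i j = 0) :
    loopJ R β ∈ filt R n M 1 := by
  refine add_mem (cstM_mem fun i j hij => ?_) ?_
  · have : (i : ℕ) ≠ j + 1 := by omega
    simp [shiftM, this]
  · rw [← scL_mul]
    have h1 := filt_scalar (n := n) (M := M) (-1) (1 : R)
    have h2 : cstM (β.map (algebraMap ℝ R)) ∈ filt R n M (1 - M) :=
      cstM_mem fun i j hij => by rw [Matrix.map_apply, h i j (by linarith), map_zero]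
    refine filt_mono ?_ (filt_mul h1 h2)
    linarith

theorem derL_C (D : Derivation ℝ R R) (r : R) : derL D (HahnSeries.C r) = HahnSeries.C (D r) := by
  ext k
  rw [coeff_derL, HahnSeries.C_apply, HahnSeries.C_apply]
  by_cases hk0 : k = 0
  · subst hk0
    simp
  · rw [HahnSeries.coeff_single_of_ne hk0, HahnSeries.coeff_single_of_ne hk0, map_zero]

theorem derM_loopJ (D : Derivation ℝ R R) (β : Mat n) : derM n D (loopJ R β) = 0 := by
  ext1 i j
  have h1 : derL D (lamL R) = 0 := by
    ext k
    rw [coeff_derL, lamL]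
    by_cases hk0 : k = -1
    · subst hk0
      simp
    · rw [HahnSeries.coeff_single_of_ne hk0, map_zero, HahnSeries.coeff_zero]
  have h2 : D (shiftM R n i j) = 0 := by
    simp only [shiftM, Matrix.of_apply]
    split_ifs <;> simp
  rw [derM_apply, loopJ, Matrix.add_apply, Matrix.smul_apply, smul_eq_mul, map_add, derL_mul,
    cstM_apply, cstM_apply, derL_C, derL_C, h1, h2, Matrix.map_apply]
  simp

end

/-! ### Leading terms -/

section
variable {R : Type*} [CommRing R] [Algebra ℝ R] {n : ℕ}

/-- The properties of the loops `J` and `J_B` used below: `J` is cyclic with first basis vector as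
cyclic vector, compatibly with the filtration. -/
structure IsLoopType (M : ℕ) (J : LMat R n) : Prop where
  two_le : 2 ≤ M
  size : M = 2 * n ∨ M = 2 * n + 1
  mem : J ∈ filt R n M 1
  pow : J ^ (M + 1) = lamL R • J
  col : ∀ r < M, ∀ i : Idx n, (J ^ r) i 0 = if (i : ℕ) = r then 1 else 0
  cyc : ∀ j : Idx n, ∃ p ∈ filt R n M j, p *ᵥ Pi.single 0 1 = Pi.single j 1 ∧
    ∃ c : LMat R n, (∀ X, c * X = X * c) ∧ p = J ^ (j : ℕ) + c

namespace IsLoopType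
variable {M : ℕ} {J : LMat R n}

theorem filtr (h : IsLoopType M J) : IsFiltr M J (scL n (lamL R)) (scL n (muL R)) (filt R n M) :=
  isFiltr (by have := h.two_le; omega) h.mem

omit [Algebra ℝ R] in
theorem isCyc (h : IsLoopType M J) :
    IsCyc M J (scL n (muL R) * J ^ (M - 1)) (scL n (lamL R)) (scL n (muL R)) :=
  IsotropicFlow.isCyc h.two_le h.pow

theorem pow_comm_mem (h : IsLoopType M J) {m : ℤ} {X : LMat R n}
    (hJ : J * X - X * J ∈ filt R n M m) (k : ℕ) : J ^ k * X - X * J ^ k ∈ filt R n M (m + k - 1) := by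
  induction k with
  | zero => simp
  | succ k ih =>
    have h1 : J ^ (k + 1) * X - X * J ^ (k + 1)
        = J ^ k * (J * X - X * J) + (J ^ k * X - X * J ^ k) * J := by
      rw [pow_succ]
      noncomm_ring
    rw [h1]
    exact add_mem (h.filtr.mul' (h.filtr.J_pow k) hJ (by push_cast; omega))
      (h.filtr.mul' ih h.mem (by push_cast; omega))

/-- A loop that commutes with `J` to leading order is determined to leading order by its first
column. -/
theorem mem_of_col (h : IsLoopType M J) {m : ℤ} {X : LMat R n}
    (hJ : J * X - X * J ∈ filt R n M m)
    (hcol : ∀ i : Idx n, ∀ k : ℤ, (M : ℤ) * k < (i : ℤ) - (m - 1) → (X i 0).coeff k = 0) :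
    X ∈ filt R n M (m - 1) := by
  intro i j k hk
  obtain ⟨p, hp, hpj, c, hc, rfl⟩ := h.cyc j
  have h1 : (J ^ (j : ℕ) + c) * X - X * (J ^ (j : ℕ) + c) ∈ filt R n M (m + j - 1) := by
    have : (J ^ (j : ℕ) + c) * X - X * (J ^ (j : ℕ) + c) = J ^ (j : ℕ) * X - X * J ^ (j : ℕ) := by
      rw [add_mul, mul_add, hc]
      abel
    rw [this]
    exact h.pow_comm_mem hJ j
  set p := J ^ (j : ℕ) + c with hpd
  -- Here X e_j = X p e_0 = p X e_0 - [p,X] e_0. The first term is controlled by the first column of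
  -- X and the second by [J,X], since p is a power of J up to a central element.
  have h2 : X i j = ((p * X) i 0) - (p * X - X * p) i 0 := by
    rw [Matrix.sub_apply, sub_sub_cancel]
    have h3 : X *ᵥ (p *ᵥ Pi.single 0 1) = X *ᵥ Pi.single j 1 := by rw [hpj]
    rw [Matrix.mulVec_mulVec] at h3
    have h4 := congrFun h3 i
    simpa using h4.symm
  have h5 : ((p * X) i 0).coeff k = 0 := by
    rw [Matrix.mul_apply, HahnSeries.coeff_sum]
    refine Finset.sum_eq_zero fun l _ => ?_
    rw [HahnSeries.coeff_mul]
    refine Finset.sum_eq_zero fun q hq => ?_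
    rw [Finset.mem_antidiagonal] at hq
    by_cases hlt : (M : ℤ) * q.1 < (i : ℤ) - l - j
    · rw [hp i l _ hlt, zero_mul]
    · rw [hcol l, mul_zero]
      have := hq.2.2
      rw [← this, mul_add] at hk
      linarith
  rw [h2, HahnSeries.coeff_sub, h5, h1 i 0 k (by simp; linarith), sub_zero]

/-- The leading term of a loop that commutes with `J` to leading order. -/
theorem exists_leading (h : IsLoopType M J) {m q : ℤ} {r : ℕ} (hr : r < M) (hm : m = M * q + r)
    {X : LMat R n} (hX : X ∈ filt R n M m) (hJ : J * X - X * J ∈ filt R n M m)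
    (hlast : M = 2 * n + 1 ∨ X (Fin.last (2 * n)) 0 = 0) :
    ∃ a : R, HahnSeries.single (-q) a • J ^ r ∈ filt R n M m ∧
      X - HahnSeries.single (-q) a • J ^ r ∈ filt R n M (m - 1) := by
  have hr2 : r < 2 * n + 1 := by rcases h.size with h1 | h1 <;> omega
  set a := (X ⟨r, hr2⟩ 0).coeff (-q) with ha
  obtain ⟨Z, hZ⟩ : ∃ Z, Z = HahnSeries.single (-q) a • J ^ r := ⟨_, rfl⟩
  have hZm : Z ∈ filt R n M m := by
    rw [hZ, ← scL_mul]
    exact h.filtr.mul' (filt_scalar _ _) (h.filtr.J_pow r) (by rw [hm]; linarith)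
  refine ⟨a, ?_⟩
  rw [← hZ]
  refine ⟨hZm, h.mem_of_col ?_ ?_⟩
  · have h1 : J * Z - Z * J = 0 := by
      rw [hZ, mul_smul_comm, smul_mul_assoc, ← pow_succ, ← pow_succ', sub_self]
    have h2 : J * (X - Z) - (X - Z) * J = (J * X - X * J) - (J * Z - Z * J) := by noncomm_ring
    rw [h2, h1, sub_zero]
    exact hJ
  · intro i k hk
    have hZ0 : Z i 0 = if (i : ℕ) = r then HahnSeries.single (-q) a else 0 := by
      rw [hZ, Matrix.smul_apply, h.col r hr]
      split_ifs <;> simp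
    by_cases hlt : (M : ℤ) * k < (i : ℤ) - m
    · exact sub_mem hX hZm i 0 k (by simpa using hlt)
    · have hMk : (M : ℤ) * k = (i : ℤ) - m := by omega
      rw [Matrix.sub_apply, HahnSeries.coeff_sub, hZ0]
      by_cases hir : (i : ℕ) = r
      · have hi : i = ⟨r, hr2⟩ := Fin.ext hir
        have hkq : k = -q := by
          have h1 : (M : ℤ) * k = M * (-q) := by rw [hMk, hm, hir]; ring
          exact mul_left_cancel₀ (by have := h.two_le; positivity) h1
        rw [if_pos hir, hkq, HahnSeries.coeff_single_same, ha, hi, sub_self]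
      · rw [if_neg hir, HahnSeries.coeff_zero, sub_zero]
        -- Top degree entries of the first column sit in rows i congruent to r modulo M. As 0 ≤ i ≤
        -- 2n and r < M, this means i = r, except for r = 0 and i = 2n when M = 2n; that entry is
        -- zero by `hlast`.
        have hdvd : (M : ℤ) ∣ (i : ℤ) - r := ⟨k + q, by rw [mul_add, hMk, hm]; ring⟩
        have hil := i.isLt
        rcases hlast with hM | hl
        · exfalso
          apply hir
          have := Int.eq_zero_of_abs_lt_dvd hdvd (by rw [abs_lt]; omega)
          omega
        · rcases h.size with hM | hM
          · by_cases hil2 : (i : ℕ) = 2 * n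
            · have : i = Fin.last (2 * n) := Fin.ext hil2
              rw [this, hl, HahnSeries.coeff_zero]
            · exfalso
              apply hir
              have := Int.eq_zero_of_abs_lt_dvd hdvd (by rw [abs_lt]; omega)
              omega
          · exfalso
            apply hir
            have := Int.eq_zero_of_abs_lt_dvd hdvd (by rw [abs_lt]; omega)
            omega

omit [Algebra ℝ R] in
theorem pow_mul_pow {M : ℕ} {J : LMat R n} (hp : J ^ (M + 1) = lamL R • J) (r : ℕ) :
    J ^ (r * (M + 1)) = lamL R ^ r • J ^ r := by
  rw [mul_comm r, pow_mul, hp, smul_pow]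

theorem pow_sub_mem (h : IsLoopType M J) {m : ℤ} {X Z : LMat R n} (hX : X ∈ filt R n M m)
    (hZ : Z ∈ filt R n M m) (hXZ : X - Z ∈ filt R n M (m - 1)) (k : ℕ) :
    X ^ k - Z ^ k ∈ filt R n M (k * m - 1) := by
  induction k with
  | zero => simp
  | succ k ih =>
    have : X ^ (k + 1) - Z ^ (k + 1) = (X ^ k - Z ^ k) * X + Z ^ k * (X - Z) := by
      rw [pow_succ, pow_succ]
      noncomm_ring
    rw [this]
    exact add_mem (h.filtr.mul' ih hX (by push_cast; linarith))
      (h.filtr.mul' (h.filtr.pow hZ k) hXZ (by push_cast; linarith))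

/-- The terms of degree at least two of a solution of `X^{M+1} = λ X` vanish. -/
theorem mem_pred [IsReduced R] (h : IsLoopType M J) {m : ℤ} (hm : 2 ≤ m) {X : LMat R n}
    (hX : X ∈ filt R n M m) (hJ : J * X - X * J ∈ filt R n M m)
    (hlast : M = 2 * n + 1 ∨ X (Fin.last (2 * n)) 0 = 0) (hpow : X ^ (M + 1) = lamL R • X) :
    X ∈ filt R n M (m - 1) := by
  have hM := h.two_le
  obtain ⟨q, r, hr, hmq⟩ : ∃ q : ℤ, ∃ r : ℕ, r < M ∧ m = M * q + r := by
    refine ⟨m / M, (m % M).toNat, ?_, ?_⟩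
    · have h1 := Int.emod_lt_of_pos m (by omega : (0 : ℤ) < M)
      have h2 := Int.emod_nonneg m (by omega : (M : ℤ) ≠ 0)
      omega
    · have h2 := Int.emod_nonneg m (by omega : (M : ℤ) ≠ 0)
      rw [Int.toNat_of_nonneg h2, Int.mul_ediv_add_emod]
  obtain ⟨a, hZ, hXZ⟩ := h.exists_leading hr hmq hX hJ hlast
  have hr2 : r < 2 * n + 1 := by rcases h.size with h1 | h1 <;> omega
  -- The leading term of X^{M+1} has coefficient a^{M+1} in degree (M+1)m, whereas λX has degree at
  -- most M + m, which is smaller as m ≥ 2. Hence a^{M+1} = 0, and a = 0 because the ring is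
  -- reduced.
  have h1 := h.pow_sub_mem hX hZ hXZ (M + 1)
  rw [hpow, smul_pow, ← pow_mul, pow_mul_pow h.pow, HahnSeries.single_pow, smul_smul, lamL,
    HahnSeries.single_pow, HahnSeries.single_mul_single, one_pow, mul_one] at h1
  have h2 : HahnSeries.single (-1 : ℤ) (1 : R) • X ∈ filt R n M (((M + 1 : ℕ) : ℤ) * m - 1) := by
    rw [← scL_mul]
    refine h.filtr.mul' (filt_scalar _ _) hX ?_
    push_cast
    nlinarith
  have h3 := sub_mem h2 h1
  rw [sub_sub_cancel] at h3
  have h4 := h3 ⟨r, hr2⟩ 0 ((M + 1) • (-q) + r • (-1)) (by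
    rw [hmq]
    push_cast [smul_eq_mul]
    simp
    nlinarith)
  rw [Matrix.smul_apply, h.col r hr, if_pos rfl, smul_eq_mul, mul_one,
    HahnSeries.coeff_single_same] at h4
  have h5 : a = 0 := pow_eq_zero_iff (by omega) |>.1 h4
  rwa [h5, HahnSeries.single_eq_zero, zero_smul, sub_zero] at hXZ

/-- A solution of `X^{M+1} = λ X` and `[∂ + J + u, X] = 0` is a multiple of `J` to leading order. -/
theorem exists_leading_one [IsReduced R] (h : IsLoopType M J) (D : Derivation ℝ R R)
    {u : LMat R n} (hu : u ∈ filt R n M 0) {X : LMat R n} {m : ℤ} (hX : X ∈ filt R n M m)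
    (hE : derM n D X + ((J + u) * X - X * (J + u)) = 0)
    (hlast : M = 2 * n + 1 ∨ X (Fin.last (2 * n)) 0 = 0) (hpow : X ^ (M + 1) = lamL R • X) :
    ∃ a : R, X - (HahnSeries.C a : LaurentSeries R) • J ∈ filt R n M 0 := by
  have hM := h.two_le
  -- By the differential equation [J,X] = [X,u] - DX, which does not exceed the degree of X.
  have hJ : ∀ m, X ∈ filt R n M m → J * X - X * J ∈ filt R n M m := by
    intro m hX
    have h1 : J * X - X * J = X * u - u * X - derM n D X := by
      calc J * X - X * J = (derM n D X + ((J + u) * X - X * (J + u))) + X * u - u * X - derM n D X := by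
            noncomm_ring
        _ = _ := by rw [hE, zero_add]
    rw [h1]
    exact sub_mem (sub_mem (h.filtr.mul' hX hu (by omega)) (h.filtr.mul' hu hX (by omega)))
      (derM_mem D hX)
  have hX1 : X ∈ filt R n M 1 := by
    -- Descent through `mem_pred`, which applies in every degree at least 2.
    have key : ∀ k : ℕ, X ∈ filt R n M (1 + k) → X ∈ filt R n M 1 := by
      intro k
      induction k with
      | zero => simp
      | succ k ih =>
        intro hk
        apply ih
        have := h.mem_pred (by push_cast; omega) hk (hJ _ hk) hlast hpow
        exact filt_mono (by push_cast; omega) this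
    refine key m.toNat (filt_mono ?_ hX)
    have := Int.self_le_toNat m
    omega
  obtain ⟨a, -, ha⟩ := h.exists_leading (q := 0) (r := 1) (by omega) (by simp) hX1 (hJ _ hX1) hlast
  exact ⟨a, by simpa using ha⟩

end IsLoopType

/-! ### The two types -/

theorem loopJ_apply (β : Mat n) (i j : Idx n) :
    loopJ R β i j = (if (i : ℕ) = j + 1 then 1 else 0) +
      lamL R * HahnSeries.C (algebraMap ℝ R (β i j)) := by
  rw [loopJ, Matrix.add_apply, Matrix.smul_apply, cstM_apply, cstM_apply, smul_eq_mul,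
    Matrix.map_apply]
  congr 1
  simp only [shiftM, Matrix.of_apply]
  split_ifs <;> simp

theorem loopJ_mulVec_single {β : Mat n} {j q : Idx n} (hq : (q : ℕ) = j + 1)
    (h : ∀ i, β i j = 0) : loopJ R β *ᵥ Pi.single j 1 = Pi.single q 1 := by
  ext1 i
  rw [Matrix.mulVec_single_one, Matrix.col_apply, loopJ_apply, h, Pi.single_apply]
  have : ((i : ℕ) = j + 1) ↔ i = q := by rw [Fin.ext_iff, hq]
  simp [this]

theorem loopJ_pow_mulVec {β : Mat n} {r : ℕ} (hr : r < 2 * n + 1)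
    (h : ∀ i j : Idx n, (j : ℕ) < r → β i j = 0) :
    loopJ R β ^ r *ᵥ Pi.single 0 1 = Pi.single ⟨r, hr⟩ 1 := by
  induction r with
  | zero => rw [pow_zero, Matrix.one_mulVec]; rfl
  | succ r ih =>
    rw [pow_succ', ← Matrix.mulVec_mulVec, ih (by omega) fun i j hj => h i j (by omega)]
    exact loopJ_mulVec_single rfl fun i => h i _ (Nat.lt_succ_self r)

omit [Algebra ℝ R] in
theorem col_of_mulVec {X : LMat R n} {q : Idx n} (h : X *ᵥ Pi.single 0 1 = Pi.single q 1)
    (i : Idx n) : X i 0 = if (i : ℕ) = q then 1 else 0 := by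
  have := congrFun h i
  rw [Matrix.mulVec_single_one, Matrix.col_apply, Pi.single_apply] at this
  rw [this]
  simp only [Fin.ext_iff]

/-- The matrix `e_{1,2n+1}`. -/
def βA (n : ℕ) : Mat n := E n 1 (2 * n + 1)

theorem βA_apply (i j : Idx n) : βA n i j = if (i : ℕ) = 0 ∧ (j : ℕ) = 2 * n then 1 else 0 := by
  simp [βA, E]

theorem loopJ_A_last :
    loopJ R (βA n) *ᵥ Pi.single (Fin.last (2 * n)) 1 = lamL R • Pi.single 0 1 := by
  ext1 i
  have hi := i.isLt
  have h1 : (i : ℕ) ≠ (Fin.last (2 * n) : Idx n) + 1 := by simp; omega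
  have h2 : ((i : ℕ) = 0) ↔ i = 0 := by rw [Fin.ext_iff]; simp
  rw [Matrix.mulVec_single_one, Matrix.col_apply, loopJ_apply, if_neg h1, βA_apply, zero_add,
    Pi.smul_apply, Pi.single_apply, smul_eq_mul]
  by_cases hi0 : i = 0
  · subst hi0
    simp
  · rw [if_neg (by rw [h2]; tauto), if_neg hi0]
    simp

theorem loopJ_A_pow_mulVec {r : ℕ} (hr : r < 2 * n + 1) :
    loopJ R (βA n) ^ r *ᵥ Pi.single 0 1 = Pi.single ⟨r, hr⟩ 1 :=
  loopJ_pow_mulVec hr fun i j hj => by rw [βA_apply, if_neg (by omega)]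

/-- J shifts the basis cyclically and picks up a factor λ on wrapping around. It suffices to test
e_0, whose images under powers of J form the basis. -/
theorem loopJ_A_pow : loopJ R (βA n) ^ (2 * n + 1) = scL n (lamL R) := by
  refine Matrix.ext_of_mulVec_single fun j => ?_
  have h0 : loopJ R (βA n) ^ (2 * n + 1) *ᵥ Pi.single 0 1 = lamL R • Pi.single 0 1 := by
    rw [pow_succ', ← Matrix.mulVec_mulVec, loopJ_A_pow_mulVec (by omega)]
    exact loopJ_A_last
  have hj : (Pi.single j 1 : Idx n → LaurentSeries R) = loopJ R (βA n) ^ (j : ℕ) *ᵥ Pi.single 0 1 :=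
    (loopJ_A_pow_mulVec j.isLt).symm
  have h1 : scL n (lamL R) *ᵥ Pi.single j 1 = lamL R • Pi.single j 1 := by
    rw [scL, Matrix.smul_mulVec, Matrix.one_mulVec]
  rw [h1, hj, Matrix.mulVec_mulVec, pow_mul_comm, ← Matrix.mulVec_mulVec, h0,
    Matrix.mulVec_smul]

theorem isLoopType_A (hn : 1 ≤ n) : IsLoopType (2 * n + 1) (loopJ R (βA n)) where
  two_le := by omega
  size := Or.inr rfl
  mem := loopJ_mem fun i j hij => by
    rw [βA_apply, if_neg]
    push_cast at hij
    omega
  pow := by rw [pow_succ, loopJ_A_pow, scL_mul]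
  col r hr i := col_of_mulVec (loopJ_A_pow_mulVec hr) i
  cyc j := ⟨loopJ R (βA n) ^ (j : ℕ), by
    have h1 : loopJ R (βA n) ∈ filt R n (2 * n + 1) 1 := loopJ_mem fun i j hij => by
      rw [βA_apply, if_neg]
      push_cast at hij
      omega
    simpa using (isFiltr (by omega) h1).J_pow (j : ℕ), loopJ_A_pow_mulVec j.isLt, 0, by simp, by simp⟩

theorem βB_apply (i j : Idx n) : βB n i j =
    if ((i : ℕ) = 0 ∧ (j : ℕ) + 1 = 2 * n) ∨ ((i : ℕ) = 1 ∧ (j : ℕ) = 2 * n) then 1 / 2 else 0 := by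
  simp only [βB, E, Matrix.smul_apply, Matrix.add_apply, Matrix.of_apply, smul_eq_mul]
  by_cases h1 : (i : ℕ) = 0 ∧ (j : ℕ) + 1 = 2 * n
  · have h2 : ¬((i : ℕ) + 1 = 2 ∧ (j : ℕ) + 1 = 2 * n + 1) := by omega
    rw [if_pos (by omega), if_neg h2, if_pos (Or.inl h1)]
    norm_num
  · by_cases h2 : (i : ℕ) = 1 ∧ (j : ℕ) = 2 * n
    · rw [if_neg (by omega), if_pos (by omega), if_pos (Or.inr h2)]
      norm_num
    · rw [if_neg (by omega), if_neg (by omega), if_neg (by tauto)]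
      norm_num

/-- Half the loop parameter. -/
def halfLam (R : Type*) [CommRing R] [Algebra ℝ R] : LaurentSeries R :=
  lamL R * HahnSeries.C (algebraMap ℝ R (1 / 2))

theorem halfLam_add : halfLam R + halfLam R = lamL R := by
  rw [halfLam, ← mul_add, ← map_add, ← map_add]
  norm_num

theorem loopJ_B_last {o : Idx n} (ho : (o : ℕ) = 1) :
    loopJ R (βB n) *ᵥ Pi.single (Fin.last (2 * n)) 1 = halfLam R • Pi.single o 1 := by
  ext1 i
  have hi := i.isLt
  have h1 : (i : ℕ) ≠ (Fin.last (2 * n) : Idx n) + 1 := by simp; omega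
  have h2 : ((i : ℕ) = 1) ↔ i = o := by rw [Fin.ext_iff, ho]
  rw [Matrix.mulVec_single_one, Matrix.col_apply, loopJ_apply, if_neg h1, βB_apply, zero_add,
    Pi.smul_apply, Pi.single_apply, smul_eq_mul, halfLam]
  by_cases hi0 : i = o
  · rw [if_pos (Or.inr ⟨h2.2 hi0, rfl⟩), if_pos hi0, mul_one]
  · rw [if_neg, if_neg hi0]
    · simp
    · rw [h2]
      simp [hi0]

theorem loopJ_B_penult {l : Idx n} (hl : (l : ℕ) + 1 = 2 * n) :
    loopJ R (βB n) *ᵥ Pi.single l 1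
      = Pi.single (Fin.last (2 * n)) 1 + halfLam R • Pi.single 0 1 := by
  ext1 i
  have hi := i.isLt
  have h1 : ((i : ℕ) = l + 1) ↔ i = Fin.last (2 * n) := by rw [Fin.ext_iff, hl]; rfl
  have h2 : ((i : ℕ) = 0) ↔ i = 0 := by rw [Fin.ext_iff]; simp
  have h3 : (l : ℕ) ≠ 2 * n := by omega
  rw [Matrix.mulVec_single_one, Matrix.col_apply, loopJ_apply, βB_apply, Pi.add_apply,
    Pi.smul_apply, Pi.single_apply, Pi.single_apply, smul_eq_mul, halfLam]
  simp only [h1]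
  simp only [h2, hl, h3, and_true, and_false, or_false]
  refine congrArg₂ _ rfl ?_
  by_cases hi0 : i = 0
  · rw [if_pos hi0, if_pos hi0, mul_one]
  · rw [if_neg hi0, if_neg hi0, map_zero, map_zero, mul_zero, mul_zero]

theorem loopJ_B_pow_mulVec {r : ℕ} (hr : r < 2 * n) :
    loopJ R (βB n) ^ r *ᵥ Pi.single 0 1 = Pi.single ⟨r, by omega⟩ 1 :=
  loopJ_pow_mulVec _ fun i j hj => by rw [βB_apply, if_neg (by omega)]

theorem loopJ_B_pow_mulVec_top (hn : 1 ≤ n) :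
    loopJ R (βB n) ^ (2 * n) *ᵥ Pi.single 0 1
      = Pi.single (Fin.last (2 * n)) 1 + halfLam R • Pi.single 0 1 := by
  obtain ⟨k, hk⟩ : ∃ k, 2 * n = k + 1 := ⟨2 * n - 1, by omega⟩
  have h : loopJ R (βB n) ^ (2 * n) = loopJ R (βB n) * loopJ R (βB n) ^ k := by
    rw [← pow_succ', ← hk]
  rw [h, ← Matrix.mulVec_mulVec, loopJ_B_pow_mulVec (by omega)]
  exact loopJ_B_penult hk.symm

/-- Here J^{2n} e_0 = e_{2n} + (λ/2) e_0, while J sends e_{2n} to (λ/2) e_1 and e_0 to e_1. The two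
halves add up to J^{2n+1} e_0 = λ J e_0, and e_0 generates everything under polynomials in J. -/
theorem loopJ_B_pow (hn : 1 ≤ n) :
    loopJ R (βB n) ^ (2 * n + 1) = lamL R • loopJ R (βB n) := by
  set J := loopJ R (βB n) with hJ
  have h1 : J ^ 1 *ᵥ Pi.single 0 1 = Pi.single ⟨1, by omega⟩ 1 := loopJ_B_pow_mulVec (by omega)
  rw [pow_one] at h1
  have h0 : J ^ (2 * n + 1) *ᵥ Pi.single 0 1 = lamL R • (J *ᵥ Pi.single 0 1) := by
    rw [pow_succ', ← Matrix.mulVec_mulVec, loopJ_B_pow_mulVec_top hn, Matrix.mulVec_add,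
      Matrix.mulVec_smul, loopJ_B_last (o := ⟨1, by omega⟩) rfl, h1, ← add_smul, halfLam_add]
  have h2 : ∀ k, J ^ (2 * n + 1) *ᵥ (J ^ k *ᵥ Pi.single 0 1)
      = (lamL R • J) *ᵥ (J ^ k *ᵥ Pi.single 0 1) := by
    intro k
    rw [Matrix.mulVec_mulVec, pow_mul_comm, ← Matrix.mulVec_mulVec, h0,
      Matrix.mulVec_smul, Matrix.mulVec_mulVec, ← pow_succ, pow_succ', ← Matrix.mulVec_mulVec,
      Matrix.smul_mulVec]
  refine Matrix.ext_of_mulVec_single fun j => ?_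
  have hjl := j.isLt
  by_cases hj : (j : ℕ) < 2 * n
  · have : (Pi.single j 1 : Idx n → LaurentSeries R) = J ^ (j : ℕ) *ᵥ Pi.single 0 1 :=
      (loopJ_B_pow_mulVec hj).symm
    rw [this, h2]
  · have hj' : j = Fin.last (2 * n) := Fin.ext (by simp; omega)
    have : (Pi.single j 1 : Idx n → LaurentSeries R)
        = J ^ (2 * n) *ᵥ Pi.single 0 1 - halfLam R • (J ^ 0 *ᵥ Pi.single 0 1) := by
      rw [loopJ_B_pow_mulVec_top hn, hj', pow_zero, Matrix.one_mulVec, add_sub_cancel_right]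
    rw [this, Matrix.mulVec_sub, Matrix.mulVec_sub, Matrix.mulVec_smul, Matrix.mulVec_smul, h2, h2]

theorem isLoopType_B (hn : 1 ≤ n) : IsLoopType (2 * n) (loopJ R (βB n)) := by
  have hmem : loopJ R (βB n) ∈ filt R n (2 * n) 1 := loopJ_mem fun i j hij => by
    rw [βB_apply, if_neg]
    push_cast at hij
    omega
  have hF := isFiltr (by omega) hmem
  refine ⟨by omega, Or.inl rfl, hmem, loopJ_B_pow hn,
    fun r hr i => col_of_mulVec (loopJ_B_pow_mulVec hr) i, fun j => ?_⟩
  have hjl := j.isLt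
  by_cases hj : (j : ℕ) < 2 * n
  · exact ⟨_, by simpa using hF.J_pow (j : ℕ), loopJ_B_pow_mulVec hj, 0, by simp, (add_zero _).symm⟩
  · have hj' : j = Fin.last (2 * n) := Fin.ext (by simp; omega)
    have hjv : (j : ℕ) = 2 * n := by omega
    -- The last basis vector is not a power of J applied to e_0 but (J^{2n} - λ/2) e_0.
    refine ⟨loopJ R (βB n) ^ (j : ℕ) + -scL n (halfLam R), add_mem ?_ (neg_mem ?_), ?_,
      -scL n (halfLam R), fun X => ?_, rfl⟩
    · simpa using hF.J_pow (j : ℕ)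
    · have : halfLam R = HahnSeries.single (-1 : ℤ) (algebraMap ℝ R (1 / 2)) := by
        rw [halfLam, lamL, HahnSeries.C_apply, HahnSeries.single_mul_single]
        simp
      rw [this, hjv]
      exact filt_mono (by push_cast; omega) (filt_scalar _ _)
    · rw [hjv, Matrix.add_mulVec, loopJ_B_pow_mulVec_top hn, Matrix.neg_mulVec, scL,
        Matrix.smul_mulVec, Matrix.one_mulVec, hj']
      simp
    · rw [neg_mul, mul_neg, (scL_commute _ X).eq]

end

/-! ### The involution of the loop algebra -/

section
variable {R : Type*} [CommRing R] {n : ℕ}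

/-- The substitution `λ ↦ ε λ` for a sign `ε`. -/
def twL (ε : ℤˣ) : LaurentSeries R →+ LaurentSeries R where
  toFun f := ⟨fun k => ((ε ^ k : ℤˣ) : ℤ) • f.coeff k, f.isPWO_support.mono fun k hk hk' => hk (by
    simp only at hk' ⊢
    rw [hk', smul_zero])⟩
  map_zero' := by ext; simp
  map_add' f g := by ext; simp

theorem coeff_twL (ε : ℤˣ) (f : LaurentSeries R) (k : ℤ) :
    (twL ε f).coeff k = ((ε ^ k : ℤˣ) : ℤ) • f.coeff k := rfl

theorem coeff_twL_eq_zero (ε : ℤˣ) {f : LaurentSeries R} {k : ℤ} :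
    (twL ε f).coeff k = 0 ↔ f.coeff k = 0 := by
  rw [coeff_twL]
  rcases Int.units_eq_one_or (ε ^ k) with h | h <;> rw [h] <;> simp

theorem twL_mul (ε : ℤˣ) (f g : LaurentSeries R) : twL ε (f * g) = twL ε f * twL ε g := by
  ext k
  have key : ∀ f : LaurentSeries R, (twL ε f).support = f.support := fun f =>
    Set.ext fun k => not_congr (coeff_twL_eq_zero ε)
  rw [coeff_twL, HahnSeries.coeff_mul_right' (twL ε g).isPWO_support (key g).superset,
    HahnSeries.coeff_mul_left' f.isPWO_support (key f).subset, Finset.smul_sum]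
  refine Finset.sum_congr rfl fun p hp => ?_
  rw [Finset.mem_antidiagonal] at hp
  rw [coeff_twL, coeff_twL, ← hp.2.2, zpow_add, smul_mul_smul_comm]
  push_cast
  rfl

theorem twL_single (ε : ℤˣ) (a : ℤ) (r : R) :
    twL ε (HahnSeries.single a r) = HahnSeries.single a (((ε ^ a : ℤˣ) : ℤ) • r) := by
  ext k
  rw [coeff_twL]
  by_cases h : k = a
  · subst h
    simp
  · rw [HahnSeries.coeff_single_of_ne h, HahnSeries.coeff_single_of_ne h, smul_zero]

theorem twL_C (ε : ℤˣ) (r : R) : twL ε (HahnSeries.C r : LaurentSeries R) = HahnSeries.C r := by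
  rw [HahnSeries.C_apply, twL_single]
  simp

/-- The anti-automorphism `X(λ) ↦ C X(ε λ)ᵗ C` of the loop algebra. -/
def tauM (ε : ℤˣ) : LMat R n →+ LMat R n where
  toFun X := formM _ n * (X.map (twL ε))ᵀ * formM _ n
  map_zero' := by
    rw [Matrix.map_zero _ (map_zero _), Matrix.transpose_zero, mul_zero, zero_mul]
  map_add' X Y := by
    rw [Matrix.map_add _ (map_add _), Matrix.transpose_add, mul_add, add_mul]

theorem tauM_def (ε : ℤˣ) (X : LMat R n) :
    tauM ε X = formM _ n * (X.map (twL ε))ᵀ * formM _ n := rfl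

theorem tauM_apply (ε : ℤˣ) (X : LMat R n) (i j : Idx n) :
    tauM ε X i j = (-1) ^ ((i : ℕ) + j) * twL ε (X j.rev i.rev) := by
  rw [tauM_def, mul_formM_apply, formM_mul_apply, Matrix.transpose_apply, Matrix.map_apply,
    ← mul_assoc, ← pow_add]
  congr 1
  exact neg_one_pow_congr (by omega)

theorem tauM_mul (ε : ℤˣ) (X Y : LMat R n) : tauM ε (X * Y) = tauM ε Y * tauM ε X := by
  have h : (X * Y).map (twL ε) = X.map (twL ε) * Y.map (twL ε) := by
    ext1 i j
    simp only [Matrix.map_apply, Matrix.mul_apply, map_sum, twL_mul]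
  have h2 := formM_mul_self (R := LaurentSeries R) (n := n)
  simp only [tauM_def, h, Matrix.transpose_mul, Matrix.mul_assoc]
  rw [← Matrix.mul_assoc (formM _ n) (formM _ n), h2, Matrix.one_mul]

theorem tauM_scL (ε : ℤˣ) (f : LaurentSeries R) (X : LMat R n) :
    tauM ε (f • X) = twL ε f • tauM ε X := by
  ext1 i j
  rw [tauM_apply, Matrix.smul_apply, Matrix.smul_apply, smul_eq_mul, smul_eq_mul, twL_mul,
    tauM_apply]
  ring

theorem tauM_mem (ε : ℤˣ) {M : ℕ} {m : ℤ} {X : LMat R n} (hX : X ∈ filt R n M m) :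
    tauM ε X ∈ filt R n M m := by
  intro i j k hk
  have h : (twL ε (X j.rev i.rev)).coeff k = 0 := by
    rw [coeff_twL_eq_zero]
    refine hX _ _ _ ?_
    rw [rev_val, rev_val]
    omega
  rw [tauM_apply]
  rcases neg_one_pow_eq_or (LaurentSeries R) ((i : ℕ) + j) with h1 | h1
  · rw [h1, one_mul, h]
  · rw [h1, neg_one_mul, HahnSeries.coeff_neg, h, neg_zero]

theorem coeff_tauM (ε : ℤˣ) (X : LMat R n) (k : ℤ) :
    (tauM ε X).map (fun f => f.coeff k) =
      ((ε ^ k : ℤˣ) : ℤ) • (formM R n * (X.map fun f => f.coeff k)ᵀ * formM R n) := by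
  ext i j
  rw [Matrix.map_apply, tauM_apply, Matrix.smul_apply, mul_formM_apply, formM_mul_apply,
    Matrix.transpose_apply, Matrix.map_apply, ← mul_assoc, ← pow_add,
    neg_one_pow_congr (R := R) (a := n + j + (n + i)) (b := i + j) (by omega)]
  rcases neg_one_pow_eq_or R ((i : ℕ) + j) with h1 | h1 <;>
    rcases Nat.even_or_odd ((i : ℕ) + j) with h2 | h2 <;>
    simp [h2.neg_one_pow, coeff_twL]

theorem tauM_cstM (ε : ℤˣ) (X : Matrix (Idx n) (Idx n) R) :
    tauM ε (cstM X) = cstM (formM R n * Xᵀ * formM R n) := by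
  ext1 i j
  rw [tauM_apply, cstM_apply, cstM_apply, twL_C, mul_formM_apply, formM_mul_apply,
    Matrix.transpose_apply, ← mul_assoc, ← pow_add,
    neg_one_pow_congr (R := R) (a := n + j + (n + i)) (b := i + j) (by omega), map_mul, map_pow,
    map_neg, map_one]

theorem IsSkew.conj {X : Matrix (Idx n) (Idx n) R} (hX : IsSkew X) :
    formM R n * Xᵀ * formM R n = -X := by
  rw [Matrix.mul_assoc, hX.transpose_mul_formM, mul_neg, ← Matrix.mul_assoc, formM_mul_self,
    Matrix.one_mul]

theorem isSkew_of_conj {X : Matrix (Idx n) (Idx n) R} (hX : formM R n * Xᵀ * formM R n = -X) :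
    IsSkew X := by
  have h : formM R n * (formM R n * Xᵀ * formM R n) = Xᵀ * formM R n := by
    rw [Matrix.mul_assoc, ← Matrix.mul_assoc, formM_mul_self, Matrix.one_mul]
  rw [IsSkew, ← h, hX, mul_neg, neg_add_cancel]

theorem cstM_neg (X : Matrix (Idx n) (Idx n) R) : cstM (-X) = -cstM X := by
  ext1 i j
  rw [cstM_apply, Matrix.neg_apply, Matrix.neg_apply, map_neg, cstM_apply]

theorem tauM_cstM_of_skew (ε : ℤˣ) {X : Matrix (Idx n) (Idx n) R} (hX : IsSkew X) :
    tauM ε (cstM X) = -cstM X := by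
  rw [tauM_cstM, hX.conj, cstM_neg]

theorem tauM_pow (ε : ℤˣ) (X : LMat R n) (k : ℕ) : tauM ε (X ^ (k + 1)) = tauM ε X ^ (k + 1) := by
  induction k with
  | zero => simp
  | succ k ih => rw [pow_succ, tauM_mul, ih, ← pow_succ']

theorem formM_map {S : Type*} [CommRing S] (f : R →+* S) : (formM R n).map f = formM S n := by
  ext i j
  simp only [formM, Matrix.map_apply, Matrix.of_apply]
  split_ifs <;> simp

variable [Algebra ℝ R]

theorem tauM_loopJ (ε : ℤˣ) {β : Mat n}
    (hβ : formM ℝ n * βᵀ * formM ℝ n = -((ε : ℤ) • β)) :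
    tauM ε (loopJ R β) = -loopJ R β := by
  have h1 : formM R n * (β.map (algebraMap ℝ R))ᵀ * formM R n
      = -((ε : ℤ) • β.map (algebraMap ℝ R)) := by
    have h2 := congrArg (fun X : Mat n => X.map (algebraMap ℝ R)) hβ
    simp only [Matrix.map_mul, formM_map] at h2
    rw [← Matrix.transpose_map, h2]
    rcases Int.units_eq_one_or ε with h | h <;> rw [h] <;> ext i j <;> simp
  have h3 : twL ε (lamL R) = (ε : ℤ) • lamL R := by
    rw [lamL, twL_single]
    rcases Int.units_eq_one_or ε with h | h <;> rw [h] <;> simp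
  rw [loopJ, map_add, tauM_cstM_of_skew ε isSkew_shiftM, tauM_scL, tauM_cstM, h1, cstM_neg, h3]
  rcases Int.units_eq_one_or ε with h | h <;> rw [h] <;> simp [cstM_neg] <;> abel

theorem tauM_derM (ε : ℤˣ) (D : Derivation ℝ R R) (X : LMat R n) :
    tauM ε (derM n D X) = derM n D (tauM ε X) := by
  ext i j k
  have h : ∀ Y : LMat R n, (tauM ε Y i j).coeff k = ((ε ^ k : ℤˣ) : ℤ) •
      (formM R n * (Y.map fun f => f.coeff k)ᵀ * formM R n) i j := fun Y =>
    congrFun (congrFun (coeff_tauM ε Y k) i) j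
  rw [derM_apply, coeff_derL, h, h, mul_formM_apply, formM_mul_apply, mul_formM_apply,
    formM_mul_apply, map_zsmul, ← mul_assoc, ← pow_add, ← mul_assoc, ← pow_add]
  rcases neg_one_pow_eq_or R (n + (j : ℕ) + (n + i)) with h1 | h1 <;> rw [h1] <;>
    simp [derM_apply]

/-- The resolvents of `∂ + J + u`: solutions of the equation that are conjugate to `J`. -/
structure IsRes (D : Derivation ℝ R R) (M : ℕ) (ε : ℤˣ) (J : LMat R n)
    (u : Matrix (Idx n) (Idx n) R) (S : LMat R n) : Prop where
  sub_mem : S - J ∈ filt R n M 0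
  pow : S ^ (M + 1) = lamL R • S
  eqn : derM n D S + ((J + cstM u) * S - S * (J + cstM u)) = 0
  tau : tauM ε S = -S
  conj : ∃ T Y, T * Y = 1 ∧ Y * T = 1 ∧ S = T * J * Y

omit [Algebra ℝ R] in
theorem IsV.cstM_mem {u : Matrix (Idx n) (Idx n) R} (hu : IsV u) (M : ℕ) :
    cstM u ∈ filt R n M 0 :=
  IsotropicFlow.cstM_mem fun i j h => hu.eq_zero_of_le (Fin.le_def.2 (by omega))

theorem IsLoopType.eq_of_eqn {M : ℕ} {J : LMat R n} (h : IsLoopType M J) (D : Derivation ℝ R R)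
    (hJ : derM n D J = 0) {u : Matrix (Idx n) (Idx n) R} (hu : IsV u) {S S' : LMat R n}
    (hS : S - J ∈ filt R n M 0) (hS' : S' - J ∈ filt R n M 0)
    (hpow : S ^ (M + 1) = lamL R • S) (hpow' : S' ^ (M + 1) = lamL R • S')
    (hE : derM n D S + ((J + cstM u) * S - S * (J + cstM u)) = 0)
    (hE' : derM n D S' + ((J + cstM u) * S' - S' * (J + cstM u)) = 0) : S = S' := by
  refine h.filtr.resolvent_unique h.isCyc (isDer D hJ) (hu.cstM_mem M) hS hS' ?_ ?_ hE hE'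
  · rw [hpow, scL_mul]
  · rw [hpow', scL_mul]

/-- The resolvent exists. -/
theorem IsLoopType.exists_isRes {M : ℕ} {J : LMat R n} (h : IsLoopType M J) (D : Derivation ℝ R R)
    (hJ : derM n D J = 0) {ε : ℤˣ} (hε : (-1 : ℤˣ) ^ M = ε) (htau : tauM ε J = -J)
    {u : Matrix (Idx n) (Idx n) R} (hu : IsV u) : ∃ S, IsRes D M ε J u S := by
  obtain ⟨T, Y, hTY, hYT, hmem, hpow, hE⟩ :=
    h.filtr.exists_resolvent h.isCyc (isDer D hJ) (hu.cstM_mem M)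
  set S := T * J * Y with hS
  rw [scL_mul] at hpow
  refine ⟨S, hmem, hpow, hE, ?_, T, Y, hTY, hYT, hS⟩
  -- The loop -τ(S) solves the same equation and has leading term J. It satisfies the power relation
  -- because (-1)^M = ε cancels the sign that λ acquires under τ. Uniqueness then gives the
  -- symmetry.
  have key : -tauM ε S = S := by
    refine h.eq_of_eqn D hJ hu ?_ hmem ?_ hpow ?_ hE
    · have := neg_mem (tauM_mem ε hmem)
      rw [map_sub, htau] at this
      convert this using 1
      abel
    · have h1 : twL ε (lamL R) = (ε : ℤ) • lamL R := by
        rw [lamL, twL_single]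
        rcases Int.units_eq_one_or ε with h | h <;> rw [h] <;> simp
      rw [neg_pow, ← tauM_pow, hpow, tauM_scL, h1, ← hε]
      rcases Nat.even_or_odd M with h2 | h2
      · rw [h2.neg_one_pow, (Even.add_one h2).neg_one_pow]
        simp
      · rw [h2.neg_one_pow, (Odd.add_one h2).neg_one_pow]
        simp
    · have h1 := congrArg (fun X => -tauM ε X) hE
      simp only [map_add, map_sub, tauM_mul, map_zero, htau, tauM_derM,
        tauM_cstM_of_skew ε hu.1, neg_zero] at h1
      rw [← h1, map_neg]
      noncomm_ring
  rw [← neg_eq_iff_eq_neg]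
  exact key

end

/-! ### The objects of the statement over the ring of smooth functions -/

section
variable {n : ℕ}

theorem C_eq_formM : C n = formM ℝ n := by
  ext i j
  have hi := i.isLt
  rw [C, Matrix.sum_apply, formM, Matrix.of_apply,
    Finset.sum_eq_single_of_mem ((i : ℕ) + 1) (by rw [Finset.mem_Icc]; omega)]
  · rw [E, Matrix.smul_apply, Matrix.of_apply, smul_eq_mul]
    by_cases h : (i : ℕ) + j = 2 * n
    · rw [if_pos (by omega), if_pos h, mul_one]
      congr 1
    · rw [if_neg (by omega), if_neg h, mul_zero]
  · intro k _ hk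
    rw [E, Matrix.smul_apply, Matrix.of_apply, if_neg (by omega), smul_zero]

theorem b_eq_shiftM : b n = shiftM ℝ n := by
  ext i j
  have hi := i.isLt
  have hj := j.isLt
  rw [b, Matrix.sum_apply, shiftM, Matrix.of_apply]
  by_cases h : (i : ℕ) = j + 1
  · rw [if_pos h, Finset.sum_eq_single_of_mem ((j : ℕ) + 1) (by rw [Finset.mem_Icc]; omega)]
    · rw [E, Matrix.of_apply, if_pos (by omega)]
    · intro k _ hk
      rw [E, Matrix.of_apply, if_neg (by omega)]
  · rw [if_neg h]
    refine Finset.sum_eq_zero fun k _ => ?_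
    rw [E, Matrix.of_apply, if_neg (by omega)]

theorem isOrtho_iff {A : Mat n} : IsOrtho n A ↔ Aᵀ * formM ℝ n * A = formM ℝ n := by
  rw [IsOrtho, C_eq_formM]

theorem IsSkew.trace_eq_zero {X : Mat n} (hX : IsSkew X) : X.trace = 0 := by
  have h1 : ∑ i, X i i = ∑ i, -X i i := by
    rw [← Equiv.sum_comp Fin.revPerm fun i => X i i]
    refine Finset.sum_congr rfl fun i _ => ?_
    have := hX.apply_rev i.rev i.rev
    rw [Fin.rev_rev, Even.neg_one_pow ⟨_, rfl⟩] at this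
    simpa using this
  rw [Finset.sum_neg_distrib] at h1
  have h2 : X.trace = ∑ i, X i i := rfl
  linarith

theorem mem_so_iff {X : Mat n} : X ∈ so n ↔ IsSkew X := by
  rw [so, Set.mem_ofPred_eq, C_eq_formM]
  exact ⟨fun h => h.2, fun h => ⟨h.trace_eq_zero, h⟩⟩

theorem βmat_apply {k : ℕ} (hk : k ∈ Set.Icc 1 n) (i j : Idx n) : βmat n k i j =
    if ((i : ℕ) + k = n ∧ (j : ℕ) + 1 = n + k) ∨ ((i : ℕ) + k = n + 1 ∧ (j : ℕ) = n + k)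
      then 1 else 0 := by
  rw [Set.mem_Icc] at hk
  simp only [βmat, E, Matrix.add_apply, Matrix.of_apply]
  by_cases h1 : (i : ℕ) + k = n ∧ (j : ℕ) + 1 = n + k
  · rw [if_pos (by omega), if_neg (by omega), if_pos (Or.inl h1), add_zero]
  · by_cases h2 : (i : ℕ) + k = n + 1 ∧ (j : ℕ) = n + k
    · rw [if_neg (by omega), if_pos (by omega), if_pos (Or.inr h2), zero_add]
    · rw [if_neg (by omega), if_neg (by omega), if_neg (by tauto), zero_add]

theorem βmat_eq_betaM {k : ℕ} (hk : k ∈ Set.Icc 1 n) (m q : Idx n) (hm : (m : ℕ) + 1 = n + k)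
    (hq : (q : ℕ) = n + k) : βmat n k = betaM ℝ m q := by
  ext i j
  have hi := i.isLt
  have hj := j.isLt
  rw [βmat_apply hk, betaM, Matrix.of_apply]
  have h : (((i : ℕ) + k = n ∧ (j : ℕ) + 1 = n + k) ∨ ((i : ℕ) + k = n + 1 ∧ (j : ℕ) = n + k)) ↔
      ((i = q.rev ∧ j = m) ∨ (i = m.rev ∧ j = q)) := by
    simp only [Fin.ext_iff, rev_val]
    rw [Set.mem_Icc] at hk
    omega
  simp only [h]

theorem isV_βmat {k : ℕ} (hk : k ∈ Set.Icc 1 n) : IsV (βmat n k) := by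
  have h := Set.mem_Icc.1 hk
  rw [βmat_eq_betaM hk ⟨n + k - 1, by omega⟩ ⟨n + k, by omega⟩ (by simp; omega) rfl]
  exact isV_betaM (by simp; omega) (by simp; omega)

theorem isV_of_mem {X : Mat n} (hX : X ∈ V n) : IsV X := by
  let W : Submodule ℝ (Mat n) :=
    { carrier := {X | IsV X}
      add_mem' := fun h1 h2 => IsV.add h1 h2
      zero_mem' := isV_zero
      smul_mem' := fun a _ h => IsV.smul a h }
  have h : V n ≤ W := by
    rw [V, Submodule.span_le]
    rintro _ ⟨k, hk, rfl⟩
    exact isV_βmat hk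
  exact h hX

theorem mem_V_of_isV {X : Mat n} (hX : IsV X) : X ∈ V n := by
  -- Counted from 0, the left entry of `βmat n (k + 1)` is in row n - 1 - k and column n + k. It
  -- gives the coefficient; the right entry is its mirror image and equals it by skewness.
  obtain ⟨r, hr⟩ : ∃ r : Fin n → Idx n, ∀ k, (r k : ℕ) + k + 1 = n :=
    ⟨fun k => ⟨n - 1 - k, by omega⟩, fun k => by
      have := k.isLt
      simp only
      omega⟩
  obtain ⟨c, hc⟩ : ∃ c : Fin n → Idx n, ∀ k, (c k : ℕ) = n + k :=
    ⟨fun k => ⟨n + k, by omega⟩, fun k => rfl⟩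
  have key : X = ∑ k : Fin n, X (r k) (c k) • βmat n ((k : ℕ) + 1) := by
    ext i j
    have hi := i.isLt
    have hj := j.isLt
    rw [Matrix.sum_apply]
    have hz : ∀ k : Fin n, ¬(((i : ℕ) + k + 1 = n ∧ (j : ℕ) = n + k) ∨
        ((i : ℕ) + k = n ∧ (j : ℕ) = n + k + 1)) →
        (X (r k) (c k) • βmat n ((k : ℕ) + 1)) i j = 0 := by
      intro k hk
      have hkn := k.isLt
      rw [Matrix.smul_apply, βmat_apply (by rw [Set.mem_Icc]; omega), if_neg (by omega), smul_zero]
    have ho : ∀ k : Fin n, (((i : ℕ) + k + 1 = n ∧ (j : ℕ) = n + k) ∨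
        ((i : ℕ) + k = n ∧ (j : ℕ) = n + k + 1)) →
        (X (r k) (c k) • βmat n ((k : ℕ) + 1)) i j = X (r k) (c k) := by
      intro k hk
      have hkn := k.isLt
      rw [Matrix.smul_apply, βmat_apply (by rw [Set.mem_Icc]; omega), if_pos (by omega), smul_eq_mul,
        mul_one]
    by_cases h0 : (i : ℕ) < j ∧ ((i : ℕ) + j + 1 = 2 * n ∨ (i : ℕ) + j = 2 * n + 1)
    · obtain ⟨h1, h2⟩ := h0
      obtain ⟨k, hk⟩ : ∃ k : Fin n, (j : ℕ) = n + k ∧ (i : ℕ) + j + 1 = 2 * n ∨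
          (j : ℕ) = n + k + 1 ∧ (i : ℕ) + j = 2 * n + 1 := by
        rcases h2 with h2 | h2
        · exact ⟨⟨j - n, by omega⟩, Or.inl ⟨by simp only; omega, h2⟩⟩
        · exact ⟨⟨j - n - 1, by omega⟩, Or.inr ⟨by simp only; omega, h2⟩⟩
      have hrk := hr k
      have hck := hc k
      rw [Finset.sum_eq_single k]
      · rw [ho k (by omega)]
        rcases hk with ⟨h3, h4⟩ | ⟨h3, h4⟩
        · have e1 : r k = i := Fin.ext (by omega)
          have e2 : c k = j := Fin.ext (by omega)
          rw [e1, e2]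
        · have e1 : r k = j.rev := Fin.ext (by rw [rev_val]; omega)
          have e2 : c k = i.rev := Fin.ext (by rw [rev_val]; omega)
          have hodd : Odd ((i : ℕ) + j) := ⟨n, h4⟩
          rw [e1, e2, hX.1.apply_rev i j, hodd.neg_one_pow, neg_neg, one_mul]
      · intro l _ hl
        have : (l : ℕ) ≠ k := fun h => hl (Fin.ext h)
        exact hz l (by omega)
      · simp
    · have h1 : X i j = 0 := by
        by_contra h
        exact h0 (hX.2 i j h)
      rw [h1]
      refine (Finset.sum_eq_zero fun k _ => hz k ?_).symm
      omega
  rw [key]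
  exact Submodule.sum_mem _ fun k _ => Submodule.smul_mem _ _
    (Submodule.subset_span ⟨(k : ℕ) + 1, by rw [Set.mem_Icc]; omega, rfl⟩)

theorem mem_V_iff {X : Mat n} : X ∈ V n ↔ IsV X := ⟨isV_of_mem, mem_V_of_isV⟩

theorem evM_formM (p : ℝ × ℝ) : evM p (formM Sm n) = formM ℝ n := formM_map (ev p)

theorem evM_shiftM (p : ℝ × ℝ) : evM p (shiftM Sm n) = shiftM ℝ n := by
  ext i j
  simp only [evM_apply, shiftM, Matrix.of_apply]
  split_ifs <;> simp

theorem evM_transpose (p : ℝ × ℝ) (X : SMat n) : evM p Xᵀ = (evM p X)ᵀ := rfl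

theorem isSkew_iff_evM {X : SMat n} : IsSkew X ↔ ∀ p, IsSkew (evM p X) := by
  have h : ∀ p, evM p (Xᵀ * formM Sm n + formM Sm n * X) =
      (evM p X)ᵀ * formM ℝ n + formM ℝ n * evM p X := fun p => by
    rw [map_add, map_mul, map_mul, evM_formM, evM_transpose]
  constructor
  · intro hX p
    rw [IsSkew, ← h, show Xᵀ * formM Sm n + formM Sm n * X = 0 from hX, map_zero]
  · intro hX
    refine SMat.ext_ev fun p => ?_
    rw [h, map_zero]
    exact hX p

theorem isV_iff_evM {X : SMat n} : IsV X ↔ ∀ p, evM p X ∈ V n := by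
  simp only [mem_V_iff, IsV]
  rw [forall_and, ← isSkew_iff_evM]
  refine and_congr_right fun _ => ⟨fun h p i j hp => h i j ?_, fun h i j hij => ?_⟩
  · rintro h0
    rw [evM_apply, h0, map_zero] at hp
    exact hp rfl
  · by_contra h0
    apply hij
    refine Sm.ext_ev fun p => ?_
    by_contra hp
    rw [map_zero] at hp
    exact h0 (h p i j hp)

theorem evM_brkM (U Q : SMat n) (x t : ℝ) : evM (x, t) (brkM dX U Q)
    = brk n (fun y => evM (y, t) U) (fun y => evM (y, t) Q) x := by
  rw [brkM, brk, map_add, map_sub, map_mul, map_mul, map_add, evM_shiftM, evM_matD_dX, b_eq_shiftM]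

/-- Needed to conclude that a leading coefficient vanishes when one of its powers does. -/
instance : IsReduced Sm where
  eq_zero f hf := by
    obtain ⟨k, hk⟩ := hf
    refine Sm.ext_ev fun p => ?_
    have := congrArg (ev p) hk
    rw [map_pow, map_zero] at this
    rw [map_zero]
    exact eq_zero_of_pow_eq_zero this

/-! ### Evaluation of loops -/

/-- Evaluation of the coefficients of a Laurent series. -/
def evL (p : ℝ × ℝ) : LaurentSeries Sm →+* LaurentSeries ℝ where
  toFun f := f.map (ev p)
  map_one' := HahnSeries.map_one (ev p).toMonoidWithZeroHom
  map_mul' f g := HahnSeries.map_mul (ev p).toNonUnitalRingHom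
  map_zero' := by ext; simp
  map_add' f g := by ext; simp

theorem coeff_evL (p : ℝ × ℝ) (f : LaurentSeries Sm) (k : ℤ) :
    (evL p f).coeff k = ev p (f.coeff k) := rfl

/-- Evaluation of the coefficients of a loop. -/
def evLM (p : ℝ × ℝ) : LMat Sm n →+* LoopMat n := (evL p).mapMatrix

/-- The coefficient of `λ^k`. -/
def coefM (X : LMat Sm n) (k : ℤ) : SMat n := X.map fun f => f.coeff (-k)

theorem loopCoeff_evLM (p : ℝ × ℝ) (X : LMat Sm n) (k : ℤ) :
    loopCoeff (evLM p X) k = evM p (coefM X k) := rfl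

theorem LMat.ext_ev {X Y : LMat Sm n} (h : ∀ p, evLM p X = evLM p Y) : X = Y := by
  ext1 i j
  ext1
  funext k
  refine Sm.ext_ev fun p => ?_
  exact congrArg (fun Z : LoopMat n => (Z i j).coeff k) (h p)

theorem LMat.ext_coefM {X Y : LMat Sm n} (h : ∀ k, coefM X k = coefM Y k) : X = Y := by
  ext1 i j
  ext1
  funext k
  have := congrFun (congrFun (h (-k)) i) j
  simpa [coefM] using this

theorem evLM_apply (p : ℝ × ℝ) (X : LMat Sm n) (i j : Idx n) : evLM p X i j = evL p (X i j) := rfl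

theorem evL_single (p : ℝ × ℝ) (a : ℤ) (r : Sm) :
    evL p (HahnSeries.single a r) = HahnSeries.single a (ev p r) := by
  ext k
  rw [coeff_evL]
  by_cases h : k = a
  · subst h
    simp
  · rw [HahnSeries.coeff_single_of_ne h, HahnSeries.coeff_single_of_ne h, map_zero]

theorem evL_C (p : ℝ × ℝ) (r : Sm) : evL p (HahnSeries.C r) = HahnSeries.C (ev p r) := by
  rw [HahnSeries.C_apply, evL_single, HahnSeries.C_apply]

theorem evL_lamL (p : ℝ × ℝ) : evL p (lamL Sm) = lam := by
  rw [lamL, evL_single, map_one, lam]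

theorem evLM_smul (p : ℝ × ℝ) (f : LaurentSeries Sm) (X : LMat Sm n) :
    evLM p (f • X) = evL p f • evLM p X := by
  ext1 i j
  rw [evLM_apply, Matrix.smul_apply, Matrix.smul_apply, smul_eq_mul, map_mul, smul_eq_mul, evLM_apply]

theorem evLM_cstM (p : ℝ × ℝ) (X : SMat n) : evLM p (cstM X) = constLoop (evM p X) := by
  ext1 i j
  rw [evLM_apply, cstM_apply, evL_C]
  rfl

theorem evLM_loopJ (p : ℝ × ℝ) (β : Mat n) :
    evLM p (loopJ Sm β) = constLoop (b n) + lam • constLoop β := by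
  rw [loopJ, map_add, evLM_smul, evLM_cstM, evLM_cstM, evM_shiftM, evL_lamL, b_eq_shiftM]
  rfl

theorem coefM_add (X Y : LMat Sm n) (k : ℤ) : coefM (X + Y) k = coefM X k + coefM Y k := rfl

theorem coefM_sub (X Y : LMat Sm n) (k : ℤ) : coefM (X - Y) k = coefM X k - coefM Y k := by
  ext1 i j
  exact HahnSeries.coeff_sub ..

theorem coefM_zero (k : ℤ) : coefM (0 : LMat Sm n) k = 0 := rfl

theorem coefM_derM (D : Derivation ℝ Sm Sm) (X : LMat Sm n) (k : ℤ) :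
    coefM (derM n D X) k = matD D (coefM X k) := rfl

/-- The resolvent equation, evaluated. -/
theorem commutesWith_iff (β : Mat n) (U : SMat n) (X : LMat Sm n) :
    (∀ t, CommutesWith n (constLoop (b n) + lam • constLoop β) (fun x => evM (x, t) U)
      fun x => evLM (x, t) X) ↔
    derM n dX X + ((loopJ Sm β + cstM U) * X - X * (loopJ Sm β + cstM U)) = 0 := by
  set Z := derM n dX X + ((loopJ Sm β + cstM U) * X - X * (loopJ Sm β + cstM U)) with hZ
  have key : ∀ x t k, matDeriv (fun y => loopCoeff (evLM (y, t) X) k) x +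
      loopCoeff ((constLoop (b n) + lam • constLoop β + constLoop (evM (x, t) U)) * evLM (x, t) X -
        evLM (x, t) X * (constLoop (b n) + lam • constLoop β + constLoop (evM (x, t) U))) k
      = evM (x, t) (coefM Z k) := by
    intro x t k
    simp only [loopCoeff_evLM]
    rw [← evM_matD_dX, ← evLM_loopJ (x, t), ← evLM_cstM, ← map_add, ← map_mul, ← map_mul, ← map_sub,
      loopCoeff_evLM, ← map_add, hZ, coefM_add, coefM_derM]
  constructor
  · intro h
    refine LMat.ext_coefM fun k => SMat.ext_ev fun p => ?_
    obtain ⟨x, t⟩ := p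
    rw [← key, coefM_zero, map_zero]
    exact h t x k
  · intro h t x k
    rw [key, h, coefM_zero, map_zero]

/-- The extension of a smooth family of loops over `ℝ` to `ℝ²`, constant in the second variable. -/
theorem exists_liftL {P : ℝ → LoopMat n} (hP : IsSmoothLoop n P) :
    ∃ (X : LMat Sm n) (m : ℤ), (∀ x t, evLM (x, t) X = P x) ∧
      ∀ i j k, k < -m → (X i j).coeff k = 0 := by
  obtain ⟨h1, m, hm⟩ := hP
  let c : Idx n → Idx n → ℤ → Sm := fun i j k => ⟨fun p => (P p.1 i j).coeff k, by
    have : ContDiff ℝ ∞ fun p : ℝ × ℝ => (P p.1 i j).coeff (- -k) := (h1 (-k)).lift i j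
    rw [neg_neg] at this
    exact this⟩
  have hc : ∀ i j k, k < -m → c i j k = 0 := by
    intro i j k hk
    refine Sm.ext_ev fun p => ?_
    have : (P p.1 i j).coeff (- -k) = 0 := congrFun (congrFun (hm p.1 (-k) (by linarith)) i) j
    rw [neg_neg] at this
    exact this
  refine ⟨Matrix.of fun i j => HahnSeries.ofSuppBddBelow (c i j) ⟨-m, fun k hk => ?_⟩, m, ?_, ?_⟩
  · by_contra h
    exact hk (hc i j k (not_le.1 h))
  · intro x t
    ext i j k
    rfl
  · intro i j k hk
    exact hc i j k hk

end

/-! ### Existence and uniqueness of the resolvents -/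

section
variable {n : ℕ}

theorem IsV.sub {R : Type*} [CommRing R] {v w : Matrix (Idx n) (Idx n) R} (hv : IsV v) (hw : IsV w) :
    IsV (v - w) := by
  have h : v - w = v + (-1 : R) • w := by rw [neg_one_smul, sub_eq_add_neg]
  exact h ▸ hv.add (hw.smul (-1))

theorem JB_eq (n : ℕ) : JB n = constLoop (b n) + lam • constLoop (βB n) := rfl

theorem JA_eq (n : ℕ) : JA n = constLoop (b n) + lam • constLoop (βA n) := rfl

theorem isLoopType_A_trace (hn : 1 ≤ n) : (loopJ Sm (βA n)).trace = 0 := by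
  refine Finset.sum_eq_zero fun i _ => ?_
  rw [Matrix.diag_apply, loopJ_apply, if_neg (by omega), βA_apply, if_neg (by omega)]
  simp

theorem tau_βA : formM ℝ n * (βA n)ᵀ * formM ℝ n = -(((-1 : ℤˣ) : ℤ) • βA n) := by
  ext i j
  have hi := i.isLt
  have hj := j.isLt
  rw [mul_formM_apply, formM_mul_apply, Matrix.transpose_apply, βA_apply, rev_val, rev_val]
  by_cases h : (i : ℕ) = 0 ∧ (j : ℕ) = 2 * n
  · rw [if_pos (by omega), mul_one, ← pow_add, Even.neg_one_pow ⟨2 * n, by omega⟩]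
    simp [βA_apply, h]
  · rw [if_neg (by omega), Matrix.neg_apply, Matrix.smul_apply, βA_apply, if_neg h]
    simp

theorem isSkew_βB : IsSkew (βB n) := by
  apply isSkew_of_conj
  ext i j
  have hi := i.isLt
  have hj := j.isLt
  rw [mul_formM_apply, formM_mul_apply, Matrix.transpose_apply, Matrix.neg_apply, βB_apply, βB_apply,
    rev_val, rev_val]
  by_cases h : ((i : ℕ) = 0 ∧ (j : ℕ) + 1 = 2 * n) ∨ ((i : ℕ) = 1 ∧ (j : ℕ) = 2 * n)
  · rw [if_pos (by omega), if_pos h, ← mul_assoc, ← pow_add, Odd.neg_one_pow]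
    · ring
    · rcases h with h | h
      · exact ⟨2 * n - 1, by omega⟩
      · exact ⟨2 * n, by omega⟩
  · rw [if_neg (by omega), if_neg h]
    simp

theorem tau_βB : formM ℝ n * (βB n)ᵀ * formM ℝ n = -(((1 : ℤˣ) : ℤ) • βB n) := by
  rw [isSkew_βB.conj]
  simp

/-- Conjugacy to J enters the uniqueness of the resolvents only through this polynomial relation. It
is an identity between entries, so, unlike the conjugating matrix, it lifts from single points to
the ring of smooth functions. -/
theorem eq_smul_of_isConj {R : Type*} [CommRing R] {J X : LMat R n} (h : IsConj J X) {k : ℕ}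
    {f : LaurentSeries R}
    (hJ : J ^ (k + 1) = f • J) : X ^ (k + 1) = f • X := by
  obtain ⟨c, hc⟩ := h
  have h1 : (c : LMat R n) * J ^ (k + 1) = X ^ (k + 1) * c := (hc.pow_right (k + 1)).eq
  have h2 : (c : LMat R n) * J = X * c := hc.eq
  rw [hJ, mul_smul_comm, h2, ← smul_mul_assoc] at h1
  have h3 := congrArg (· * ((c⁻¹ : (LMat R n)ˣ) : LMat R n)) h1
  simpa [mul_assoc] using h3.symm

theorem eq_smul_one_of_isConj {R : Type*} [CommRing R] {J X : LMat R n} (h : IsConj J X) {k : ℕ}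
    {f : LaurentSeries R}
    (hJ : J ^ k = f • 1) : X ^ k = f • 1 := by
  obtain ⟨c, hc⟩ := h
  have h1 : (c : LMat R n) * J ^ k = X ^ k * c := (hc.pow_right k).eq
  rw [hJ, mul_smul_comm, mul_one] at h1
  have h3 := congrArg (· * ((c⁻¹ : (LMat R n)ˣ) : LMat R n)) h1
  simpa using h3.symm

theorem mem_filt_of_bdd {M : ℕ} {X : LMat Sm n} {m : ℤ} (h : ∀ i j k, k < -m → (X i j).coeff k = 0) :
    X ∈ filt Sm n M (M * (m + 1) + 2 * n) := by
  intro i j k hk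
  apply h
  by_contra hlt
  have h1 : -m ≤ k := not_lt.1 hlt
  have hi := i.isLt
  have hj := j.isLt
  have h2 : (M : ℤ) * -m ≤ M * k := mul_le_mul_of_nonneg_left h1 (by positivity)
  have h3 : (0 : ℤ) ≤ M := by positivity
  have hj' : (j : ℤ) ≤ 2 * n := by omega
  have hi' : (i : ℤ) ≤ 2 * n := by omega
  nlinarith

/-- Smoothness and boundedness of the evaluation of a loop. -/
theorem isSmoothLoop_evLM {M : ℕ} (hM : 1 ≤ M) {X : LMat Sm n} {m : ℤ} (hX : X ∈ filt Sm n M m)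
    (t : ℝ) : IsSmoothLoop n fun x => evLM (x, t) X := by
  refine ⟨fun k => (matSmooth_evM (coefM X k)).slice t, |m| + 2 * n, fun x k hk => ?_⟩
  ext i j
  have : (X i j).coeff (-k) = 0 := by
    refine hX i j _ ?_
    have hj := j.isLt
    have h1 : (1 : ℤ) ≤ M := by omega
    have h2 := le_abs_self m
    have h3 := abs_nonneg m
    have : k ≤ M * k := by nlinarith
    have hj' : (j : ℤ) ≤ 2 * n := by omega
    have : (0 : ℤ) ≤ i := by positivity
    linarith
  rw [loopCoeff_evLM, evM_apply, coefM, Matrix.map_apply, this, map_zero, Matrix.zero_apply]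

/-- The lift of a resolvent to the ring of smooth functions of two variables. -/
theorem exists_lift_resolvent {M : ℕ} {β : Mat n} {u : ℝ → Mat n} {P : ℝ → LoopMat n}
    (hu : MatSmooth n u) (hP : IsSmoothLoop n P)
    (hE : CommutesWith n (constLoop (b n) + lam • constLoop β) u P) :
    ∃ (X : LMat Sm n) (m : ℤ), X ∈ filt Sm n M m ∧ (∀ x t, evLM (x, t) X = P x) ∧
      derM n dX X + ((loopJ Sm β + cstM (toSMat (fun p => u p.1) hu.lift)) * X -
        X * (loopJ Sm β + cstM (toSMat (fun p => u p.1) hu.lift))) = 0 := by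
  obtain ⟨X, m, hX, hXm⟩ := exists_liftL hP
  refine ⟨X, _, mem_filt_of_bdd hXm, hX, ?_⟩
  rw [← commutesWith_iff]
  intro t
  simpa only [hX, evM_toSMat] using hE

theorem IsRes.isConj {D : Derivation ℝ Sm Sm} {M : ℕ} {ε : ℤˣ} {β : Mat n} {U : SMat n}
    {S : LMat Sm n} (h : IsRes D M ε (loopJ Sm β) U S) (p : ℝ × ℝ) :
    IsConj (constLoop (b n) + lam • constLoop β) (evLM p S) := by
  obtain ⟨T, Y, hTY, hYT, hS⟩ := h.conj
  refine ⟨⟨evLM p T, evLM p Y, by rw [← map_mul, hTY, map_one], by rw [← map_mul, hYT, map_one]⟩, ?_⟩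
  rw [← evLM_loopJ p]
  change evLM p T * evLM p (loopJ Sm β) = evLM p S * evLM p T
  rw [← map_mul, ← map_mul, hS, mul_assoc, hYT, mul_one]

theorem coefM_tau {ε : ℤˣ} {S : LMat Sm n} (h : tauM ε S = -S) (k : ℤ) :
    ((ε ^ k : ℤˣ) : ℤ) • (formM Sm n * (coefM S k)ᵀ * formM Sm n) = -coefM S k := by
  have h1 := coeff_tauM ε S (-k)
  rw [h, zpow_neg] at h1
  have h2 : (ε ^ k)⁻¹ = ε ^ k := Int.units_inv_eq_self _
  rw [h2] at h1
  exact h1.symm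

theorem coefM_skew {ε : ℤˣ} {S : LMat Sm n} (h : tauM ε S = -S) {k : ℤ} (hk : ε ^ k = 1) :
    IsSkew (coefM S k) := by
  apply isSkew_of_conj
  have := coefM_tau h k
  rwa [hk, Units.val_one, one_smul] at this

/-- On the antidiagonal the reflection fixes the position and changes the sign. The case used below
is that of the two corners, which in type B the degree count alone cannot exclude. -/
theorem IsSkew.corner {R : Type*} [CommRing R] [Algebra ℝ R] {X : Matrix (Idx n) (Idx n) R}
    (hX : IsSkew X) {i j : Idx n} (hij : (i : ℕ) + j = 2 * n) : X i j = 0 := by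
  have h := hX.apply_rev i j
  have h1 : j.rev = i := Fin.ext (by rw [rev_val]; omega)
  have h2 : i.rev = j := Fin.ext (by rw [rev_val]; omega)
  rw [h1, h2, Even.neg_one_pow ⟨n, by omega⟩, neg_one_mul] at h
  refine eq_zero_of_add_self ?_
  nth_rw 1 [h]
  rw [neg_add_cancel]

/-! #### The `B`-type resolvent -/

/-- Both solutions are lifted to loops over `Sm`, shown to have leading term J, and compared by the
uniqueness of the filtered resolvent. -/
theorem IsP.eq (hn : 1 ≤ n) {u : ℝ → Mat n} (hu : MatSmooth n u) (huV : ∀ x, u x ∈ V n)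
    {P P' : ℝ → LoopMat n} (hP : IsP n u P) (hP' : IsP n u P') : P = P' := by
  have hL := isLoopType_B (R := Sm) hn
  have hD := derM_loopJ (n := n) dX (βB n)
  set U := toSMat (fun p => u p.1) hu.lift with hU
  have hUV : IsV U := isV_iff_evM.2 fun p => huV p.1
  have key : ∀ P, IsP n u P → ∃ X : LMat Sm n, (∀ x t, evLM (x, t) X = P x) ∧
      X - loopJ Sm (βB n) ∈ filt Sm n (2 * n) 0 ∧ X ^ (2 * n + 1) = lamL Sm • X ∧
      derM n dX X + ((loopJ Sm (βB n) + cstM U) * X - X * (loopJ Sm (βB n) + cstM U)) = 0 := by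
    rintro P ⟨h1, h2, h3, h4, h5⟩
    obtain ⟨X, m, hXm, hX, hE⟩ := exists_lift_resolvent (M := 2 * n) hu h1 h3
    have hpow : X ^ (2 * n + 1) = lamL Sm • X := by
      refine LMat.ext_ev fun p => ?_
      rw [map_pow, evLM_smul, evL_lamL]
      refine eq_smul_of_isConj (hX p.1 p.2 ▸ h4 p.1) ?_
      rw [JB_eq, ← evLM_loopJ p, ← map_pow, loopJ_B_pow hn, evLM_smul, evL_lamL]
    have hlast : X (Fin.last (2 * n)) 0 = 0 := by
      ext1
      funext k
      refine Sm.ext_ev fun p => ?_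
      have h6 := mem_so_iff.1 (h2 p.1 (-k))
      rw [← hX p.1 p.2] at h6
      have := h6.corner (i := Fin.last (2 * n)) (j := 0) (by simp)
      rw [loopCoeff_evLM, evM_apply, coefM, Matrix.map_apply, neg_neg] at this
      rw [HahnSeries.coeff_zero, map_zero]
      exact this
    obtain ⟨a, ha⟩ := hL.exists_leading_one dX (hUV.cstM_mem _) hXm hE (Or.inr hlast) hpow
    -- The loop X - aJ has degree at most 0, which excludes λ¹ at row 0 and column 2n - 1. There J_B
    -- and, by normalization, X both have the coefficient 1/2.
    have ha1 : a = 1 := by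
      refine Sm.ext_ev fun p => ?_
      have h6 := ha 0 ⟨2 * n - 1, by omega⟩ (-1) (by
        have : ((2 * n - 1 : ℕ) : ℤ) = 2 * n - 1 := by omega
        simp [this])
      have h7 := congrFun (congrFun (h5 p.1) 0) ⟨2 * n - 1, by omega⟩
      rw [← hX p.1 p.2, loopCoeff_evLM, evM_apply, coefM, Matrix.map_apply, βB_apply,
        if_pos (Or.inl ⟨rfl, by simp only; omega⟩)] at h7
      rw [Matrix.sub_apply, Matrix.smul_apply, loopJ_apply, if_neg (by simp), zero_add, βB_apply,
        if_pos (Or.inl ⟨rfl, by simp only; omega⟩), HahnSeries.coeff_sub, smul_eq_mul,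
        HahnSeries.C_apply, HahnSeries.C_apply, lamL, HahnSeries.single_mul_single,
        HahnSeries.single_mul_single, one_mul, add_zero, zero_add, HahnSeries.coeff_single_same] at h6
      have h8 := congrArg (ev p) h6
      rw [map_sub, h7, map_mul, ev_algebraMap, map_zero] at h8
      rw [map_one]
      linarith
    rw [ha1, map_one, one_smul] at ha
    exact ⟨X, hX, ha, hpow, hE⟩
  obtain ⟨X, hX, h1, h2, h3⟩ := key P hP
  obtain ⟨X', hX', h1', h2', h3'⟩ := key P' hP'
  have : X = X' := hL.eq_of_eqn dX hD hUV h1 h1' h2 h2' h3 h3'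
  funext x
  rw [← hX x 0, ← hX' x 0, this]

theorem IsRes.isP (hn : 1 ≤ n) {U : SMat n} {S : LMat Sm n}
    (h : IsRes dX (2 * n) 1 (loopJ Sm (βB n)) U S) (t : ℝ) :
    IsP n (fun x => evM (x, t) U) fun x => evLM (x, t) S := by
  have hL := isLoopType_B (R := Sm) hn
  have hS1 : S ∈ filt Sm n (2 * n) 1 := by
    have := add_mem (filt_mono (by omega) h.sub_mem) hL.mem
    simpa using this
  have hskew : ∀ k, IsSkew (coefM S k) := fun k => coefM_skew h.tau (one_zpow k)
  refine ⟨isSmoothLoop_evLM (by omega) hS1 t, fun x k => ?_, ?_, fun x => h.isConj _, fun x => ?_⟩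
  · rw [loopCoeff_evLM, mem_so_iff]
    exact isSkew_iff_evM.1 (hskew k) _
  · exact (commutesWith_iff (βB n) U S).2 h.eqn t
  · ext i j
    have hi := i.isLt
    have hj := j.isLt
    rw [loopCoeff_evLM, evM_apply]
    -- The coefficient of λ¹ in S - J has degree 2n + i - j, positive except at the corner (0, 2n),
    -- where skewness makes it zero.
    by_cases hij : (i : ℕ) = 0 ∧ (j : ℕ) = 2 * n
    · rw [(hskew 1).corner (by omega), map_zero, βB_apply, if_neg (by omega)]
    · have h1 := h.sub_mem i j (-1) (by push_cast; omega)
      rw [Matrix.sub_apply, HahnSeries.coeff_sub, sub_eq_zero] at h1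
      rw [coefM, Matrix.map_apply, h1, loopJ_apply, HahnSeries.coeff_add, lamL, HahnSeries.C_apply,
        HahnSeries.single_mul_single, one_mul, add_zero, HahnSeries.coeff_single_same]
      have h2 : (if (i : ℕ) = j + 1 then (1 : LaurentSeries Sm) else 0).coeff (-1) = 0 := by
        split_ifs <;> simp [HahnSeries.coeff_one]
      rw [h2, zero_add, ev_algebraMap]

/-! #### The `A`-type resolvent -/

theorem IsS.eq (hn : 1 ≤ n) {u : ℝ → Mat n} (hu : MatSmooth n u) (huV : ∀ x, u x ∈ V n)
    {P P' : ℝ → LoopMat n} (hP : IsS n u P) (hP' : IsS n u P') : P = P' := by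
  have hL := isLoopType_A (R := Sm) hn
  have hD := derM_loopJ (n := n) dX (βA n)
  set U := toSMat (fun p => u p.1) hu.lift with hU
  have hUV : IsV U := isV_iff_evM.2 fun p => huV p.1
  have key : ∀ P, IsS n u P → ∃ X : LMat Sm n, (∀ x t, evLM (x, t) X = P x) ∧
      X - loopJ Sm (βA n) ∈ filt Sm n (2 * n + 1) 0 ∧ X ^ (2 * n + 1 + 1) = lamL Sm • X ∧
      derM n dX X + ((loopJ Sm (βA n) + cstM U) * X - X * (loopJ Sm (βA n) + cstM U)) = 0 := by
    rintro P ⟨h1, h2, h3, h4⟩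
    obtain ⟨X, m, hXm, hX, hE⟩ := exists_lift_resolvent (M := 2 * n + 1) hu h1 h3
    have hpow1 : X ^ (2 * n + 1) = lamL Sm • (1 : LMat Sm n) := by
      refine LMat.ext_ev fun p => ?_
      rw [map_pow, evLM_smul, evL_lamL, map_one]
      refine eq_smul_one_of_isConj (hX p.1 p.2 ▸ h4 p.1) ?_
      rw [JA_eq, ← evLM_loopJ p, ← map_pow, loopJ_A_pow, scL, evLM_smul, evL_lamL, map_one]
    have hpow : X ^ (2 * n + 1 + 1) = lamL Sm • X := by
      rw [pow_succ, hpow1, smul_mul_assoc, one_mul]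
    obtain ⟨a, ha⟩ := hL.exists_leading_one dX (hUV.cstM_mem _) hXm hE (Or.inl rfl) hpow
    -- In type A no normalization is needed: comparing leading terms in X^{2n+1} = λ gives a^{2n+1}
    -- = 1, and an odd power is injective on the reals.
    have ha1 : a = 1 := by
      have haJ : (HahnSeries.C a : LaurentSeries Sm) • loopJ Sm (βA n) ∈ filt Sm n (2 * n + 1) 1 := by
        rw [← scL_mul, HahnSeries.C_apply]
        exact hL.filtr.mul' (filt_scalar _ _) hL.mem (by simp)
      have hX1 : X ∈ filt Sm n (2 * n + 1) 1 := by
        have := add_mem (filt_mono (by omega) ha) haJ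
        simpa using this
      have h6 := hL.pow_sub_mem hX1 haJ ha (2 * n + 1) 0 0 (-1) (by push_cast; simp)
      rw [hpow1, smul_pow, loopJ_A_pow, scL, Matrix.sub_apply, Matrix.smul_apply, Matrix.smul_apply,
        Matrix.smul_apply, Matrix.one_apply_eq, smul_eq_mul, smul_eq_mul, mul_one,
        ← map_pow, HahnSeries.C_apply, lamL, HahnSeries.single_mul_single, zero_add,
        mul_one, HahnSeries.coeff_sub, HahnSeries.coeff_single_same, HahnSeries.coeff_single_same] at h6
      refine Sm.ext_ev fun p => ?_
      have h8 := congrArg (ev p) h6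
      rw [map_sub, map_one, map_pow, map_zero, sub_eq_zero] at h8
      rw [map_one]
      have hodd : Odd (2 * n + 1) := ⟨n, rfl⟩
      refine hodd.strictMono_pow.injective ?_
      simp only [one_pow]
      exact h8.symm
    rw [ha1, map_one, one_smul] at ha
    exact ⟨X, hX, ha, hpow, hE⟩
  obtain ⟨X, hX, h1, h2, h3⟩ := key P hP
  obtain ⟨X', hX', h1', h2', h3'⟩ := key P' hP'
  have : X = X' := hL.eq_of_eqn dX hD hUV h1 h1' h2 h2' h3 h3'
  funext x
  rw [← hX x 0, ← hX' x 0, this]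

theorem IsRes.isS (hn : 1 ≤ n) {U : SMat n} {S : LMat Sm n}
    (h : IsRes dX (2 * n + 1) (-1) (loopJ Sm (βA n)) U S) (t : ℝ) :
    IsS n (fun x => evM (x, t) U) fun x => evLM (x, t) S := by
  have hL := isLoopType_A (R := Sm) hn
  have hS1 : S ∈ filt Sm n (2 * n + 1) 1 := by
    have := add_mem (filt_mono (by omega) h.sub_mem) hL.mem
    simpa using this
  refine ⟨isSmoothLoop_evLM (by omega) hS1 t, fun x k => ⟨?_, ?_⟩, ?_, fun x => h.isConj _⟩
  · obtain ⟨T, Y, hTY, hYT, hS⟩ := h.conj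
    have h1 : S.trace = 0 := by
      -- The symmetry alone does not make the trace zero in odd powers of λ; conjugacy to the
      -- traceless J does.
      rw [hS, Matrix.trace_mul_comm, ← mul_assoc, hYT, one_mul, isLoopType_A_trace hn]
    have h2 : (loopCoeff (evLM (x, t) S) k).trace = ev (x, t) (S.trace.coeff (-k)) := by
      rw [Matrix.trace, Matrix.trace, HahnSeries.coeff_sum, map_sum]
      rfl
    rw [h2, h1, HahnSeries.coeff_zero, map_zero]
  · have h1 := congrArg (evM (x, t)) (coefM_tau h.tau k)
    rw [map_neg, map_zsmul, map_mul, map_mul, evM_formM, evM_transpose, ← loopCoeff_evLM,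
      ← C_eq_formM] at h1
    have h2 : ((-1 : ℝ)) ^ k = ((((-1 : ℤˣ) ^ k : ℤˣ) : ℤ) : ℝ) := by
      rcases Int.even_or_odd k with hk | hk
      · rw [hk.neg_one_zpow, hk.neg_one_zpow]
        simp
      · rw [hk.neg_one_zpow, hk.neg_one_zpow]
        simp
    rw [h2, Int.cast_smul_eq_zsmul, h1, neg_add_cancel]
  · exact (commutesWith_iff (βA n) U S).2 h.eqn t

/-! ### The operators `Q` of the flows -/

/-- The pointwise properties of the right hand sides of the flows that the correspondence uses. -/
def IsFlowOp (n : ℕ) (Q : (ℝ → Mat n) → ℝ → Mat n) : Prop :=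
  ∀ U : SMat n, IsV U → ∃ Z : SMat n, IsSkew Z ∧ IsV (brkM dX U Z) ∧
    ∀ x t, Q (fun y => evM (y, t) U) x = evM (x, t) Z

theorem derM_pow {D : Derivation ℝ Sm Sm} {K S : LMat Sm n} (h : derM n D S + (K * S - S * K) = 0)
    (k : ℕ) : derM n D (S ^ (k + 1)) + (K * S ^ (k + 1) - S ^ (k + 1) * K) = 0 := by
  induction k with
  | zero => simpa using h
  | succ k ih =>
    rw [pow_succ, derM_mul]
    calc derM n D (S ^ (k + 1)) * S + S ^ (k + 1) * derM n D S + (K * (S ^ (k + 1) * S) -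
          S ^ (k + 1) * S * K)
        = (derM n D (S ^ (k + 1)) + (K * S ^ (k + 1) - S ^ (k + 1) * K)) * S +
          S ^ (k + 1) * (derM n D S + (K * S - S * K)) := by noncomm_ring
      _ = 0 := by rw [ih, h, zero_mul, mul_zero, add_zero]

theorem IsRes.eqn_pow {D : Derivation ℝ Sm Sm} {M : ℕ} {ε : ℤˣ} {J : LMat Sm n} {U : SMat n}
    {S : LMat Sm n} (h : IsRes D M ε J U S) (k : ℕ) :
    derM n D (S ^ (k + 1)) + ((J + cstM U) * S ^ (k + 1) - S ^ (k + 1) * (J + cstM U)) = 0 :=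
  derM_pow h.eqn k

/-- τ reverses products and τ(S) = -S, so odd powers of S satisfy the same symmetry. This is why the
flows are indexed by 2j - 1. -/
theorem IsRes.tau_pow {D : Derivation ℝ Sm Sm} {M : ℕ} {ε : ℤˣ} {J : LMat Sm n} {U : SMat n}
    {S : LMat Sm n} (h : IsRes D M ε J U S) {k : ℕ} (hk : Even k) :
    tauM ε (S ^ (k + 1)) = -S ^ (k + 1) := by
  rw [tauM_pow, h.tau, (Even.add_one hk).neg_pow]

theorem coefM_cstM_mul (X : SMat n) (Y : LMat Sm n) (k : ℤ) :
    coefM (cstM X * Y) k = X * coefM Y k := by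
  ext1 i j
  simp [coefM, Matrix.mul_apply, cstM_apply, HahnSeries.coeff_sum]

theorem coefM_mul_cstM (X : SMat n) (Y : LMat Sm n) (k : ℤ) :
    coefM (Y * cstM X) k = coefM Y k * X := by
  ext1 i j
  simp [coefM, Matrix.mul_apply, cstM_apply, HahnSeries.coeff_sum]

theorem coefM_lam_smul (X : LMat Sm n) (k : ℤ) : coefM (lamL Sm • X) k = coefM X (k - 1) := by
  ext1 i j
  rw [coefM, coefM, Matrix.map_apply, Matrix.map_apply, Matrix.smul_apply, smul_eq_mul, lamL,
    HahnSeries.coeff_single_mul, one_mul]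
  congr 1
  ring

/-- The coefficient of `λ^0` of the resolvent equation. -/
theorem brkM_coefM {D : Derivation ℝ Sm Sm} {β : Mat n} {U : SMat n} {X : LMat Sm n}
    (h : derM n D X + ((loopJ Sm β + cstM U) * X - X * (loopJ Sm β + cstM U)) = 0) :
    brkM D U (coefM X 0) =
      coefM X (-1) * β.map (algebraMap ℝ Sm) - β.map (algebraMap ℝ Sm) * coefM X (-1) := by
  have h1 := congrArg (fun Z => coefM Z 0) h
  simp only [loopJ, add_mul, mul_add, smul_mul_assoc, mul_smul_comm, coefM_add, coefM_sub, coefM_derM,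
    coefM_cstM_mul, coefM_mul_cstM, coefM_lam_smul, coefM_zero, zero_sub] at h1
  rw [brkM, ← sub_eq_zero, ← h1]
  noncomm_ring

/-- The difference of two corrections is skew and strictly upper triangular, so its first column
vanishes, and its bracket lies in V_n. Hence `eq_zero_of_brkM` applies. -/
theorem IsCorrection.eq {u A : ℝ → Mat n} (hu : MatSmooth n u) (huV : ∀ x, u x ∈ V n)
    (hA : MatSmooth n A) {η η' : ℝ → Mat n} (h : IsCorrection n u A η)
    (h' : IsCorrection n u A η') : η = η' := by
  set U := toSMat (fun p => u p.1) hu.lift with hU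
  have hUV : IsV U := isV_iff_evM.2 fun p => huV p.1
  set A' := toSMat (fun p => A p.1) hA.lift with hA'
  have key : ∀ η, ∀ h : IsCorrection n u A η,
      IsV (brkM dX U (A' - toSMat (fun p => η p.1) h.1.lift)) ∧
      IsSkew (toSMat (fun p => η p.1) h.1.lift) ∧
      ∀ i, (toSMat (fun p => η p.1) h.1.lift) i 0 = 0 := by
    intro η h
    refine ⟨isV_iff_evM.2 fun p => ?_, isSkew_iff_evM.2 fun p => ?_, fun i => Sm.ext_ev fun p => ?_⟩
    · obtain ⟨x, t⟩ := p
      rw [evM_brkM]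
      exact h.2.2 x
    · exact mem_so_iff.1 (h.2.1 p.1).1
    · exact (h.2.1 p.1).2 i 0 (Fin.zero_le _)
  obtain ⟨h1, h2, h3⟩ := key η h
  obtain ⟨h1', h2', h3'⟩ := key η' h'
  have hN := eq_zero_of_brkM (D := dX) hUV (h2'.sub h2)
    (fun i => by rw [Matrix.sub_apply, h3, h3', sub_zero]) (by
      have h4 := h1.sub h1'
      rw [← brkM_sub] at h4
      convert h4 using 2
      abel)
  funext x
  have := congrArg (evM (x, 0)) hN
  rw [map_sub, map_zero, sub_eq_zero] at this
  exact this.symm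

theorem exists_flow_op {U A : SMat n} (hU : IsV U) (hA : IsSkew A)
    (hbrk : ∀ i j, j < i → brkM dX U A i j = 0) :
    ∃ Z : SMat n, IsSkew Z ∧ IsV (brkM dX U Z) ∧ ∀ x t, evM (x, t) A -
      correction n (fun y => evM (y, t) U) (fun y => evM (y, t) A) x = evM (x, t) Z := by
  obtain ⟨Z, hZ, hV, hZA⟩ := exists_correction hU hA hbrk
  refine ⟨Z, hZ, hV, fun x t => ?_⟩
  have h1 : IsCorrection n (fun y => evM (y, t) U) (fun y => evM (y, t) A)
      fun y => evM (y, t) (A - Z) := by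
    refine ⟨(matSmooth_evM (A - Z)).slice t, fun y => ⟨?_, fun i j hij => ?_⟩, fun y => ?_⟩
    · exact mem_so_iff.2 (isSkew_iff_evM.1 (hA.sub hZ) _)
    · change evM (y, t) (A - Z) i j = 0
      rw [evM_apply, Matrix.sub_apply, hZA i j hij, sub_self, map_zero]
    · have h2 := isV_iff_evM.1 hV (y, t)
      rw [evM_brkM] at h2
      convert h2 using 3 with z
      simp only [map_sub, sub_sub_cancel]
  have h2 : correction n (fun y => evM (y, t) U) (fun y => evM (y, t) A) =
      fun y => evM (y, t) (A - Z) :=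
    IsCorrection.eq ((matSmooth_evM U).slice t) (fun y => isV_iff_evM.1 hU _)
      ((matSmooth_evM A).slice t) (Classical.epsilon_spec ⟨_, h1⟩) h1
  rw [h2]
  simp only [map_sub, sub_sub_cancel]

theorem isFlowOp_QB (hn : 1 ≤ n) {j : ℕ} (hj : 1 ≤ j) : IsFlowOp n (QB n j) := by
  intro U hU
  obtain ⟨S, hS⟩ := (isLoopType_B (R := Sm) hn).exists_isRes dX (derM_loopJ dX (βB n))
    (ε := 1) (Even.neg_one_pow ⟨n, by omega⟩) (tauM_loopJ 1 tau_βB) hU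
  -- The chosen resolvents for the separate values of t are, by uniqueness, the slices of one loop
  -- over `Sm`; this gives smoothness in t.
  have hP : ∀ t, P n (fun y => evM (y, t) U) = fun x => evLM (x, t) S := fun t =>
    IsP.eq hn ((matSmooth_evM U).slice t) (fun y => isV_iff_evM.1 hU _)
      (Classical.epsilon_spec ⟨_, hS.isP hn t⟩) (hS.isP hn t)
  obtain ⟨k, rfl⟩ : ∃ k, j = k + 1 := ⟨j - 1, by omega⟩
  have hk : 2 * (k + 1) - 1 = 2 * k + 1 := by omega
  have htau := hS.tau_pow (k := 2 * k) ⟨k, by omega⟩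
  have hskew : ∀ i, IsSkew (coefM (S ^ (2 * k + 1)) i) := fun i => coefM_skew htau (one_zpow i)
  have hcoeff : ∀ t, Pcoeff n (2 * (k + 1) - 1) 0 (fun y => evM (y, t) U) =
      fun x => evM (x, t) (coefM (S ^ (2 * k + 1)) 0) := fun t => by
    funext x
    rw [Pcoeff, hP, hk, ← map_pow, loopCoeff_evLM]
  -- The bracket is [X, β] with X the coefficient of λ⁻¹. As β lives near the upper right corner, an
  -- entry of the bracket below the diagonal involves only the lower left corner of X, which is zero
  -- by skewness.
  obtain ⟨Z, hZ, hV, hQ⟩ := exists_flow_op hU (hskew 0) fun i l hil => by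
    rw [brkM_coefM (hS.eqn_pow (2 * k)), Matrix.sub_apply]
    set X := coefM (S ^ (2 * k + 1)) (-1) with hX
    have hil' : (l : ℕ) < i := hil
    have hiL := i.isLt
    have hc : ∀ i l : Idx n, (i : ℕ) = 2 * n → (l : ℕ) = 0 → X i l = 0 := fun i l h1 h2 =>
      (hskew (-1)).corner (by omega)
    have h1 : (X * (βB n).map (algebraMap ℝ Sm)) i l = 0 := by
      rw [Matrix.mul_apply]
      refine Finset.sum_eq_zero fun q _ => ?_
      rw [Matrix.map_apply, βB_apply]
      split_ifs with h
      · rw [hc i q (by omega) (by omega), zero_mul]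
      · rw [map_zero, mul_zero]
    have h2 : ((βB n).map (algebraMap ℝ Sm) * X) i l = 0 := by
      rw [Matrix.mul_apply]
      refine Finset.sum_eq_zero fun q _ => ?_
      rw [Matrix.map_apply, βB_apply]
      split_ifs with h
      · rw [hc q l (by omega) (by omega), mul_zero]
      · rw [map_zero, zero_mul]
    rw [h1, h2, sub_zero]
  refine ⟨Z, hZ, hV, fun x t => ?_⟩
  rw [QB, hcoeff, hQ]

theorem isFlowOp_QA (hn : 1 ≤ n) {j : ℕ} (hj : 1 ≤ j) : IsFlowOp n (QA n j) := by
  intro U hU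
  obtain ⟨X, hX⟩ := (isLoopType_A (R := Sm) hn).exists_isRes dX (derM_loopJ dX (βA n))
    (ε := -1) (Odd.neg_one_pow ⟨n, by omega⟩) (tauM_loopJ (-1) tau_βA) hU
  have hP : ∀ t, S n (fun y => evM (y, t) U) = fun x => evLM (x, t) X := fun t =>
    IsS.eq hn ((matSmooth_evM U).slice t) (fun y => isV_iff_evM.1 hU _)
      (Classical.epsilon_spec ⟨_, hX.isS hn t⟩) (hX.isS hn t)
  obtain ⟨k, rfl⟩ : ∃ k, j = k + 1 := ⟨j - 1, by omega⟩
  have hk : 2 * (k + 1) - 1 = 2 * k + 1 := by omega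
  have htau := hX.tau_pow (k := 2 * k) ⟨k, by omega⟩
  have hcoeff : ∀ t, Scoeff n (2 * (k + 1) - 1) 0 (fun y => evM (y, t) U) =
      fun x => evM (x, t) (coefM (X ^ (2 * k + 1)) 0) := fun t => by
    funext x
    rw [Scoeff, hP, hk, ← map_pow, loopCoeff_evLM]
  -- Here β is the upper right corner unit, so the bracket is supported in the first row and the
  -- last column.
  obtain ⟨Z, hZ, hV, hQ⟩ := exists_flow_op hU (coefM_skew htau (zpow_zero _)) fun i l hil => by
    rw [brkM_coefM (hX.eqn_pow (2 * k)), Matrix.sub_apply]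
    have hil' : (l : ℕ) < i := hil
    have hiL := i.isLt
    rw [Matrix.mul_apply, Matrix.mul_apply, Finset.sum_eq_zero, Finset.sum_eq_zero, sub_zero]
    · intro q _
      rw [Matrix.map_apply, βA_apply, if_neg (by omega), map_zero, zero_mul]
    · intro q _
      rw [Matrix.map_apply, βA_apply, if_neg (by omega), map_zero, mul_zero]
  refine ⟨Z, hZ, hV, fun x t => ?_⟩
  rw [QA, hcoeff, hQ]

end

/-! ### Linear differential equations with parameters -/

section
open Topology
variable {E : Type*} [NormedAddCommGroup E] [NormedSpace ℝ E]

theorem continuous_primitive {f : ℝ × ℝ → E} (hf : Continuous f) :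
    Continuous fun p : ℝ × ℝ => ∫ s in (0 : ℝ)..p.1, f (s, p.2) := by
  refine intervalIntegral.continuous_parametric_intervalIntegral_of_continuous
    (f := fun (p : ℝ × ℝ) (s : ℝ) => f (s, p.2)) ?_ continuous_fst
  exact hf.comp (by fun_prop : Continuous fun q : (ℝ × ℝ) × ℝ => (q.2, q.1.2))

theorem hasDerivAt_primitive [CompleteSpace E] {f : ℝ × ℝ → E} (hf : Continuous f) (x t : ℝ) :
    HasDerivAt (fun y => ∫ s in (0 : ℝ)..y, f (s, t)) (f (x, t)) x :=
  (Continuous.integral_hasStrictDerivAt (hf.comp (by fun_prop : Continuous fun s : ℝ => (s, t)))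
    0 x).hasDerivAt

/-- A weight that turns the Volterra operator of a linear equation into a contraction. -/
theorem exists_weight {a : ℝ × ℝ → ℝ} (ha : Continuous a) :
    ∃ w : ℝ × ℝ → ℝ, Continuous w ∧ (∀ p, 1 ≤ w p) ∧ ∀ x t : ℝ, ∀ C : ℝ, 0 ≤ C → ∀ f : ℝ → E,
      (∀ s, ‖f s‖ ≤ C * (w (s, t) * a (s, t))) → ‖∫ s in (0 : ℝ)..x, f s‖ ≤ C * (w (x, t) / 2) := by
  set ψ : ℝ × ℝ → ℝ := fun p => ∫ s in (0 : ℝ)..p.1, a (s, p.2) with hψ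
  have hψc : Continuous ψ := continuous_primitive ha
  have hw : Continuous fun p => Real.cosh (2 * ψ p) := by
    have := Real.continuous_cosh
    fun_prop
  -- Since ψ has x-derivative a, the function sinh(2ψ)/2 is a primitive of w a, and |sinh| ≤ cosh
  -- gives the factor 1/2. The even function cosh serves both signs of x.
  refine ⟨fun p => Real.cosh (2 * ψ p), hw, fun p => Real.one_le_cosh _, fun x t C hC f hf => ?_⟩
  have hcont : Continuous fun s => C * (Real.cosh (2 * ψ (s, t)) * a (s, t)) := by fun_prop
  have h1 : ∫ s in (0 : ℝ)..x, C * (Real.cosh (2 * ψ (s, t)) * a (s, t))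
      = C * (Real.sinh (2 * ψ (x, t)) / 2) - C * (Real.sinh (2 * ψ (0, t)) / 2) := by
    refine intervalIntegral.integral_eq_sub_of_hasDerivAt (f := fun s => C * (Real.sinh (2 * ψ (s, t)) / 2))
      (fun s _ => ?_) (hcont.intervalIntegrable _ _)
    have h2 : HasDerivAt (fun y => ψ (y, t)) (a (s, t)) s := hasDerivAt_primitive ha s t
    have h3 := (((h2.const_mul 2).sinh).div_const 2).const_mul C
    exact h3.congr_deriv (by ring)
  have h0 : ψ (0, t) = 0 := by simp [hψ]
  refine (intervalIntegral.norm_integral_le_abs_of_norm_le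
    (Filter.Eventually.of_forall hf) (hcont.intervalIntegrable _ _)).trans ?_
  rw [h1, h0, mul_zero, Real.sinh_zero, zero_div, mul_zero, sub_zero, abs_mul, abs_of_nonneg hC]
  refine mul_le_mul_of_nonneg_left ?_ hC
  rw [abs_div, abs_two]
  refine div_le_div_of_nonneg_right ?_ (by norm_num)
  rw [abs_le]
  have h4 := Real.sinh_lt_cosh (2 * ψ (x, t))
  have h5 := Real.sinh_lt_cosh (-(2 * ψ (x, t)))
  rw [Real.sinh_neg, Real.cosh_neg] at h5
  exact ⟨by linarith, h4.le⟩

open BoundedContinuousFunction in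
/-- A linear equation with continuous coefficients has a solution that is continuous in the variable
and the parameter. -/
theorem exists_linear_solution [CompleteSpace E] {L : ℝ × ℝ → E →L[ℝ] E} (hL : Continuous L)
    (y₀ : E) : ∃ y : ℝ × ℝ → E, Continuous y ∧ (∀ t, y (0, t) = y₀) ∧
      ∀ x t, HasDerivAt (fun s => y (s, t)) (L (x, t) (y (x, t))) x := by
  obtain ⟨w, hwc, hw1, hwint⟩ := exists_weight (E := E) hL.norm
  have hw0 : ∀ p, 0 < w p := fun p => zero_lt_one.trans_le (hw1 p)
  have hint : ∀ z : (ℝ × ℝ) →ᵇ E, Continuous fun p => w p • L p (z p) := fun z =>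
    hwc.smul (hL.clm_apply z.continuous)
  have hbd : ∀ z : (ℝ × ℝ) →ᵇ E, ∀ p : ℝ × ℝ,
      ‖∫ s in (0 : ℝ)..p.1, w (s, p.2) • L (s, p.2) (z (s, p.2))‖ ≤ ‖z‖ * (w p / 2) := by
    intro z p
    refine hwint p.1 p.2 ‖z‖ (norm_nonneg _) _ fun s => ?_
    rw [norm_smul, Real.norm_of_nonneg (hw0 _).le]
    have h1 := (L (s, p.2)).le_opNorm (z (s, p.2))
    have h2 := mul_le_mul_of_nonneg_left (z.norm_coe_le_norm (s, p.2)) (norm_nonneg (L (s, p.2)))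
    have h3 := mul_le_mul_of_nonneg_left (h1.trans h2) (hw0 (s, p.2)).le
    linarith
  -- The unknown is z = y/w, which stays bounded on the whole plane. The integral equation for z is
  -- then a contraction in the sup norm, and its fixed point is at once global and continuous in the
  -- parameter.
  let T : ((ℝ × ℝ) →ᵇ E) → ((ℝ × ℝ) →ᵇ E) := fun z =>
    BoundedContinuousFunction.ofNormedAddCommGroup
      (fun p => (w p)⁻¹ • (y₀ + ∫ s in (0 : ℝ)..p.1, w (s, p.2) • L (s, p.2) (z (s, p.2))))
      ((hwc.inv₀ fun p => (hw0 p).ne').smul (continuous_const.add (continuous_primitive (hint z))))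
      (‖y₀‖ + ‖z‖ / 2) fun p => by
        rw [norm_smul, norm_inv, Real.norm_of_nonneg (hw0 p).le, inv_mul_le_iff₀ (hw0 p)]
        refine (norm_add_le _ _).trans ((add_le_add_right (hbd z p) _).trans ?_)
        have := mul_le_mul_of_nonneg_right (hw1 p) (norm_nonneg y₀)
        linarith
  have hT : ContractingWith (1 / 2 : NNReal) T := by
    refine ⟨by rw [← NNReal.coe_lt_coe]; norm_num, LipschitzWith.of_dist_le_mul fun z z' => ?_⟩
    rw [dist_le (by positivity)]
    intro p
    have h1 : ∀ z : (ℝ × ℝ) →ᵇ E, IntervalIntegrable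
        (fun s => w (s, p.2) • L (s, p.2) (z (s, p.2))) MeasureTheory.volume 0 p.1 := fun z =>
      ((hint z).comp (by fun_prop : Continuous fun s : ℝ => (s, p.2))).intervalIntegrable _ _
    have h2 : T z p - T z' p = (w p)⁻¹ •
        ∫ s in (0 : ℝ)..p.1, w (s, p.2) • L (s, p.2) ((z - z') (s, p.2)) := by
      change (w p)⁻¹ • (y₀ + _) - (w p)⁻¹ • (y₀ + _) = _
      rw [← smul_sub, add_sub_add_left_eq_sub, ← intervalIntegral.integral_sub (h1 z) (h1 z')]
      simp only [← smul_sub, ← map_sub, BoundedContinuousFunction.sub_apply]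
    rw [dist_eq_norm, h2, norm_smul, norm_inv, Real.norm_of_nonneg (hw0 p).le,
      inv_mul_le_iff₀ (hw0 p), dist_eq_norm]
    refine (hbd (z - z') p).trans (le_of_eq ?_)
    push_cast
    ring
  obtain ⟨z, hz⟩ : ∃ z, T z = z := ⟨_, hT.fixedPoint_isFixedPt⟩
  have hy : ∀ p, w p • z p = y₀ + ∫ s in (0 : ℝ)..p.1, w (s, p.2) • L (s, p.2) (z (s, p.2)) := by
    intro p
    conv_lhs => rw [← hz]
    exact smul_inv_smul₀ (hw0 p).ne' _
  refine ⟨fun p => w p • z p, hwc.smul z.continuous, fun t => ?_, fun x t => ?_⟩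
  · simp only [hy]
    simp
  · simp only [map_smul]
    refine HasDerivAt.congr_of_eventuallyEq ((hasDerivAt_primitive (hint z) x t).const_add y₀) ?_
    exact Filter.Eventually.of_forall fun s => hy (s, t)

/-- A function that factors through its increment is differentiable. -/
theorem hasDerivAt_of_factor {f L : ℝ → E} {s : ℝ} (hL : ContinuousAt L s)
    (h : ∀ t, f t = f s + (t - s) • L t) : HasDerivAt f (L s) s := by
  rw [hasDerivAt_iff_tendsto_slope]
  refine (hL.tendsto.mono_left nhdsWithin_le_nhds).congr' ?_
  filter_upwards [self_mem_nhdsWithin] with t ht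
  have ht' : t - s ≠ 0 := sub_ne_zero.2 ht
  rw [slope_def_module, h t, add_sub_cancel_left, smul_smul, inv_mul_cancel₀ ht', one_smul]

end

section
variable {𝔸 : Type*} [NormedRing 𝔸] [NormedAlgebra ℝ 𝔸] [CompleteSpace 𝔸]

/-- The fundamental solution of a linear equation, with its inverse. -/
theorem exists_fundamental (hinv : ∀ a c : 𝔸, a * c = 1 → c * a = 1) {A : ℝ × ℝ → 𝔸}
    (hA : Continuous A) : ∃ G H : ℝ × ℝ → 𝔸, Continuous G ∧ Continuous H ∧ (∀ t, G (0, t) = 1) ∧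
      (∀ t, H (0, t) = 1) ∧ (∀ p, G p * H p = 1) ∧ (∀ p, H p * G p = 1) ∧
      (∀ x t, HasDerivAt (fun s => G (s, t)) (G (x, t) * A (x, t)) x) ∧
      ∀ x t, HasDerivAt (fun s => H (s, t)) (-(A (x, t) * H (x, t))) x := by
  obtain ⟨G, hG, hG0, hGd⟩ := exists_linear_solution
    (L := fun p => (ContinuousLinearMap.mul ℝ 𝔸).flip (A p))
    ((ContinuousLinearMap.continuous _).comp hA) (1 : 𝔸)
  obtain ⟨H, hH, hH0, hHd⟩ := exists_linear_solution
    (L := fun p => -(ContinuousLinearMap.mul ℝ 𝔸) (A p))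
    ((ContinuousLinearMap.continuous _).comp hA).neg (1 : 𝔸)
  have hGd' : ∀ x t, HasDerivAt (fun s => G (s, t)) (G (x, t) * A (x, t)) x := hGd
  have hHd' : ∀ x t, HasDerivAt (fun s => H (s, t)) (-(A (x, t) * H (x, t))) x := hHd
  have hGH : ∀ p, G p * H p = 1 := by
    rintro ⟨x, t⟩
    have h1 : ∀ s, HasDerivAt (fun s => G (s, t) * H (s, t)) 0 s := by
      intro s
      have := (hGd' s t).mul (hHd' s t)
      exact this.congr_deriv (by noncomm_ring)
    have h2 := is_const_of_deriv_eq_zero (fun s => (h1 s).differentiableAt)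
      (fun s => (h1 s).deriv) x 0
    rw [h2, hG0, hH0, mul_one]
  exact ⟨G, H, hG, hH, hG0, hH0, hGH, fun p => hinv _ _ (hGH p), hGd', hHd'⟩

/-- Hadamard's lemma: N is the mean of ∂_t A over the segment from s to t. It allows the frame to be
differentiated in t without a theorem on the dependence of solutions on parameters. -/
theorem exists_increment {A : ℝ × ℝ → 𝔸} (hA : ContDiff ℝ ∞ A) (s : ℝ) : ∃ N : ℝ × ℝ → 𝔸,
    Continuous N ∧ (∀ y t, A (y, t) = A (y, s) + (t - s) • N (y, t)) ∧
      ∀ y, N (y, s) = deriv (fun t => A (y, t)) s := by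
  have hd : ∀ y t, HasDerivAt (fun t => A (y, t)) (fderiv ℝ A (y, t) (0, 1)) t := by
    intro y t
    have h := (hA.differentiable (by simp) (y, t)).hasFDerivAt
    have h2 : HasDerivAt (fun z : ℝ => (y, z)) ((0 : ℝ), (1 : ℝ)) t :=
      (hasDerivAt_const t y).prodMk (hasDerivAt_id t)
    exact h.comp_hasDerivAt t h2
  have hc : Continuous fun p : ℝ × ℝ => fderiv ℝ A p (0, 1) :=
    (hA.continuous_fderiv (by simp)).clm_apply continuous_const
  refine ⟨fun p => ∫ θ in (0 : ℝ)..1, fderiv ℝ A (p.1, s + θ * (p.2 - s)) (0, 1), ?_, ?_, ?_⟩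
  · refine intervalIntegral.continuous_parametric_intervalIntegral_of_continuous'
      (f := fun (p : ℝ × ℝ) (θ : ℝ) => fderiv ℝ A (p.1, s + θ * (p.2 - s)) (0, 1)) ?_ 0 1
    exact hc.comp (by fun_prop : Continuous fun q : (ℝ × ℝ) × ℝ => (q.1.1, s + q.2 * (q.1.2 - s)))
  · intro y t
    have h1 : ∀ θ : ℝ, HasDerivAt (fun θ => A (y, s + θ * (t - s)))
        ((t - s) • fderiv ℝ A (y, s + θ * (t - s)) (0, 1)) θ := by
      intro θ
      have h2 : HasDerivAt (fun θ : ℝ => s + θ * (t - s)) (t - s) θ := by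
        simpa using ((hasDerivAt_id θ).mul_const (t - s)).const_add s
      exact (hd y (s + θ * (t - s))).scomp θ h2
    have h3 : Continuous fun θ : ℝ => (t - s) • fderiv ℝ A (y, s + θ * (t - s)) (0, 1) :=
      (hc.comp (by fun_prop : Continuous fun θ : ℝ => (y, s + θ * (t - s)))).const_smul (t - s)
    have h4 := intervalIntegral.integral_eq_sub_of_hasDerivAt (fun θ _ => h1 θ)
      (h3.intervalIntegrable 0 1)
    rw [intervalIntegral.integral_smul] at h4
    simp only
    rw [h4]
    simp
  · intro y
    rw [(hd y s).deriv]
    simp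

/-- A flat connection has a parallel frame: the differential equations hold. -/
theorem exists_flat_frame_aux (hinv : ∀ a c : 𝔸, a * c = 1 → c * a = 1) {A B : ℝ × ℝ → 𝔸}
    (hA : ContDiff ℝ ∞ A) (hB : Continuous B)
    (hflat : ∀ x t, HasDerivAt (fun y => B (y, t))
      (deriv (fun s => A (x, s)) t - (A (x, t) * B (x, t) - B (x, t) * A (x, t))) x) :
    ∃ g k : ℝ × ℝ → 𝔸, Continuous g ∧ g (0, 0) = 1 ∧ (∀ p, g p * k p = 1) ∧ (∀ p, k p * g p = 1) ∧
      (∀ x t, HasDerivAt (fun y => g (y, t)) (g (x, t) * A (x, t)) x) ∧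
      ∀ x t, HasDerivAt (fun s => g (x, s)) (g (x, t) * B (x, t)) t := by
  obtain ⟨G, H, hG, hH, hG0, hH0, hGH, hHG, hGd, hHd⟩ := exists_fundamental hinv hA.continuous
  obtain ⟨h', k', hh', hk', hh0, hk0, hhk, hkh, hhd, -⟩ := exists_fundamental hinv
    (A := fun p => B (0, p.1)) (hB.comp (by fun_prop : Continuous fun p : ℝ × ℝ => ((0 : ℝ), p.1)))
  set h : ℝ → 𝔸 := fun t => h' (t, 0) with hh
  set k : ℝ → 𝔸 := fun t => k' (t, 0) with hk
  have hhc : Continuous h := hh'.comp (by fun_prop : Continuous fun t : ℝ => (t, (0 : ℝ)))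
  have hkc : Continuous k := hk'.comp (by fun_prop : Continuous fun t : ℝ => (t, (0 : ℝ)))
  have hhd : ∀ t, HasDerivAt h (h t * B (0, t)) t := fun t => hhd t 0
  have hhk : ∀ t, h t * k t = 1 := fun t => hhk _
  have hkh : ∀ t, k t * h t = 1 := fun t => hkh _
  -- G solves the equation in x with G(0,t) = 1, and h solves the equation in t along x = 0. The
  -- product keeps the x-equation and has the right t-derivative on that line; flatness carries it
  -- to all x.
  set g : ℝ × ℝ → 𝔸 := fun p => h p.2 * G p with hg
  set l : ℝ × ℝ → 𝔸 := fun p => H p * k p.2 with hl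
  have hgc : Continuous g := (hhc.comp continuous_snd).mul hG
  have hlc : Continuous l := hH.mul (hkc.comp continuous_snd)
  have hgl : ∀ p, g p * l p = 1 := fun p => by
    simp only [hg, hl]
    rw [mul_assoc, ← mul_assoc (G p), hGH, one_mul, hhk]
  have hlg : ∀ p, l p * g p = 1 := fun p => hinv _ _ (hgl p)
  have hgd : ∀ x t, HasDerivAt (fun y => g (y, t)) (g (x, t) * A (x, t)) x := fun x t => by
    have := (hGd x t).const_mul (h t)
    simpa only [hg, mul_assoc] using this
  have hld : ∀ x t, HasDerivAt (fun y => l (y, t)) (-(A (x, t) * l (x, t))) x := fun x t => by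
    have := (hHd x t).mul_const (k t)
    simpa only [hl, mul_assoc, neg_mul] using this
  have hg0 : ∀ t, g (0, t) = h t := fun t => by simp only [hg, hG0, mul_one]
  have hl0 : ∀ t, l (0, t) = k t := fun t => by simp only [hl, hH0, one_mul]
  refine ⟨g, l, hgc, ?_, hgl, hlg, hgd, fun x s => ?_⟩
  · rw [hg0]
    exact hh0 0
  · obtain ⟨N, hN, hAN, hNs⟩ := exists_increment hA s
    have hF : Continuous fun p : ℝ × ℝ => g p * N p * l (p.1, s) :=
      (hgc.mul hN).mul (hlc.comp (by fun_prop))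
    -- The y-derivative of g(y,t) l(y,s) is g (A(y,t) - A(y,s)) l, which N writes as t - s times a
    -- continuous function.
    have h1 : ∀ t, g (x, t) * l (x, s) = h t * k s +
        (t - s) • ∫ y in (0 : ℝ)..x, g (y, t) * N (y, t) * l (y, s) := by
      intro t
      have h2 : ∀ y, HasDerivAt (fun y => g (y, t) * l (y, s))
          ((t - s) • (g (y, t) * N (y, t) * l (y, s))) y := by
        intro y
        have := (hgd y t).mul (hld y s)
        refine this.congr_deriv ?_
        rw [hAN y t, ← smul_mul_assoc, ← mul_smul_comm]
        noncomm_ring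
      have h3 := intervalIntegral.integral_eq_sub_of_hasDerivAt (a := 0) (b := x)
        (fun y _ => h2 y) (((hF.comp (by fun_prop : Continuous fun y : ℝ => (y, t))).const_smul
          (t - s)).intervalIntegrable _ _)
      simp only [hg0, hl0] at h3
      rw [intervalIntegral.integral_smul] at h3
      rw [h3]
      abel
    -- Flatness enters only here: it makes g B l a primitive of g (∂_t A) l at t = s.
    have h4 : ∫ y in (0 : ℝ)..x, g (y, s) * N (y, s) * l (y, s)
        = g (x, s) * B (x, s) * l (x, s) - h s * B (0, s) * k s := by
      have h5 : ∀ y, HasDerivAt (fun y => g (y, s) * B (y, s) * l (y, s))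
          (g (y, s) * N (y, s) * l (y, s)) y := by
        intro y
        have := ((hgd y s).mul (hflat y s)).mul (hld y s)
        refine this.congr_deriv ?_
        rw [hNs, Pi.mul_apply]
        noncomm_ring
      have := intervalIntegral.integral_eq_sub_of_hasDerivAt (a := 0) (b := x) (fun y _ => h5 y)
        ((hF.comp (by fun_prop : Continuous fun y : ℝ => (y, s))).intervalIntegrable _ _)
      rw [hg0, hl0] at this
      exact this
    have h6 : HasDerivAt (fun t => (t - s) • ∫ y in (0 : ℝ)..x, g (y, t) * N (y, t) * l (y, s))
        (∫ y in (0 : ℝ)..x, g (y, s) * N (y, s) * l (y, s)) s := by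
      refine hasDerivAt_of_factor
        (L := fun t => ∫ y in (0 : ℝ)..x, g (y, t) * N (y, t) * l (y, s)) ?_ fun t => by simp
      exact ((continuous_primitive hF).comp
        (by fun_prop : Continuous fun t : ℝ => (x, t))).continuousAt
    have h7 : HasDerivAt (fun t => g (x, t) * l (x, s)) (g (x, s) * B (x, s) * l (x, s)) s := by
      simp only [h1]
      have := ((hhd s).mul_const (k s)).add h6
      rw [h4] at this
      exact this.congr_deriv (by abel)
    have h8 := h7.mul_const (g (x, s))
    simp only [mul_assoc, hlg, mul_one] at h8
    exact h8

omit [CompleteSpace 𝔸] in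
-- Bootstrap: continuous partial derivatives make g differentiable, and its differential is linear
-- in gA and gB, so each order of differentiability of g yields the next.
theorem contDiff_of_connection {g A B : ℝ × ℝ → 𝔸} (hA : ContDiff ℝ ∞ A) (hB : ContDiff ℝ ∞ B)
    (hg : Continuous g) (hx : ∀ x t, HasDerivAt (fun y => g (y, t)) (g (x, t) * A (x, t)) x)
    (ht : ∀ x t, HasDerivAt (fun s => g (x, s)) (g (x, t) * B (x, t)) t) : ContDiff ℝ ∞ g := by
  let S : 𝔸 →L[ℝ] (ℝ →L[ℝ] 𝔸) := ContinuousLinearMap.smulRightL ℝ ℝ 𝔸 (ContinuousLinearMap.id ℝ ℝ)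
  have hS : ∀ a : 𝔸, S a = ContinuousLinearMap.toSpanSingleton ℝ a := fun a => by
    ext
    simp [S]
  let P₁ : (ℝ →L[ℝ] 𝔸) →L[ℝ] (ℝ × ℝ →L[ℝ] 𝔸) :=
    (ContinuousLinearMap.compL ℝ (ℝ × ℝ) ℝ 𝔸).flip (ContinuousLinearMap.fst ℝ ℝ ℝ)
  let P₂ : (ℝ →L[ℝ] 𝔸) →L[ℝ] (ℝ × ℝ →L[ℝ] 𝔸) :=
    (ContinuousLinearMap.compL ℝ (ℝ × ℝ) ℝ 𝔸).flip (ContinuousLinearMap.snd ℝ ℝ ℝ)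
  have hd : ∀ p, HasFDerivAt g (P₁ (S (g p * A p)) + P₂ (S (g p * B p))) p := by
    intro p
    have := hasStrictFDerivAt_uncurry_coprod (𝕜 := ℝ) (u := p) (f := fun x t => g (x, t))
      (f₁ := fun x t => S (g (x, t) * A (x, t))) (f₂ := fun x t => S (g (x, t) * B (x, t)))
      (Filter.Eventually.of_forall fun v => by
        have := (hx v.1 v.2).hasFDerivAt
        rw [← hS] at this
        exact this)
      (Filter.Eventually.of_forall fun v => by
        have := (ht v.1 v.2).hasFDerivAt
        rw [← hS] at this
        exact this)
      (S.continuous.comp (hg.mul hA.continuous)).continuousAt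
      (S.continuous.comp (hg.mul hB.continuous)).continuousAt
    refine HasFDerivAt.congr_fderiv this.hasFDerivAt ?_
    ext <;> simp [P₁, P₂, Function.HasUncurry.uncurry]
  rw [contDiff_infty]
  intro k
  induction k with
  | zero => exact contDiff_zero.2 hg
  | succ k ih =>
    have := contDiff_succ_iff_hasFDerivAt (𝕜 := ℝ) (f := g) (n := k)
    push_cast
    rw [this]
    refine ⟨_, ?_, hd⟩
    have hA' : ContDiff ℝ k A := hA.of_le (by exact_mod_cast le_top)
    have hB' : ContDiff ℝ k B := hB.of_le (by exact_mod_cast le_top)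
    exact ((P₁.comp S).contDiff.comp (ih.mul hA')).add ((P₂.comp S).contDiff.comp (ih.mul hB'))

/-- A flat connection has a parallel frame. -/
theorem exists_flat_frame (hinv : ∀ a c : 𝔸, a * c = 1 → c * a = 1) {A B : ℝ × ℝ → 𝔸}
    (hA : ContDiff ℝ ∞ A) (hB : ContDiff ℝ ∞ B)
    (hflat : ∀ x t, HasDerivAt (fun y => B (y, t))
      (deriv (fun s => A (x, s)) t - (A (x, t) * B (x, t) - B (x, t) * A (x, t))) x) :
    ∃ g : ℝ × ℝ → 𝔸, ContDiff ℝ ∞ g ∧ g (0, 0) = 1 ∧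
      (∀ x t, HasDerivAt (fun y => g (y, t)) (g (x, t) * A (x, t)) x) ∧
      ∀ x t, HasDerivAt (fun s => g (x, s)) (g (x, t) * B (x, t)) t := by
  obtain ⟨g, k, hg, hg0, -, -, hx, ht⟩ := exists_flat_frame_aux hinv hA hB.continuous hflat
  exact ⟨g, contDiff_of_connection hA hB hg hx ht, hg0, hx, ht⟩

end

/-! #### Matrices -/

section
attribute [local instance] Matrix.linftyOpNormedRing Matrix.linftyOpNormedAlgebra
variable {n : ℕ}

/-- The entries of a matrix, as continuous linear maps. -/
def entryL (i j : Idx n) : Mat n →L[ℝ] ℝ :=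
  LinearMap.toContinuousLinearMap (Matrix.entryLinearMap ℝ ℝ i j)

theorem MatSmooth.contDiff {F : Type*} [NormedAddCommGroup F] [NormedSpace ℝ F] {A : F → Mat n}
    (hA : MatSmooth n A) : ContDiff ℝ ∞ A := by
  have h : A = fun x => ∑ i, ∑ j, A x i j • Matrix.single i j (1 : ℝ) := by
    funext x
    conv_lhs => rw [Matrix.matrix_eq_sum_single (A x)]
    simp
  rw [h]
  exact ContDiff.sum fun i _ => ContDiff.sum fun j _ => (hA i j).smul contDiff_const

theorem matSmooth_of_contDiff {F : Type*} [NormedAddCommGroup F] [NormedSpace ℝ F] {A : F → Mat n}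
    (hA : ContDiff ℝ ∞ A) : MatSmooth n A := fun i j => (entryL i j).contDiff.comp hA

theorem hasDerivAt_entry {A : ℝ → Mat n} {A' : Mat n} {x : ℝ} (h : HasDerivAt A A' x) (i j : Idx n) :
    HasDerivAt (fun y => A y i j) (A' i j) x :=
  (entryL i j).hasFDerivAt.comp_hasDerivAt x h

theorem hasDerivAt_matDeriv {A : ℝ → Mat n} {x : ℝ} (h : DifferentiableAt ℝ A x) :
    HasDerivAt A (matDeriv A x) x :=
  h.hasDerivAt.congr_deriv (Matrix.ext fun i j => (hasDerivAt_entry h.hasDerivAt i j).deriv.symm)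

/-- The parallel frame of a flat connection, in terms of matrices of smooth functions. -/
theorem exists_flat_frame_matrix {A B : SMat n} (hflat : matD dT A = matD dX B + (A * B - B * A)) :
    ∃ g : SMat n, evM (0, 0) g = 1 ∧ matD dX g = g * A ∧ matD dT g = g * B := by
  have hA := (matSmooth_evM A).contDiff
  have hB := (matSmooth_evM B).contDiff
  have slice_x : ∀ (X : SMat n) (x t : ℝ), HasDerivAt (fun y => evM (y, t) X)
      (evM (x, t) (matD dX X)) x := fun X x t => by
    rw [evM_matD_dX]
    exact hasDerivAt_matDeriv (((matSmooth_evM X).slice t).contDiff.differentiable (by simp) x)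
  have slice_t : ∀ (X : SMat n) (x t : ℝ), HasDerivAt (fun s => evM (x, s) X)
      (evM (x, t) (matD dT X)) t := fun X x t => by
    rw [evM_matD_dT]
    exact hasDerivAt_matDeriv (((matSmooth_evM X).comp
      (contDiff_const.prodMk contDiff_id : ContDiff ℝ ∞ fun s : ℝ => (x, s))).contDiff.differentiable
        (by simp) t)
  obtain ⟨g, hg, hg0, hgx, hgt⟩ := exists_flat_frame (𝔸 := Mat n)
    (fun a c h => mul_eq_one_comm.1 h) hA hB fun x t => by
      have h1 := slice_x B x t
      have h2 := (slice_t A x t).deriv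
      rw [h2, hflat, map_add, map_sub, map_mul, map_mul, add_sub_cancel_right]
      exact h1
  refine ⟨toSMat g (matSmooth_of_contDiff hg), by simpa using hg0, SMat.ext_ev fun p => ?_,
    SMat.ext_ev fun p => ?_⟩
  · obtain ⟨x, t⟩ := p
    rw [evM_matD_dX, map_mul]
    ext i j
    exact (hasDerivAt_entry (hgx x t) i j).deriv
  · obtain ⟨x, t⟩ := p
    rw [evM_matD_dT, map_mul]
    ext i j
    exact (hasDerivAt_entry (hgt x t) i j).deriv

end

/-! ### Moving frames over the ring of smooth functions -/

section
variable {n : ℕ}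

theorem form_eq_bil (X Y : Vec n) : form n X Y = bil ℝ n X Y := by
  rw [form, bil, C_eq_formM]

theorem ev_bil (p : ℝ × ℝ) (x y : Idx n → Sm) :
    ev p (bil Sm n x y) = bil ℝ n (fun i => ev p (x i)) fun i => ev p (y i) := by
  rw [bil, bil, RingHom.map_dotProduct]
  congr 1
  funext i
  rw [Function.comp_apply, RingHom.map_mulVec, formM_map]
  rfl

theorem derivation_bil (D : Derivation ℝ Sm Sm) (x y : Idx n → Sm) :
    D (bil Sm n x y) = bil Sm n (fun i => D (x i)) y + bil Sm n x fun i => D (y i) := by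
  have hF : ∀ i j, D (formM Sm n i j) = 0 := fun i j => congrFun (congrFun (matD_formM (D := D)) i) j
  simp only [bil, dotProduct, Matrix.mulVec, map_sum, Derivation.leibniz, smul_eq_mul, hF, mul_zero,
    add_zero, Finset.sum_add_distrib]
  rw [add_comm]
  congr 1
  exact Finset.sum_congr rfl fun i _ => mul_comm _ _

/-- A frame with its curvature. -/
structure IsFrame (g v : SMat n) : Prop where
  isV : IsV v
  gram : gᵀ * formM Sm n * g = formM Sm n
  eqn : matD dX g = g * (shiftM Sm n + v)

/-- The first column of a frame. -/
def curve (g : SMat n) (p : ℝ × ℝ) : Vec n := evM p g *ᵥ e₁ n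

theorem curve_apply (g : SMat n) (p : ℝ × ℝ) (i : Idx n) : curve g p i = ev p (g i 0) := by
  rw [curve, e₁, Matrix.mulVec_single_one]
  rfl

/-- The inverse of a matrix that preserves the form. -/
def adj {R : Type*} [CommRing R] (g : Matrix (Idx n) (Idx n) R) : Matrix (Idx n) (Idx n) R :=
  formM R n * gᵀ * formM R n

section
variable {R : Type*} [CommRing R] {g : Matrix (Idx n) (Idx n) R}

theorem adj_mul (h : gᵀ * formM R n * g = formM R n) : adj g * g = 1 := left_inv_of_gram h

theorem mul_adj (h : gᵀ * formM R n * g = formM R n) : g * adj g = 1 :=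
  mul_eq_one_comm.1 (adj_mul h)

theorem adj_mul_cancel (h : gᵀ * formM R n * g = formM R n) (X : Matrix (Idx n) (Idx n) R) :
    adj g * (g * X) = X := by rw [← Matrix.mul_assoc, adj_mul h, Matrix.one_mul]

theorem mul_adj_cancel (h : gᵀ * formM R n * g = formM R n) (X : Matrix (Idx n) (Idx n) R) :
    g * (adj g * X) = X := by rw [← Matrix.mul_assoc, mul_adj h, Matrix.one_mul]

theorem gram_of_mul_adj (h : g * adj g = 1) : gᵀ * formM R n * g = formM R n := by
  have h1 : adj g * g = 1 := mul_eq_one_comm.1 h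
  have h2 := congrArg (formM R n * ·) h1
  simp only [adj, ← Matrix.mul_assoc, formM_mul_self, Matrix.one_mul, Matrix.mul_one] at h2
  exact h2

theorem gram_mul {c : Matrix (Idx n) (Idx n) R} (hc : cᵀ * formM R n * c = formM R n)
    (h : gᵀ * formM R n * g = formM R n) : (c * g)ᵀ * formM R n * (c * g) = formM R n := by
  rw [Matrix.transpose_mul]
  calc gᵀ * cᵀ * formM R n * (c * g) = gᵀ * (cᵀ * formM R n * c) * g := by
        simp only [Matrix.mul_assoc]
    _ = formM R n := by rw [hc, h]

theorem gram_adj (h : gᵀ * formM R n * g = formM R n) :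
    (adj g)ᵀ * formM R n * adj g = formM R n := by
  have h1 : (adj g)ᵀ = formM R n * g * formM R n := by
    simp only [adj, Matrix.transpose_mul, formM_transpose, Matrix.transpose_transpose,
      Matrix.mul_assoc]
  have h2 : formM R n * formM R n * adj g = adj g := by rw [formM_mul_self, Matrix.one_mul]
  rw [h1, Matrix.mul_assoc (formM R n * g), formM_mul_self, Matrix.mul_one, Matrix.mul_assoc,
    mul_adj h, Matrix.mul_one]

end

theorem evM_gram {g : SMat n} (h : gᵀ * formM Sm n * g = formM Sm n) (p : ℝ × ℝ) :
    (evM p g)ᵀ * formM ℝ n * evM p g = formM ℝ n := by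
  rw [← evM_transpose, ← evM_formM p, ← map_mul, ← map_mul, h]

theorem IsFrame.isOrtho {g v : SMat n} (h : IsFrame g v) (p : ℝ × ℝ) : IsOrtho n (evM p g) :=
  isOrtho_iff.2 (evM_gram h.gram p)

theorem inv_eq_adj {g : Mat n} (h : gᵀ * formM ℝ n * g = formM ℝ n) : g⁻¹ = adj g :=
  Matrix.inv_eq_left_inv (adj_mul h)

theorem IsFrame.inv_mul_deriv {g v : SMat n} (h : IsFrame g v) (x t : ℝ) :
    (evM (x, t) g)⁻¹ * matDeriv (fun y => evM (y, t) g) x - b n = evM (x, t) v := by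
  rw [← evM_matD_dX, h.eqn, map_mul, inv_eq_adj (evM_gram h.gram _),
    adj_mul_cancel (evM_gram h.gram _), map_add, evM_shiftM, b_eq_shiftM, add_sub_cancel_left]

/-- The lift of a moving frame to a frame over the ring of smooth functions. -/
theorem IsMovingFrame.exists_isFrame {γ : ℝ → Vec n} {g : ℝ → Mat n} (h : IsMovingFrame n γ g) :
    ∃ v : SMat n, IsFrame (toSMat (fun p => g p.1) h.1.lift) v := by
  obtain ⟨h1, h2, h3, h4⟩ := h
  set G := toSMat (fun p => g p.1) h1.lift with hG
  have hgram : Gᵀ * formM Sm n * G = formM Sm n := SMat.ext_ev fun p => by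
    rw [map_mul, map_mul, evM_transpose, evM_formM]
    exact isOrtho_iff.1 (h2 p.1)
  refine ⟨adj G * matD dX G - shiftM Sm n, isV_iff_evM.2 fun p => ?_, hgram, ?_⟩
  · obtain ⟨x, t⟩ := p
    have h5 := h4 x
    rw [inv_eq_adj (isOrtho_iff.1 (h2 x)), b_eq_shiftM] at h5
    rw [map_sub, map_mul, evM_shiftM, evM_matD_dX, adj, map_mul, map_mul, evM_formM, evM_transpose]
    exact h5
  · rw [add_sub_cancel, mul_adj_cancel hgram]

theorem IsMovingFrame.eq {γ : ℝ → Vec n} {g g' : ℝ → Mat n} (h : IsMovingFrame n γ g)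
    (h' : IsMovingFrame n γ g') : g = g' := by
  obtain ⟨v, hv⟩ := h.exists_isFrame
  obtain ⟨v', hv'⟩ := h'.exists_isFrame
  have := frame_unique hv'.isV hv.isV hv'.gram hv.gram hv'.eqn hv.eqn fun i k hk =>
    Sm.ext_ev fun p => by
      have h1 := congrFun ((h.2.2.1 p.1 k hk).trans (h'.2.2.1 p.1 k hk).symm) i
      exact h1
  funext x
  exact congrArg (evM (x, 0)) this

theorem iteratedDeriv_eq_ev {γ : ℝ × ℝ → Vec n} {c : Idx n → Sm}
    (hc : ∀ p i, γ p i = ev p (c i)) (t : ℝ) (k : ℕ) :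
    iteratedDeriv k (fun x => γ (x, t)) = fun x i => ev (x, t) (dX^[k] (c i)) := by
  induction k with
  | zero =>
    rw [iteratedDeriv_zero]
    funext x i
    exact hc _ i
  | succ k ih =>
    rw [iteratedDeriv_succ, ih]
    funext x
    refine HasDerivAt.deriv (hasDerivAt_pi.2 fun i => ?_)
    rw [Function.iterate_succ_apply']
    exact Sm.hasDerivAt_x (dX^[k] (c i)) x t

/-- The products with γ^{(n)} come from differentiating ⟨γ^{(i)}, γ^{(n-1)}⟩ = 0. For i = n - 1 both
terms of the derivative coincide, and 2 is invertible. -/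
theorem gram_of_mem_M (hn : 1 ≤ n) {γ : ℕ → Idx n → Sm} (hγ : ∀ k i, dX (γ k i) = γ (k + 1) i)
    (hiso : ∀ i j, i < n → j < n → bil Sm n (γ i) (γ j) = 0) (hone : bil Sm n (γ n) (γ n) = 1)
    (i j : ℕ) (hi : i ≤ n) (hj : j ≤ n) :
    bil Sm n (γ i) (γ j) = if i = n ∧ j = n then 1 else 0 := by
  have hD : ∀ i j, dX (bil Sm n (γ i) (γ j)) =
      bil Sm n (γ (i + 1)) (γ j) + bil Sm n (γ i) (γ (j + 1)) := fun i j => by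
    rw [derivation_bil]
    simp only [hγ]
  have key : ∀ i, i < n → bil Sm n (γ i) (γ n) = 0 := by
    intro i hi
    have h1 := hD i (n - 1)
    rw [hiso i (n - 1) hi (by omega), map_zero, Nat.sub_add_cancel hn] at h1
    by_cases hi1 : i + 1 < n
    · rw [hiso (i + 1) (n - 1) hi1 (by omega), zero_add] at h1
      exact h1.symm
    · have hi2 : i = n - 1 := by omega
      have hi3 : i + 1 = n := by omega
      rw [← hi2, hi3, bil_comm] at h1
      exact eq_zero_of_add_self h1.symm
  rcases hi.lt_or_eq with h1 | h1 <;> rcases hj.lt_or_eq with h2 | h2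
  · rw [hiso i j h1 h2, if_neg (by omega)]
  · rw [h2, key i h1, if_neg (by omega)]
  · rw [h1, bil_comm, key j h2, if_neg (by omega)]
  · rw [h1, h2, hone, if_pos ⟨rfl, rfl⟩]

/-- A smooth family of isotropic curves is the family of first columns of a frame. -/
theorem exists_isFrame_of_mem_M (hn : 1 ≤ n) {γ : ℝ × ℝ → Vec n} (hγ : ContDiff ℝ ∞ γ)
    (hM : ∀ t, (fun x => γ (x, t)) ∈ M n) : ∃ g v : SMat n, IsFrame g v ∧ γ = curve g := by
  let c : Idx n → Sm := fun i => ⟨fun p => γ p i, contDiff_pi.1 hγ i⟩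
  have hc : ∀ p i, γ p i = ev p (c i) := fun p i => rfl
  have hit : ∀ x t k, iteratedDeriv k (fun x => γ (x, t)) x = fun i => ev (x, t) (dX^[k] (c i)) :=
    fun x t k => congrFun (iteratedDeriv_eq_ev hc t k) x
  have hD : ∀ k i, dX (dX^[k] (c i)) = dX^[k + 1] (c i) := fun k i =>
    (Function.iterate_succ_apply' dX k (c i)).symm
  obtain ⟨g, v, hv, hg, hE, hcol⟩ := exists_frame (D := dX) (fun k i => dX^[k] (c i)) hD
    (gram_of_mem_M hn hD (fun i j hi hj => Sm.ext_ev fun ⟨x, t⟩ => by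
        rw [ev_bil, ← hit, ← hit, ← form_eq_bil, map_zero]
        exact ((hM t).1.2.2 x).prop _ (Submodule.subset_span ⟨⟨i, hi⟩, rfl⟩) _
          (Submodule.subset_span ⟨⟨j, hj⟩, rfl⟩))
      (Sm.ext_ev fun ⟨x, t⟩ => by
        rw [ev_bil, ← hit, ← form_eq_bil, map_one]
        exact (hM t).2 x))
  refine ⟨g, v, ⟨hv, hg, hE⟩, ?_⟩
  funext p
  funext i
  rw [curve_apply, hcol i 0 (by simp)]
  exact hc p i

/-! ### The curve of a frame -/

namespace IsFrame
variable {g v : SMat n}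

theorem iterate (h : IsFrame g v) (i k : Idx n) (hk : (k : ℕ) ≤ n) :
    dX^[(k : ℕ)] (g i 0) = g i k := by
  obtain ⟨k, hk2⟩ := k
  simp only at hk ⊢
  induction k with
  | zero => rfl
  | succ k ih =>
    rw [Function.iterate_succ_apply', ih (by omega) (by omega), ← matD_apply, h.eqn,
      mul_shiftM_add_apply g v i ⟨k, by omega⟩ ⟨k + 1, hk2⟩ rfl,
      h.isV.mul_col_zero (by simp only; omega), add_zero]

theorem iteratedDeriv_curve (h : IsFrame g v) (x t : ℝ) (k : Idx n) (hk : (k : ℕ) ≤ n) :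
    iteratedDeriv k (fun y => curve g (y, t)) x = (evM (x, t) g).col k := by
  rw [iteratedDeriv_eq_ev (curve_apply g) t k]
  funext i
  simp only [h.iterate i k hk]
  rfl

theorem isMovingFrame (h : IsFrame g v) (t : ℝ) :
    IsMovingFrame n (fun x => curve g (x, t)) fun x => evM (x, t) g := by
  refine ⟨(matSmooth_evM g).slice t, fun x => h.isOrtho _, fun x k hk => ?_, fun x => ?_⟩
  · exact (h.iteratedDeriv_curve x t k hk).symm
  · rw [h.inv_mul_deriv]
    exact isV_iff_evM.1 h.isV _

theorem movingFrame_eq (h : IsFrame g v) (t : ℝ) :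
    movingFrame n (fun y => curve g (y, t)) = fun x => evM (x, t) g :=
  IsMovingFrame.eq (Classical.epsilon_spec ⟨_, h.isMovingFrame t⟩) (h.isMovingFrame t)

theorem Ψ_eq (h : IsFrame g v) (x t : ℝ) :
    Ψ n (fun y => curve g (y, t)) x = evM (x, t) v := by
  rw [Ψ, h.movingFrame_eq]
  exact h.inv_mul_deriv x t

/-- The derivatives of the first column in terms of the frame. -/
theorem exists_coords (h : IsFrame g v) (k : ℕ) : ∃ c : Idx n → Sm,
    (∀ i, dX^[k] (g i 0) = (g *ᵥ c) i) ∧ (∀ i : Idx n, k < i → c i = 0) ∧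
      ∀ i : Idx n, (i : ℕ) = k → c i = 1 := by
  induction k with
  | zero =>
    refine ⟨Pi.single 0 1, fun i => ?_, fun i hi => ?_, fun i hi => ?_⟩
    · rw [Matrix.mulVec_single_one]
      rfl
    · exact Pi.single_eq_of_ne (fun h0 => by simp [h0] at hi) _
    · have : i = 0 := Fin.ext hi
      rw [this, Pi.single_eq_same]
  | succ k ih =>
    obtain ⟨c, hc, hc0, hc1⟩ := ih
    have hv0 : ∀ i : Idx n, k < i → (v *ᵥ c) i = 0 := fun i hi => by
      rw [Matrix.mulVec, dotProduct]
      refine Finset.sum_eq_zero fun j _ => ?_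
      by_cases hji : j ≤ i
      · rw [h.isV.eq_zero_of_le hji, zero_mul]
      · rw [hc0 j (by rw [not_le, Fin.lt_def] at hji; omega), mul_zero]
    have hs : ∀ i p : Idx n, (i : ℕ) = p + 1 → (shiftM Sm n *ᵥ c) i = c p := fun i p hip => by
      rw [Matrix.mulVec, dotProduct, Finset.sum_eq_single p]
      · simp [shiftM, hip]
      · intro q _ hq
        have : (i : ℕ) ≠ q + 1 := fun h0 => hq (Fin.ext (by omega))
        simp [shiftM, this]
      · simp
    refine ⟨fun i => dX (c i) + (shiftM Sm n *ᵥ c) i + (v *ᵥ c) i, fun i => ?_, fun i hi => ?_,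
      fun i hi => ?_⟩
    · rw [Function.iterate_succ_apply', hc]
      have h1 : dX ((g *ᵥ c) i) = (matD dX g *ᵥ c) i + (g *ᵥ fun j => dX (c j)) i := by
        simp only [Matrix.mulVec, dotProduct, map_sum, Derivation.leibniz, smul_eq_mul, matD_apply,
          Finset.sum_add_distrib]
        rw [add_comm]
        congr 1
        exact Finset.sum_congr rfl fun j _ => mul_comm _ _
      have h2 : (fun i => dX (c i) + (shiftM Sm n *ᵥ c) i + (v *ᵥ c) i) =
          (fun i => dX (c i)) + (shiftM Sm n + v) *ᵥ c := by
        funext i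
        rw [Matrix.add_mulVec, Pi.add_apply, Pi.add_apply, add_assoc]
      rw [h1, h2, Matrix.mulVec_add, Pi.add_apply, Matrix.mulVec_mulVec, ← h.eqn, add_comm]
    · simp only
      rw [hc0 i (by omega), hv0 i (by omega), hs i ⟨i - 1, by omega⟩ (by simp only; omega),
        hc0 _ (by simp only; omega), map_zero, add_zero, add_zero]
    · simp only
      rw [hc0 i (by omega), hv0 i (by omega), hs i ⟨i - 1, by omega⟩ (by simp only; omega),
        hc1 _ (by simp only; omega), map_zero, add_zero, zero_add]

/-- In frame coordinates the derivatives of the first column form an upper triangular matrix with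
unit diagonal. -/
theorem linearIndependent (h : IsFrame g v) (x t : ℝ) : LinearIndependent ℝ
    fun k : Fin (2 * n + 1) => iteratedDeriv k (fun y => curve g (y, t)) x := by
  choose c hc hc0 hc1 using fun k : Idx n => h.exists_coords k
  set X : Mat n := Matrix.of fun i k => ev (x, t) (c k i) with hX
  have hdet : X.det = 1 := by
    rw [Matrix.det_of_isUpperTriangular]
    · refine Finset.prod_eq_one fun i _ => ?_
      rw [hX, Matrix.of_apply, hc1 i i rfl, map_one]
    · intro i j hij
      rw [hX, Matrix.of_apply, hc0 j i hij, map_zero]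
  have hgX : IsUnit (evM (x, t) g * X) := by
    refine IsUnit.mul ?_ ?_
    · exact IsUnit.of_mul_eq_one _ (mul_adj (evM_gram h.gram _))
    · rw [Matrix.isUnit_iff_isUnit_det, hdet]
      exact isUnit_one
  have hcol : (fun k : Fin (2 * n + 1) => iteratedDeriv k (fun y => curve g (y, t)) x) =
      (evM (x, t) g * X).col := ?_
  · rw [hcol]
    exact Matrix.linearIndependent_cols_of_isUnit hgX
  funext k i
  rw [iteratedDeriv_eq_ev (curve_apply g) t k]
  simp only [hc, Matrix.col_apply]
  rw [Matrix.mul_apply, Matrix.mulVec, dotProduct, map_sum]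
  simp only [map_mul]
  rfl

theorem form_col (h : IsFrame g v) (p : ℝ × ℝ) (i j : Idx n) :
    form n ((evM p g).col i) ((evM p g).col j) = formM ℝ n i j := by
  rw [← evM_gram h.gram p, gram_apply, form_eq_bil]
  rfl

/-- Let w lie in an isotropic space containing the first n columns. Pairing w with these columns
kills its frame coordinates beyond n, after which ⟨w,w⟩ is the square of coordinate n, so that one
vanishes too. -/
theorem maximal (h : IsFrame g v) (x t : ℝ) : Maximal (IsIsotropic n)
    (Submodule.span ℝ (Set.range fun k : Fin n => iteratedDeriv k (fun y => curve g (y, t)) x)) := by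
  set G := evM (x, t) g with hG
  have hgram := evM_gram h.gram (x, t)
  have hcol : ∀ k : Fin n, iteratedDeriv k (fun y => curve g (y, t)) x = G.col ⟨k, by omega⟩ :=
    fun k => h.iteratedDeriv_curve x t ⟨k, by omega⟩ k.isLt.le
  simp only [hcol]
  have hform : ∀ i j : Idx n, form n (G.col i) (G.col j) = formM ℝ n i j := h.form_col (x, t)
  refine ⟨?_, fun W hW hle w hw => ?_⟩
  · intro X hX Y hY
    refine Submodule.span_induction₂ (p := fun X Y _ _ => form n X Y = 0) ?_ ?_ ?_ ?_ ?_ ?_ ?_ hX hY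
    · rintro _ _ ⟨k, rfl⟩ ⟨l, rfl⟩
      rw [hform, formM, Matrix.of_apply, if_neg (by simp only; omega)]
    · intro y _
      simp [form]
    · intro y _
      simp [form]
    · intro a c d _ _ _ h1 h2
      rw [form, add_dotProduct]
      exact (congrArg₂ (· + ·) h1 h2).trans (add_zero 0)
    · intro a c d _ _ _ h1 h2
      rw [form, Matrix.mulVec_add, dotProduct_add]
      exact (congrArg₂ (· + ·) h1 h2).trans (add_zero 0)
    · intro r a c _ _ h1
      rw [form, smul_dotProduct]
      exact (congrArg (r • ·) h1).trans (smul_zero r)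
    · intro r a c _ _ h1
      rw [form, Matrix.mulVec_smul, dotProduct_smul]
      exact (congrArg (r • ·) h1).trans (smul_zero r)
  · set c := adj G *ᵥ w with hc
    have hw' : w = G *ᵥ c := by rw [hc, Matrix.mulVec_mulVec, mul_adj hgram, Matrix.one_mulVec]
    have hGG : ∀ a d : Vec n, form n (G *ᵥ a) (G *ᵥ d) = a ⬝ᵥ (formM ℝ n *ᵥ d) := by
      intro a d
      rw [form, C_eq_formM, Matrix.mulVec_mulVec, ← Matrix.vecMul_transpose, ← Matrix.dotProduct_mulVec,
        Matrix.mulVec_mulVec, ← Matrix.mul_assoc, hgram]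
    have hF : ∀ (d : Vec n) (i : Idx n), (formM ℝ n *ᵥ d) i = (-1) ^ (n + (i : ℕ)) * d i.rev := by
      intro d i
      simp [Matrix.mulVec, dotProduct, formM_apply]
    have hcj : ∀ j : Idx n, n < j → c j = 0 := by
      intro j hj
      have hjr := rev_val j
      have h1 := hW (G.col j.rev) (hle (Submodule.subset_span ⟨⟨(j.rev : ℕ), by omega⟩, rfl⟩)) w hw
      rw [hw', ← Matrix.mulVec_single_one, hGG, single_one_dotProduct, hF, Fin.rev_rev] at h1
      rcases neg_one_pow_eq_or ℝ (n + (j.rev : ℕ)) with h2 | h2 <;> rw [h2] at h1 <;> linarith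
    have hcn : c ⟨n, by omega⟩ = 0 := by
      have h1 := hW w hw w hw
      rw [hw', hGG, dotProduct, Finset.sum_eq_single (⟨n, by omega⟩ : Idx n)] at h1
      · rw [hF] at h1
        have h2 : (⟨n, by omega⟩ : Idx n).rev = ⟨n, by omega⟩ :=
          Fin.ext (by rw [rev_val]; simp only; omega)
        rw [h2, Even.neg_one_pow ⟨n, rfl⟩, one_mul] at h1
        exact mul_self_eq_zero.1 h1
      · intro i _ hi
        have hin : (i : ℕ) ≠ n := fun h0 => hi (Fin.ext h0)
        rcases lt_or_gt_of_ne hin with h2 | h2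
        · rw [hF, hcj i.rev (by rw [rev_val]; omega), mul_zero, mul_zero]
        · rw [hcj i h2, zero_mul]
      · simp
    have hsum : w = ∑ i : Idx n, c i • G.col i := by
      rw [hw']
      funext i
      simp [Matrix.mulVec, dotProduct, mul_comm]
    rw [hsum]
    refine Submodule.sum_mem _ fun i _ => ?_
    rcases lt_trichotomy (i : ℕ) n with h2 | h2 | h2
    · exact Submodule.smul_mem _ _ (Submodule.subset_span ⟨⟨i, h2⟩, rfl⟩)
    · have : i = ⟨n, by omega⟩ := Fin.ext h2
      rw [this, hcn, zero_smul]
      exact Submodule.zero_mem _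
    · rw [hcj i h2, zero_smul]
      exact Submodule.zero_mem _

theorem contDiff_curve (g : SMat n) : ContDiff ℝ ∞ (curve g) := by
  refine contDiff_pi.2 fun i => ?_
  simp only [curve_apply]
  exact (g i 0).contDiff

theorem mem_M (h : IsFrame g v) (t : ℝ) : (fun x => curve g (x, t)) ∈ M n := by
  refine ⟨⟨(contDiff_curve g).comp (contDiff_id.prodMk contDiff_const), fun x => h.linearIndependent x t,
    fun x => h.maximal x t⟩, fun x => ?_⟩
  have h1 := h.iteratedDeriv_curve x t ⟨n, by omega⟩ le_rfl
  simp only at h1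
  rw [h1, h.form_col, formM, Matrix.of_apply, if_pos (by simp only; omega)]
  exact Even.neg_one_pow ⟨n, rfl⟩

/-- The curve flow in terms of a frame. -/
theorem mem_curveFlow_iff (h : IsFrame g v) {Q : (ℝ → Mat n) → ℝ → Mat n} {Z : SMat n}
    (hZ : ∀ x t, Q (fun y => evM (y, t) v) x = evM (x, t) Z) :
    curve g ∈ CurveFlow n Q ↔ ∀ i, matD dT g i 0 = (g * Z) i 0 := by
  have h1 : ∀ x t, deriv (fun s => curve g (x, s)) t = fun i => ev (x, t) (matD dT g i 0) := by
    intro x t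
    refine HasDerivAt.deriv (hasDerivAt_pi.2 fun i => ?_)
    simp only [curve_apply]
    exact Sm.hasDerivAt_t (g i 0) x t
  have h2 : ∀ x t, (movingFrame n (fun y => curve g (y, t)) x *
      Q (Ψ n fun y => curve g (y, t)) x) *ᵥ e₁ n = fun i => ev (x, t) ((g * Z) i 0) := by
    intro x t
    have h3 : (Ψ n fun y => curve g (y, t)) = fun y => evM (y, t) v := by
      funext y
      exact h.Ψ_eq y t
    rw [h.movingFrame_eq, h3, hZ, ← map_mul]
    funext i
    exact curve_apply (g * Z) (x, t) i
  constructor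
  · rintro ⟨-, -, h3⟩ i
    refine Sm.ext_ev fun p => ?_
    obtain ⟨x, t⟩ := p
    have := h3 x t
    rw [h1, h2] at this
    exact congrFun this i
  · intro h3
    refine ⟨contDiff_curve g, h.mem_M, fun x t => ?_⟩
    rw [h1, h2]
    simp only [h3]

end IsFrame

/-! ### Evolution of frames, and reconstruction from the curvature -/

theorem IsV.matD {D : Derivation ℝ Sm Sm} {v : SMat n} (hv : IsV v) : IsV (matD D v) := by
  refine ⟨?_, fun i j hij => hv.2 i j fun h0 => hij ?_⟩
  · have h := congrArg (IsotropicFlow.matD D) hv.1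
    rw [matD_add, matD_mul, matD_mul, matD_formM, matD_zero, mul_zero, zero_mul, add_zero, zero_add,
      matD_transpose] at h
    exact h
  · rw [matD_apply, h0, map_zero]

/-- Along the curve flow the frame and the curvature evolve by `Q`. -/
theorem IsFrame.evolution {g v Z : SMat n} (h : IsFrame g v) (hZ : IsSkew Z)
    (hZV : IsV (brkM dX v Z)) (hcol : ∀ i, matD dT g i 0 = (g * Z) i 0) :
    matD dT g = g * Z ∧ matD dT v = brkM dX v Z := by
  obtain ⟨A, hA⟩ : ∃ A, A = adj g * matD dT g := ⟨_, rfl⟩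
  have hgA : matD dT g = g * A := by rw [hA, mul_adj_cancel h.gram]
  have hskew : IsSkew A := by
    have h1 := congrArg (matD dT) h.gram
    rw [matD_mul, matD_mul, matD_formM, mul_zero, add_zero, matD_transpose, hgA,
      Matrix.transpose_mul] at h1
    rw [IsSkew, ← h.gram, ← h1]
    simp only [Matrix.mul_assoc]
  -- Zero curvature: both orders of the mixed derivative of g are expanded and g is cancelled.
  have hv : matD dT v = brkM dX v A := by
    have h1 := matD_dX_dT g
    rw [hgA, matD_mul, h.eqn, matD_mul, hgA, matD_add] at h1
    have h2 : matD dT (shiftM Sm n) = 0 := by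
      ext1 i j
      simp only [matD_apply, shiftM, Matrix.of_apply, Matrix.zero_apply]
      split_ifs <;> simp
    rw [h2, zero_add] at h1
    have h3 : g * matD dT v = g * brkM dX v A := by
      rw [brkM, Matrix.mul_add, Matrix.mul_sub, ← Matrix.mul_assoc, ← Matrix.mul_assoc, ← sub_eq_zero]
      have h4 := sub_eq_zero.2 h1.symm
      rw [← h4]
      abel
    rw [← adj_mul_cancel h.gram (matD dT v), h3, adj_mul_cancel h.gram]
  -- The flow gives A and Z the same first column. The bracket of their difference is v_t minus the
  -- bracket of Z, and both are in V_n.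
  have hAZ : A - Z = 0 := by
    refine eq_zero_of_brkM (D := dX) h.isV (hskew.sub hZ) (fun i => ?_) ?_
    · have h1 : adj g * (matD dT g - g * Z) = A - Z := by
        rw [Matrix.mul_sub, adj_mul_cancel h.gram, hA]
      rw [← h1, Matrix.mul_apply]
      refine Finset.sum_eq_zero fun j _ => ?_
      rw [Matrix.sub_apply, hcol, sub_self, mul_zero]
    · rw [brkM_sub, ← hv]
      exact h.isV.matD.sub hZV
  rw [sub_eq_zero] at hAZ
  rw [← hAZ]
  exact ⟨hgA, hv⟩

theorem mem_kdVFlow_iff {Q : (ℝ → Mat n) → ℝ → Mat n} {v Z : SMat n} (hv : IsV v)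
    (hZ : ∀ x t, Q (fun y => evM (y, t) v) x = evM (x, t) Z) :
    (fun p => evM p v) ∈ KdVFlow n Q ↔ matD dT v = brkM dX v Z := by
  have h1 : ∀ t, Q (fun y => evM (y, t) v) = fun x => evM (x, t) Z := fun t => funext fun x => hZ x t
  constructor
  · rintro ⟨-, -, h2⟩
    refine SMat.ext_ev fun p => ?_
    obtain ⟨x, t⟩ := p
    rw [evM_matD_dT, evM_brkM, h2 x t, h1]
  · intro h2
    refine ⟨matSmooth_evM v, isV_iff_evM.1 hv, fun x t => ?_⟩
    rw [← evM_matD_dT, h2, evM_brkM, h1]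

/-- A constant matrix over the ring of smooth functions. -/
def cst (c : Mat n) : SMat n := c.map (algebraMap ℝ Sm)

theorem evM_cst (p : ℝ × ℝ) (c : Mat n) : evM p (cst c) = c := rfl

theorem IsFrame.cst_mul {g v : SMat n} (h : IsFrame g v) {c : Mat n} (hc : IsOrtho n c) :
    IsFrame (cst c * g) v := by
  refine ⟨h.isV, gram_mul ?_ h.gram, ?_⟩
  · refine SMat.ext_ev fun p => ?_
    rw [map_mul, map_mul, evM_transpose, evM_cst, evM_formM]
    exact isOrtho_iff.1 hc
  · rw [matD_mul, cst, matD_map_algebraMap, zero_mul, zero_add, h.eqn, Matrix.mul_assoc]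

theorem curve_cst_mul (c : Mat n) (g : SMat n) (p : ℝ × ℝ) :
    curve (cst c * g) p = c *ᵥ curve g p := by
  rw [curve, curve, map_mul, evM_cst, Matrix.mulVec_mulVec]

theorem Sm.eq_const {f : Sm} (hx : dX f = 0) (ht : dT f = 0) (p : ℝ × ℝ) : ev p f = ev (0, 0) f := by
  obtain ⟨x, t⟩ := p
  have h1 : ev (x, t) f = ev (0, t) f :=
    is_const_of_deriv_eq_zero (f := fun y => ev (y, t) f)
      (fun y => (f.hasDerivAt_x y t).differentiableAt)
      (fun y => by rw [← ev_dX, hx, map_zero]) x 0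
  have h2 : ev (0, t) f = ev (0, 0) f :=
    is_const_of_deriv_eq_zero (f := fun s => ev (0, s) f)
      (fun s => (f.hasDerivAt_t 0 s).differentiableAt)
      (fun s => by rw [← ev_dT, ht, map_zero]) t 0
  rw [h1, h2]

theorem SMat.eq_cst {X : SMat n} (hx : matD dX X = 0) (ht : matD dT X = 0) :
    X = cst (evM (0, 0) X) := by
  refine SMat.ext_ev fun p => ?_
  rw [evM_cst]
  ext i j
  exact Sm.eq_const (congrFun (congrFun hx i) j) (congrFun (congrFun ht i) j) p

/-- A matrix that preserves the form as an element of `O(n+1,n)`. -/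
theorem exists_mem_O {c : Mat n} (hc : IsOrtho n c) : ∃ c' ∈ O n, (c' : Mat n) = c := by
  have h := isOrtho_iff.1 hc
  exact ⟨⟨c, adj c, mul_adj h, adj_mul h⟩, hc, rfl⟩

/-- Two frames with the same connection differ by a constant element of `O(n+1,n)`. -/
theorem exists_O_of_frames {g h v w Z : SMat n} (hg : IsFrame g v) (hh : IsFrame h w) (hvw : v = w)
    (hgt : matD dT g = g * Z) (hht : matD dT h = h * Z) :
    ∃ c ∈ O n, ∀ p, curve h p = (c : Mat n) *ᵥ curve g p := by
  subst hvw
  set K := h * adj g with hK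
  have hKg : K * g = h := by rw [hK, Matrix.mul_assoc, adj_mul hg.gram, Matrix.mul_one]
  -- The quotient K = h g⁻¹ has zero derivative in every direction in which g and h satisfy the same
  -- equation.
  have key : ∀ (D : Derivation ℝ Sm Sm) (B : SMat n), matD D g = g * B → matD D h = h * B →
      matD D K = 0 := by
    intro D B h1 h2
    have h3 := congrArg (matD D) hKg
    rw [matD_mul, h1, h2, ← Matrix.mul_assoc, hKg, add_eq_right] at h3
    rw [← Matrix.mul_one (matD D K), ← mul_adj hg.gram, ← Matrix.mul_assoc, h3, Matrix.zero_mul]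
  have hc := SMat.eq_cst (key dX _ hg.eqn hh.eqn) (key dT Z hgt hht)
  obtain ⟨c, hcO, hcK⟩ := exists_mem_O (c := evM (0, 0) K)
    (isOrtho_iff.2 (evM_gram (gram_mul hh.gram (gram_adj hg.gram)) (0, 0)))
  refine ⟨c, hcO, fun p => ?_⟩
  rw [hcK, ← curve_cst_mul, ← hc, hKg]

/-- A solution of the evolution equation of the curvature is the curvature of a frame. -/
theorem exists_isFrame_of_flat {v Z : SMat n} (hv : IsV v) (hZ : IsSkew Z)
    (hflat : matD dT v = brkM dX v Z) : ∃ g, IsFrame g v ∧ matD dT g = g * Z := by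
  have h2 : matD dT (shiftM Sm n) = 0 := by
    ext1 i j
    simp only [matD_apply, shiftM, Matrix.of_apply, Matrix.zero_apply]
    split_ifs <;> simp
  obtain ⟨g, hg0, hgx, hgt⟩ := exists_flat_frame_matrix (A := shiftM Sm n + v) (B := Z) (by
    rw [matD_add, h2, zero_add, hflat, brkM])
  -- As B is skew, the two terms of the derivative of g C gᵀ C cancel. The product is thus constant,
  -- and it is 1 at the origin, so g preserves the form.
  have key : ∀ (D : Derivation ℝ Sm Sm) (B : SMat n), IsSkew B → matD D g = g * B →
      matD D (g * adj g) = 0 := by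
    intro D B hB h1
    have h3 : formM Sm n * Bᵀ * formM Sm n = -B := hB.conj
    rw [adj, matD_mul, matD_mul, matD_mul, matD_formM, matD_transpose, h1, Matrix.transpose_mul,
      zero_mul, zero_add, mul_zero, add_zero]
    have h4 : g * (formM Sm n * (Bᵀ * gᵀ) * formM Sm n) =
        g * (formM Sm n * Bᵀ * formM Sm n) * (formM Sm n * gᵀ * formM Sm n) := by
      simp only [Matrix.mul_assoc]
      rw [← Matrix.mul_assoc (formM Sm n) (formM Sm n), formM_mul_self, Matrix.one_mul]
    rw [h4, h3, Matrix.mul_neg, Matrix.neg_mul, add_neg_cancel]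
  have hc := SMat.eq_cst (key dX _ (isSkew_shiftM.add hv.1) hgx) (key dT Z hZ hgt)
  have h0 : evM (0, 0) (g * adj g) = 1 := by
    rw [adj, map_mul, map_mul, map_mul, evM_transpose, hg0, evM_formM, Matrix.transpose_one,
      Matrix.mul_one, formM_mul_self, Matrix.mul_one]
  have h1 : g * adj g = 1 := by
    rw [hc, h0]
    refine SMat.ext_ev fun p => ?_
    rw [evM_cst, map_one]
  exact ⟨g, ⟨hv, gram_of_mul_adj h1, hgx⟩, hgt⟩

/-- The correspondence between curve flows and flows of the curvature. -/
theorem correspondence (hn : 1 ≤ n) {Q : (ℝ → Mat n) → ℝ → Mat n} (hQ : IsFlowOp n Q) :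
    OInvariant n (CurveFlow n Q) ∧ ∃ F : ModO n (CurveFlow n Q) → KdVFlow n Q,
      (∀ γ : CurveFlow n Q, ∀ x t, (F (cls γ)).1 (x, t) = Ψ n (fun y => γ.1 (y, t)) x) ∧
      Function.Bijective F := by
  have hframe : ∀ γ ∈ CurveFlow n Q, ∃ g v Z : SMat n, IsFrame g v ∧ γ = curve g ∧ IsSkew Z ∧
      (∀ x t, Q (fun y => evM (y, t) v) x = evM (x, t) Z) ∧ matD dT g = g * Z ∧
      matD dT v = brkM dX v Z := by
    intro γ hγ
    obtain ⟨g, v, hgv, rfl⟩ := exists_isFrame_of_mem_M hn hγ.1 hγ.2.1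
    obtain ⟨Z, hZ, hZV, hZQ⟩ := hQ v hgv.isV
    obtain ⟨h1, h2⟩ := hgv.evolution hZ hZV ((hgv.mem_curveFlow_iff hZQ).1 hγ)
    exact ⟨g, v, Z, hgv, rfl, hZ, hZQ, h1, h2⟩
  refine ⟨fun c hc γ hγ => ?_, ?_⟩
  · obtain ⟨g, v, Z, hgv, rfl, -, hZQ, hgt, -⟩ := hframe γ hγ
    have h1 : (fun p => (c : Mat n) *ᵥ curve g p) = curve (cst (c : Mat n) * g) :=
      funext fun p => (curve_cst_mul _ _ _).symm
    rw [h1, (hgv.cst_mul hc).mem_curveFlow_iff hZQ]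
    intro i
    rw [matD_mul, cst, matD_map_algebraMap, zero_mul, zero_add, hgt, Matrix.mul_assoc]
  · have hmem : ∀ γ : CurveFlow n Q, (fun p : ℝ × ℝ => Ψ n (fun y => γ.1 (y, p.2)) p.1) ∈ KdVFlow n Q := by
      rintro ⟨γ, hγ⟩
      obtain ⟨g, v, Z, hgv, rfl, -, hZQ, -, hvt⟩ := hframe γ hγ
      have h1 : (fun p : ℝ × ℝ => Ψ n (fun y => curve g (y, p.2)) p.1) = fun p => evM p v :=
        funext fun p => hgv.Ψ_eq p.1 p.2
      simp only [h1]
      exact (mem_kdVFlow_iff hgv.isV hZQ).2 hvt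
    let f : CurveFlow n Q → KdVFlow n Q := fun γ => ⟨_, hmem γ⟩
    -- One direction makes the map well defined on orbits, as a constant left factor does not change
    -- the curvature. The other makes it injective: equal curvatures give equal Z, so both frames
    -- satisfy the same two linear equations.
    have hf : ∀ γ δ : CurveFlow n Q, (orbitSetoid n (CurveFlow n Q)).r γ δ ↔ f γ = f δ := by
      rintro ⟨γ, hγ⟩ ⟨δ, hδ⟩
      obtain ⟨g, v, Z, hgv, rfl, -, hZQ, hgt, -⟩ := hframe γ hγ
      obtain ⟨h, w, Z', hhw, rfl, -, hZQ', hht, -⟩ := hframe δ hδ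
      constructor
      · rintro ⟨c, hc, hcγ⟩
        refine Subtype.ext (funext fun p => ?_)
        have h1 : (fun y => curve h (y, p.2)) = fun y => curve (cst (c : Mat n) * g) (y, p.2) :=
          funext fun y => (hcγ (y, p.2)).trans (curve_cst_mul _ _ _).symm
        change Ψ n (fun y => curve g (y, p.2)) p.1 = Ψ n (fun y => curve h (y, p.2)) p.1
        rw [h1, (hgv.cst_mul hc).Ψ_eq, hgv.Ψ_eq]
      · intro hE
        have hvw : v = w := SMat.ext_ev fun p => by
          have := congrFun (congrArg Subtype.val hE) p
          change Ψ n (fun y => curve g (y, p.2)) p.1 = Ψ n (fun y => curve h (y, p.2)) p.1 at this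
          rwa [hgv.Ψ_eq, hhw.Ψ_eq] at this
        have hZZ : Z = Z' := SMat.ext_ev fun p => by
          rw [← hZQ p.1 p.2, ← hZQ' p.1 p.2, hvw]
        exact exists_O_of_frames hgv hhw hvw hgt (hZZ ▸ hht)
    refine ⟨Quotient.lift f fun γ δ h => (hf γ δ).1 h, fun γ x t => rfl, ?_, ?_⟩
    · intro a
      induction a using Quotient.inductionOn with
      | h γ =>
        intro c
        induction c using Quotient.inductionOn with
        | h δ => exact fun h => Quotient.sound ((hf γ δ).2 h)
    · rintro ⟨u, hu⟩
      set v := toSMat u hu.1 with hvd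
      have hv : IsV v := isV_iff_evM.2 hu.2.1
      obtain ⟨Z, hZ, hZV, hZQ⟩ := hQ v hv
      obtain ⟨g, hgv, hgt⟩ := exists_isFrame_of_flat hv hZ ((mem_kdVFlow_iff hv hZQ).1 hu)
      refine ⟨cls ⟨curve g, (hgv.mem_curveFlow_iff hZQ).2 fun i => by rw [hgt]⟩, ?_⟩
      exact Subtype.ext (funext fun p => hgv.Ψ_eq p.1 p.2)

end

end IsotropicFlow

end

/-! ### The main theorem -/

open IsotropicFlow
theorem mainTheorem3 (n j : ℕ) (hn : 1 ≤ n) (hj : 1 ≤ j) :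
    (OInvariant n (CurveFlow n (QB n j)) ∧
      ∃ F : ModO n (CurveFlow n (QB n j)) → KdVFlow n (QB n j),
        (∀ γ : CurveFlow n (QB n j), ∀ x t,
          (F (cls γ)).1 (x, t) = Ψ n (fun y => γ.1 (y, t)) x) ∧
        Function.Bijective F) ∧
    (¬ (2 * n + 1 ∣ 2 * j - 1) →
      OInvariant n (CurveFlow n (QA n j)) ∧
      ∃ F : ModO n (CurveFlow n (QA n j)) → KdVFlow n (QA n j),
        (∀ γ : CurveFlow n (QA n j), ∀ x t,
          (F (cls γ)).1 (x, t) = Ψ n (fun y => γ.1 (y, t)) x) ∧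
        Function.Bijective F) :=
  ⟨correspondence hn (isFlowOp_QB hn hj), fun _ => correspondence hn (isFlowOp_QA hn hj)⟩
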